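/- **Setting.** Let $\mathcal U,\mathcal V$ be finite sets with $|\mathcal U|=|\mathcal V|=n$ and let $M:\mathcal U\to\mathcal V$ be an (unknown) bijection. Two observation models are considered, each with a score matrix $G\in\mathbb R^{\mathcal U\times\mathcal V}$ of log-likelihood ratios and a signal strength $\zeta$. *Planted matching.* Given $\mu>0$, the weights $W_{u,v}$ are independent Gaussians of variance $1$, with mean $\mu$ if $v=M(u)$ and mean $0$ otherwise. Here $G_{u,v}=\mu W_{u,v}-\mu^2/2$ and $\zeta=\mu^2/2$. *Database alignment.* For finite index sets $\mathcal D_a,\mathcal D_b$, the feature vectors $A(u)\in\mathbb R^{\mathcal D_a}$ ($u\in\mathcal U$), $B(v)\in\mathbb R^{\mathcal D_b}$ ($v\in\mathcal V$) are jointly Gaussian; the $A(u)$ are i.i.d. with a known mean and covariance $\Sigma_a$, the $B(v)$ are i.i.d. with a known mean and covariance $\Sigma_b$; $\mathrm{Cov}(A(u),B(v))=\Sigma_{ab}$ if $v=M(u)$ and $0$ otherwise; and $\Sigma=\begin{pmatrix}\Sigma_a&\Sigma_{ab}\\ \Sigma_{ab}^\top&\Sigma_b\end{pmatrix}$ is positive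 definite. With $f_{XY},f_X,f_Y$ the joint and marginal densities of a pair of correlated feature vectors, $G_{u,v}=\log\frac{f_{XY}(A(u),B(v))}{f_X(A(u))f_Y(B(v))}$, and $\zeta=I_{XY}$ is the mutual information of the pair. A family of such problems satisfies the *low per-feature correlation condition* if $\|\Sigma_a^{-1/2}\Sigma_{ab}\Sigma_b^{-1/2}\|_2\le r_n$ for some sequence $r_n\to0$, where $\|\cdot\|_2$ is the largest singular value. *Algorithms.* Maximum likelihood estimation returns a $\{0,1\}$-valued maximizer $m\in\mathbb R^{\mathcal U\times\mathcal V}$ of $\sum_{u,v}(G_{u,v}-\tau)m_{u,v}$ subject to (a) $\sum_u m_{u,v}\le 1$ for all $v$, (b) $\sum_v m_{u,v}=1$ for all $u$, (c) $m_{u,v}\in[0,1]$, where $\tau\in\mathbb R$ is arbitrary; maximum row estimation drops (a); threshold testing drops (a) and (b) and uses $\tau=\log n$. Ties may be broken in any way. For threshold testing an error is a pair $(u,v)$ for which $m_{u,v}$ differs from $\mathbf 1[v=M(u)]$; for the two other algorithms an error is a user $u\in\mathcal U$ that is not mapped to $M(u)$. **Theorem.** Fix $\beta>0$. Each condition below guarantees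 at most $n^{1-\beta+o(1)}$ errors in expectation as $n\to\infty$, uniformly over all problems of size $n$ satisfying it, with the following explicit forms. 1. *Threshold testing*, $\zeta\ge(\sqrt\beta+\sqrt{1+\beta})^2\log n$: in both models at most $2n^{1-\beta}$ expected errors for every $n\ge1$. 2. *Maximum row estimation*, $0<\beta\le1$, $\zeta\ge(1+\sqrt\beta)^2\log n$: for planted matching at most $2n^{1-\beta}$ for every $n\ge1$; for database alignment under the low per-feature correlation condition at most $n^{1-\beta+o(1)}$, where the $o(1)$ depends only on $\beta$ and $(r_n)$. 3. *Maximum row estimation*, $\beta>1$, $\zeta\ge2(1+\beta)\log n$: in both models at most $2n^{1-\beta}$ for every $n\ge1$. 4. *Maximum likelihood estimation*, $0<\beta\le1/2$, $\zeta\ge(1+2\sqrt{\beta(1-\beta)})\log n$: for planted matching at most $2n^{1-\beta}$ for all sufficiently large $n$ (depending only on $\beta$); for database alignment under the low per-feature correlation condition at most $n^{1-\beta+o(1)}$, where the $o(1)$ depends only on $\beta$ and $(r_n)$. 5. *Maximum likelihood estimation*, $1/2<\beta\le1$, $\zeta\ge2\log n+2\log\frac{\sqrt5+1}{2}$: in both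 models at most $n^{1-\beta}$ for every $n\ge1$. 6. *Maximum likelihood estimation*, $\beta>1$, $\zeta\ge(1+\beta)\log n$: in both models at most $n^{1-\beta}$ for all sufficiently large $n$ (depending only on $\beta$). -/

import Mathlib

open MeasureTheory ProbabilityTheory Filter Topology
open scoped ENNReal

universe u₁ u₂ u₃ u₄ u₅

namespace Alignment

/-! ### Mappings, the linear programs, and the algorithms -/

section Programs

variable {U : Type u₁} {V : Type u₂} [Fintype U] [Fintype V] [DecidableEq V]

/-- The `0/1` matrix encoding of the (bijective) true mapping `M`. -/
def mapMatrix (M : U ≃ V) : Matrix U V ℝ :=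
  fun u v => if M u = v then 1 else 0

/-- Constraint (a): every column sum is at most one. -/
def ColumnConstraint (m : Matrix U V ℝ) : Prop := ∀ v, ∑ u, m u v ≤ 1

/-- Constraint (b): every row sum equals one. -/
def RowConstraint (m : Matrix U V ℝ) : Prop := ∀ u, ∑ v, m u v = 1

/-- Constraint (c): all entries lie in `[0,1]`. -/
def EntryConstraint (m : Matrix U V ℝ) : Prop := ∀ u v, 0 ≤ m u v ∧ m u v ≤ 1

/-- The objective `⟨G - τ, m⟩`. -/
def objective (G : Matrix U V ℝ) (τ : ℝ) (m : Matrix U V ℝ) : ℝ :=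
  ∑ u, ∑ v, (G u v - τ) * m u v

/-- The number of pairs `(u, v)` on which `m` and the true mapping disagree
(false negatives plus false positives). -/
noncomputable def pairErrors (M : U ≃ V) (m : Matrix U V ℝ) : ℕ :=
  Set.ncard {p : U × V | m p.1 p.2 ≠ mapMatrix M p.1 p.2}

/-- The number of users `u` whose row in `m` is not the row of the true mapping
(misaligned users). -/
noncomputable def userErrors (M : U ≃ V) (m : Matrix U V ℝ) : ℕ :=
  Set.ncard {u : U | m u ≠ mapMatrix M u}

end Programs

/-- The three algorithms. -/
inductive Algorithm
  | threshold
  | maxRow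
  | maxLikelihood

namespace Algorithm

variable {U : Type u₁} {V : Type u₂} [Fintype U] [Fintype V] [DecidableEq V]

/-- The feasible set of the linear program solved by each algorithm. -/
def Feasible : Algorithm → Matrix U V ℝ → Prop
  | threshold, m => EntryConstraint m
  | maxRow, m => RowConstraint m ∧ EntryConstraint m
  | maxLikelihood, m => ColumnConstraint m ∧ RowConstraint m ∧ EntryConstraint m

/-- The offset `τ`: threshold testing uses `τ = log n`; the two other algorithms may use any `τ`
(which has no influence on their maximizers). -/
def Offset : Algorithm → ℕ → ℝ → Prop
  | threshold, n, τ => τ = Real.log n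
  | maxRow, _, _ => True
  | maxLikelihood, _, _ => True

/-- `m` is an integral optimal solution of the linear program with scores `G` and offset `τ`. -/
def IsOutput (alg : Algorithm) (G : Matrix U V ℝ) (τ : ℝ) (m : Matrix U V ℝ) : Prop :=
  alg.Feasible m ∧ (∀ u v, m u v = 0 ∨ m u v = 1) ∧
    ∀ m' : Matrix U V ℝ, alg.Feasible m' → objective G τ m' ≤ objective G τ m

/-- The number of errors: wrongly decided pairs for threshold testing (whose output need not be
single-valued), misaligned users for the two other algorithms. -/
noncomputable def errors : Algorithm → (U ≃ V) → Matrix U V ℝ → ℕ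
  | threshold, M, m => pairErrors M m
  | maxRow, M, m => userErrors M m
  | maxLikelihood, M, m => userErrors M m

end Algorithm

/-- Whatever the (measurable, possibly randomized) choice among optimal integral solutions, the
algorithm makes at most `b` errors in expectation on the random score matrix `G`. -/
def ExpectedErrorsLE {U : Type u₁} {V : Type u₂} [Fintype U] [Fintype V] [DecidableEq V]
    {Ω : Type u₃} [MeasurableSpace Ω] (P : Measure Ω) (alg : Algorithm) (M : U ≃ V)
    (G : Ω → Matrix U V ℝ) (b : ℝ) : Prop :=
  ∀ (τ : ℝ) (m : Ω → Matrix U V ℝ), alg.Offset (Fintype.card U) τ →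
    (∀ u v, Measurable fun ω => m ω u v) → (∀ᵐ ω ∂P, alg.IsOutput (G ω) τ (m ω)) →
      ∫⁻ ω, (alg.errors M (m ω) : ℝ≥0∞) ∂P ≤ ENNReal.ofReal b

/-! ### Planted matching -/

/-- Independent unit-variance Gaussian weights, with mean `μ` on the pairs of `M` and mean `0` on
all other pairs. -/
structure IsPlantedMatching {U : Type u₁} {V : Type u₂} [DecidableEq V]
    {Ω : Type u₃} [MeasurableSpace Ω] (P : Measure Ω) (M : U ≃ V) (μ : ℝ)
    (W : U → V → Ω → ℝ) : Prop where
  indep : iIndepFun (fun p : U × V => W p.1 p.2) P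
  law : ∀ u v, HasLaw (W u v) (gaussianReal (if M u = v then μ else 0) 1) P

/-- The log-likelihood ratio score `μ W - μ² / 2` of planted matching. -/
noncomputable def plantedScore {U : Type u₁} {V : Type u₂} {Ω : Type u₃} (μ : ℝ) (W : U → V → Ω → ℝ)
    (ω : Ω) : Matrix U V ℝ :=
  fun u v => μ * W u v ω - μ ^ 2 / 2

/-- On every planted matching problem with `|U| = |V| = n` and signal strength
`μ² / 2 ≥ z`, the algorithm makes at most `b` errors in expectation. -/
def PlantedGuarantee (alg : Algorithm) (n : ℕ) (z b : ℝ) : Prop :=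
  ∀ (U : Type u₁) (V : Type u₂) [Fintype U] [Fintype V] [DecidableEq V] (Ω : Type u₃)
    [MeasurableSpace Ω] (P : Measure Ω) [IsProbabilityMeasure P] (M : U ≃ V) (μ : ℝ)
    (W : U → V → Ω → ℝ),
    Fintype.card U = n → 0 < μ → IsPlantedMatching P M μ W → z ≤ μ ^ 2 / 2 →
      ExpectedErrorsLE P alg M (plantedScore μ W) b

/-! ### Correlated Gaussian databases -/

section Databases

variable {Da : Type u₄} {Db : Type u₅} [Fintype Da] [Fintype Db] [DecidableEq Da] [DecidableEq Db]

/-- Density of the Gaussian law with mean `c` and (positive definite) covariance matrix `S`. -/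
noncomputable def gaussianDensity {D : Type*} [Fintype D] [DecidableEq D] (c : D → ℝ)
    (S : Matrix D D ℝ) (x : D → ℝ) : ℝ :=
  (Real.sqrt ((2 * Real.pi) ^ Fintype.card D * S.det))⁻¹ *
    Real.exp (-((x - c) ⬝ᵥ (S⁻¹).mulVec (x - c)) / 2)

/-- Mean and covariance of a pair of correlated feature vectors; the joint covariance matrix
is positive definite, so that the joint and marginal densities exist. -/
structure FeatureStats (Da : Type u₄) (Db : Type u₅) [Fintype Da] [Fintype Db] where
  meanA : Da → ℝ
  meanB : Db → ℝ
  covA : Matrix Da Da ℝ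
  covAB : Matrix Da Db ℝ
  covB : Matrix Db Db ℝ
  posDef : (Matrix.fromBlocks covA covAB covAB.transpose covB).PosDef

namespace FeatureStats

/-- The joint density `f_XY`. -/
noncomputable def jointDensity (s : FeatureStats Da Db) (x : Da → ℝ) (y : Db → ℝ) : ℝ :=
  gaussianDensity (Sum.elim s.meanA s.meanB)
    (Matrix.fromBlocks s.covA s.covAB s.covAB.transpose s.covB) (Sum.elim x y)

/-- The information density `log (f_XY(x,y) / (f_X(x) f_Y(y)))`. -/
noncomputable def infoDensity (s : FeatureStats Da Db) (x : Da → ℝ) (y : Db → ℝ) : ℝ :=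
  Real.log (s.jointDensity x y /
    (gaussianDensity s.meanA s.covA x * gaussianDensity s.meanB s.covB y))

/-- The mutual information `I_XY` between a pair of correlated feature vectors. -/
noncomputable def mutualInfo (s : FeatureStats Da Db) : ℝ :=
  ∫ p : (Da → ℝ) × (Db → ℝ), s.jointDensity p.1 p.2 * s.infoDensity p.1 p.2

open scoped MatrixOrder in
/-- The normalized cross-covariance `Σ_a^{-1/2} Σ_ab Σ_b^{-1/2}`. -/
noncomputable def normalizedCov (s : FeatureStats Da Db) : Matrix Da Db ℝ :=
  (CFC.sqrt s.covA)⁻¹ * s.covAB * (CFC.sqrt s.covB)⁻¹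

open scoped Matrix.Norms.L2Operator in
/-- The `ℓ²` operator norm (largest singular value) of `Σ_a^{-1/2} Σ_ab Σ_b^{-1/2}`. -/
noncomputable def maxCorrelation (s : FeatureStats Da Db) : ℝ :=
  ‖s.normalizedCov‖

end FeatureStats

/-- Correlated Gaussian databases `A`, `B` with true mapping `M` and feature statistics `s`. -/
structure IsCorrelatedDatabases {U : Type u₁} {V : Type u₂} [Fintype U] [Fintype V]
    [DecidableEq V] {Ω : Type u₃} [MeasurableSpace Ω] (P : Measure Ω) (M : U ≃ V)
    (s : FeatureStats Da Db) (A : U → Ω → Da → ℝ) (B : V → Ω → Db → ℝ) : Prop where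
  gaussian : HasGaussianLaw
    (fun ω => ((fun u => A u ω, fun v => B v ω) : (U → Da → ℝ) × (V → Db → ℝ))) P
  indepA : iIndepFun A P
  indepB : iIndepFun B P
  meanA : ∀ u i, ∫ ω, A u ω i ∂P = s.meanA i
  meanB : ∀ v j, ∫ ω, B v ω j ∂P = s.meanB j
  covA : ∀ u i i', covariance (fun ω => A u ω i) (fun ω => A u ω i') P = s.covA i i'
  covB : ∀ v j j', covariance (fun ω => B v ω j) (fun ω => B v ω j') P = s.covB j j'
  covAB : ∀ u v i j, covariance (fun ω => A u ω i) (fun ω => B v ω j) P =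
    if M u = v then s.covAB i j else 0

/-- The information density matrix `G`. -/
noncomputable def databaseScore {U : Type u₁} {V : Type u₂} {Ω : Type u₃}
    (s : FeatureStats Da Db) (A : U → Ω → Da → ℝ) (B : V → Ω → Db → ℝ) (ω : Ω) :
    Matrix U V ℝ :=
  fun u v => s.infoDensity (A u ω) (B v ω)

end Databases

/-- On every pair of correlated Gaussian databases with `|U| = |V| = n`, arbitrary finite feature
sets, mutual information `I_XY ≥ z` and largest correlation at most `κ`, the algorithm makes at
most `b` errors in expectation. The value `κ = ⊤` imposes no condition on the correlation. -/
def DatabaseGuarantee (alg : Algorithm) (n : ℕ) (κ : EReal) (z b : ℝ) : Prop :=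
  ∀ (U : Type u₁) (V : Type u₂) [Fintype U] [Fintype V] [DecidableEq V] (Ω : Type u₃)
    [MeasurableSpace Ω] (P : Measure Ω) [IsProbabilityMeasure P] (M : U ≃ V)
    (Da : Type u₄) (Db : Type u₅) [Fintype Da] [Fintype Db] [DecidableEq Da] [DecidableEq Db]
    (s : FeatureStats Da Db) (A : U → Ω → Da → ℝ) (B : V → Ω → Db → ℝ),
    Fintype.card U = n → IsCorrelatedDatabases P M s A B →
      (s.maxCorrelation : EReal) ≤ κ → z ≤ s.mutualInfo →
        ExpectedErrorsLE P alg M (databaseScore s A B) b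

end Alignment

set_option linter.unusedSectionVars false

/-! Everything rests on exponential moments of log-likelihood ratios. For 0 ≤ θ ≤ 1 a true score
satisfies E exp(-θG) ≤ exp(-θ(1-θ)ζ), a false one E exp((1-θ)G) ≤ exp(-θ(1-θ)ζ), and for a set S of
users moved by a permutation σ the sum over u in S of (1-θ)G(u,Mσu) - θG(u,Mu) should have
exponential moment at most exp(-2θ(1-θ)ζ|S|). These are `TrueMoment`, `FalseMoment` and
`PairMoment`.

For planted matching all three follow from independence. For databases, a linear change of variables
makes the score a sum over canonical coordinates i of `coordScore`, a function of a white x and its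
regression w on the other vector, where w has variance t i (a squared canonical correlation); ζ
becomes the sum of -log(1 - t i)/2. The single-pair moments are then explicit Gaussian integrals. In
the pair moment, integrating out the noise x - w leaves kernels coupling w(u) with w(σu), a closed
chain along each cycle of σ. Every variable lies in two kernels, so Cauchy-Schwarz
(`lintegral_pi_prod_perm_le`) bounds the integral by the L² norms of the kernels. These give exactly
the required bound at θ = 1/2, and for other θ < 1/2 a bound with ζ replaced by (1-ε)ζ provided the
correlations are small. This is where the low per-feature correlation condition enters.

Error bounds. Threshold testing is a union bound over pairs at the best θ. Maximum row estimation
uses Gallager's device (`weight_le_geometric_mean`): if a competitor beats the true score, 1 is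
bounded by a geometric mean with weights 1-r and r of an exponential of the true score and a sum
over competitors; Hölder then pays n^r instead of n for the competitors. The choice r = √β is
available for β ≤ 1; beyond that r = 1 is a plain union bound.

For maximum likelihood, each cycle of the optimal permutation relative to M is augmenting, and a
cycle of length l is so with probability at most exp(-lζ/2). Summing over cycles settles ζ ≥ 2 log
n; for the constant 1 when β > 1, transpositions need the extra factor 1/2 of `SwapTail`. Below 2
log n the sum over cycles diverges. There the union runs over the set S of all misaligned users,
with Gallager's device over the at most |S|! permutations of S; sets larger than a constant times
n^(1-β) are then exponentially unlikely (`lintegral_maxLikelihood_errors_le_sum_supports`). To lower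
that constant below 2 for planted matching, users with atypically small true scores are penalized by
a weight that averages to at most 3/5 under the tilted law. -/

namespace Alignment

/-! ### The exponential with values in `ℝ≥0∞` -/

/-- The real exponential as an extended nonnegative real. -/
noncomputable def eexp (x : ℝ) : ℝ≥0∞ := ENNReal.ofReal (Real.exp x)

lemma eexp_zero : eexp 0 = 1 := by simp [eexp]

lemma eexp_add (x y : ℝ) : eexp (x + y) = eexp x * eexp y := by
  rw [eexp, Real.exp_add, ENNReal.ofReal_mul (Real.exp_pos _).le, eexp, eexp]

lemma eexp_sum {ι : Type*} (s : Finset ι) (f : ι → ℝ) :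
    eexp (∑ i ∈ s, f i) = ∏ i ∈ s, eexp (f i) := by
  rw [eexp, Real.exp_sum, ENNReal.ofReal_prod_of_nonneg fun i _ => (Real.exp_pos _).le]
  rfl

lemma eexp_rpow (x s : ℝ) : eexp x ^ s = eexp (x * s) := by
  rw [eexp, eexp, ENNReal.ofReal_rpow_of_pos (Real.exp_pos _), ← Real.exp_mul]

lemma eexp_pow (x : ℝ) (k : ℕ) : eexp x ^ k = eexp (k * x) := by
  rw [← ENNReal.rpow_natCast, eexp_rpow, mul_comm]

lemma eexp_mono {x y : ℝ} (h : x ≤ y) : eexp x ≤ eexp y :=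
  ENNReal.ofReal_le_ofReal (Real.exp_le_exp.2 h)

lemma eexp_ne_top (x : ℝ) : eexp x ≠ ∞ := ENNReal.ofReal_ne_top

lemma one_le_eexp {x : ℝ} (h : 0 ≤ x) : 1 ≤ eexp x := by
  simpa [eexp_zero] using eexp_mono h

@[fun_prop]
lemma measurable_eexp : Measurable eexp := by unfold eexp; fun_prop

@[fun_prop]
lemma _root_.AEMeasurable.eexp {Ω : Type*} [MeasurableSpace Ω] {P : Measure Ω} {f : Ω → ℝ}
    (hf : AEMeasurable f P) : AEMeasurable (fun ω => eexp (f ω)) P :=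
  measurable_eexp.comp_aemeasurable hf

@[fun_prop]
lemma _root_.Measurable.eexp {Ω : Type*} [MeasurableSpace Ω] {f : Ω → ℝ}
    (hf : Measurable f) : Measurable (fun ω => eexp (f ω)) :=
  measurable_eexp.comp hf

lemma natCast_eq_eexp {n : ℕ} (hn : 1 ≤ n) : (n : ℝ≥0∞) = eexp (Real.log n) := by
  rw [eexp, Real.exp_log (by exact_mod_cast hn), ENNReal.ofReal_natCast]

/-! ### Products over product measures -/

lemma lintegral_pi_prod {ι : Type*} [Fintype ι] {X : ι → Type*} [∀ i, MeasurableSpace (X i)]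
    (μ : ∀ i, Measure (X i)) [∀ i, IsProbabilityMeasure (μ i)] (f : ∀ i, X i → ℝ≥0∞)
    (hf : ∀ i, Measurable (f i)) :
    ∫⁻ x, ∏ i, f i (x i) ∂Measure.pi μ = ∏ i, ∫⁻ x, f i x ∂μ i := by
  have hind : iIndepFun (fun i (x : ∀ i, X i) => f i (x i)) (Measure.pi μ) :=
    iIndepFun_pi (X := fun i => f i) fun i => (hf i).aemeasurable
  rw [lintegral_prod_eq_prod_lintegral_of_indepFun _ _ hind fun i => by fun_prop]
  refine Finset.prod_congr rfl fun i _ => ?_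
  exact (measurePreserving_eval μ i).lintegral_comp (hf i)

lemma lintegral_prod_comp_of_iIndepFun {ι Ω : Type*} [Fintype ι] [MeasurableSpace Ω] {P : Measure Ω}
    {X : ι → Type*} [∀ i, MeasurableSpace (X i)] {μ : ∀ i, Measure (X i)}
    [∀ i, IsProbabilityMeasure (μ i)] {Y : ∀ i, Ω → X i} (hY : ∀ i, HasLaw (Y i) (μ i) P)
    (hind : iIndepFun Y P) (f : ∀ i, X i → ℝ≥0∞) (hf : ∀ i, Measurable (f i)) :
    ∫⁻ ω, ∏ i, f i (Y i ω) ∂P = ∏ i, ∫⁻ x, f i x ∂μ i := by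
  rw [← lintegral_pi_prod μ f hf]
  exact (hind.hasLaw_pi hY).lintegral_comp (f := fun x => ∏ i, f i (x i))
    (Measurable.aemeasurable (by fun_prop))

/-- Cauchy-Schwarz for square roots. -/
lemma lintegral_sqrt_mul_sqrt_le {α : Type*} [MeasurableSpace α] {μ : Measure α}
    {f g : α → ℝ≥0∞} (hf : AEMeasurable f μ) (hg : AEMeasurable g μ) :
    ∫⁻ x, f x ^ (1 / 2 : ℝ) * g x ^ (1 / 2 : ℝ) ∂μ ≤
      (∫⁻ x, f x ∂μ) ^ (1 / 2 : ℝ) * (∫⁻ x, g x ∂μ) ^ (1 / 2 : ℝ) :=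
  ENNReal.lintegral_mul_norm_pow_le hf hg (by norm_num) (by norm_num) (by norm_num)

/-- A form of Finner's inequality: if the factors `f e` have dependency sets such that every
coordinate occurs in at most two of them, the integral of the product is at most the product of
the `L²` norms. -/
lemma lmarginal_prod_le_prod_sqrt {ι E : Type*} [Fintype E] [DecidableEq ι]
    [DecidableEq E] {X : ι → Type*} [∀ i, MeasurableSpace (X i)] (μ : ∀ i, Measure (X i))
    [∀ i, IsProbabilityMeasure (μ i)] (f : E → (∀ i, X i) → ℝ≥0∞) (hf : ∀ e, Measurable (f e))
    (p q : ι → E) (hpq : ∀ i, p i ≠ q i)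
    (hdep : ∀ i e, e ≠ p i → e ≠ q i → ∀ x t, f e (Function.update x i t) = f e x)
    (s : Finset ι) (x : ∀ i, X i) :
    (∫⋯∫⁻_s, (fun y => ∏ e, f e y) ∂μ) x ≤
      ∏ e, ((∫⋯∫⁻_s, (fun y => f e y ^ 2) ∂μ) x) ^ (1 / 2 : ℝ) := by
  induction s using Finset.induction_on generalizing x with
  | empty =>
    simp only [lmarginal_empty]
    refine Finset.prod_le_prod' fun e _ => le_of_eq ?_
    rw [← ENNReal.rpow_natCast, ← ENNReal.rpow_mul]
    norm_num
  | insert i s hi ih =>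
    have hm : Measurable fun y => ∏ e, f e y := by fun_prop
    set g : E → (∀ i, X i) → ℝ≥0∞ := fun e => ∫⋯∫⁻_s, (fun y => f e y ^ 2) ∂μ with hg
    have hgm : ∀ e, Measurable (g e) := fun e => Measurable.lmarginal μ (by fun_prop)
    have hgu : ∀ e, Measurable fun t : X i => g e (Function.update x i t) := fun e =>
      (hgm e).comp (measurable_update x)
    have hconst : ∀ e, e ≠ p i → e ≠ q i → ∀ t, g e (Function.update x i t) = g e x := by
      intro e h1 h2 t
      rw [hg]
      simp only
      rw [lmarginal_update_of_notMem (by fun_prop) hi]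
      congr 1
      ext y
      simp [Function.comp, hdep i e h1 h2]
    have hE : (Finset.univ : Finset E) = insert (p i) (insert (q i)
        ((Finset.univ.erase (p i)).erase (q i))) := by
      ext e; simp only [Finset.mem_univ, Finset.mem_insert, Finset.mem_erase, true_iff]; tauto
    have hprod : ∀ F : E → ℝ≥0∞, ∏ e, F e =
        F (p i) * (F (q i) * ∏ e ∈ (Finset.univ.erase (p i)).erase (q i), F e) := by
      intro F
      rw [hE, Finset.prod_insert (by simp [hpq i]), Finset.prod_insert (by simp), ← hE]
    rw [lmarginal_insert _ hm hi]
    have hins : ∀ e, (∫⋯∫⁻_insert i s, (fun y => f e y ^ 2) ∂μ) x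
        = ∫⁻ t, g e (Function.update x i t) ∂μ i := fun e =>
      lmarginal_insert _ (by fun_prop) hi x
    simp only [hins]
    -- With the coordinate `i` frozen the induction hypothesis applies. Afterwards only the two
    -- factors `p i` and `q i` depend on that coordinate, so Cauchy-Schwarz integrates it out and
    -- the others leave the integral as constants.
    calc ∫⁻ t, (∫⋯∫⁻_s, (fun y => ∏ e, f e y) ∂μ) (Function.update x i t) ∂μ i
        ≤ ∫⁻ t, ∏ e, g e (Function.update x i t) ^ (1 / 2 : ℝ) ∂μ i :=
          lintegral_mono fun t => ih _
      _ = ∫⁻ t, (g (p i) (Function.update x i t) ^ (1 / 2 : ℝ) *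
            g (q i) (Function.update x i t) ^ (1 / 2 : ℝ)) *
            ∏ e ∈ (Finset.univ.erase (p i)).erase (q i), g e x ^ (1 / 2 : ℝ) ∂μ i := by
          refine lintegral_congr fun t => ?_
          rw [hprod, mul_assoc]
          congr 2
          refine Finset.prod_congr rfl fun e he => ?_
          simp only [Finset.mem_erase] at he
          rw [hconst e he.2.1 he.1]
      _ ≤ ((∫⁻ t, g (p i) (Function.update x i t) ∂μ i) ^ (1 / 2 : ℝ) *
            (∫⁻ t, g (q i) (Function.update x i t) ∂μ i) ^ (1 / 2 : ℝ)) *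
            ∏ e ∈ (Finset.univ.erase (p i)).erase (q i), g e x ^ (1 / 2 : ℝ) := by
          have hmul : Measurable fun t => g (p i) (Function.update x i t) ^ (1 / 2 : ℝ) *
              g (q i) (Function.update x i t) ^ (1 / 2 : ℝ) :=
            ((hgu _).pow_const _).mul ((hgu _).pow_const _)
          rw [lintegral_mul_const _ hmul]
          gcongr
          exact lintegral_sqrt_mul_sqrt_le (hgu _).aemeasurable (hgu _).aemeasurable
      _ = ∏ e, (∫⁻ t, g e (Function.update x i t) ∂μ i) ^ (1 / 2 : ℝ) := by
          rw [hprod, mul_assoc]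
          congr 2
          refine Finset.prod_congr rfl fun e he => ?_
          simp only [Finset.mem_erase] at he
          simp [hconst e he.2.1 he.1]

/-- The integral of a product of factors of pairs `(x i, x (σ i))` along a fixed point free
permutation is at most the product of their `L²` norms. Factors attached to the fixed points of
`σ` have to be trivial. -/
lemma lintegral_pi_prod_perm_le {ι X : Type*} [Fintype ι] [DecidableEq ι] [MeasurableSpace X]
    (μ : ι → Measure X) [∀ i, IsProbabilityMeasure (μ i)] (σ : Equiv.Perm ι)
    (k : ι → X → X → ℝ≥0∞) (hk : ∀ i, Measurable (Function.uncurry (k i)))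
    (hfix : ∀ i, σ i = i → k i = 1) :
    ∫⁻ x, ∏ i, k i (x i) (x (σ i)) ∂Measure.pi μ ≤
      ∏ i, (∫⁻ x, ∫⁻ y, k i x y ^ 2 ∂μ (σ i) ∂μ i) ^ (1 / 2 : ℝ) := by
  classical
  rcases isEmpty_or_nonempty (ι → X) with hE | ⟨⟨x₀⟩⟩
  · rw [lintegral_of_isEmpty]; exact zero_le
  have hkm : ∀ i, Measurable fun x : ι → X => k i (x i) (x (σ i)) := by
    intro i
    have h : Measurable fun x : ι → X => (x i, x (σ i)) := by fun_prop
    exact (hk i).comp h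
  have hsq : ∀ i, ∫⁻ x, k i (x i) (x (σ i)) ^ 2 ∂Measure.pi μ =
      ∫⁻ x, ∫⁻ y, k i x y ^ 2 ∂μ (σ i) ∂μ i := by
    intro i
    by_cases h : σ i = i
    · simp [hfix i h]
    have hind : IndepFun (fun x : ι → X => x i) (fun x => x (σ i)) (Measure.pi μ) :=
      (iIndepFun_pi (X := fun _ => id) (μ := μ) fun i => aemeasurable_id).indepFun
        (Ne.symm h)
    have h1 : HasLaw (fun x : ι → X => x i) (μ i) (Measure.pi μ) :=
      ⟨(measurable_pi_apply _).aemeasurable, (measurePreserving_eval μ i).map_eq⟩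
    have h2 : HasLaw (fun x : ι → X => x (σ i)) (μ (σ i)) (Measure.pi μ) :=
      ⟨(measurable_pi_apply _).aemeasurable, (measurePreserving_eval μ (σ i)).map_eq⟩
    have := (hind.hasLaw_prod h1 h2).lintegral_comp
      (f := fun p => Function.uncurry (k i) p ^ 2) ((hk i).pow_const 2).aemeasurable
    rw [lintegral_prod _ ((hk i).pow_const 2).aemeasurable] at this
    exact this
  by_cases hall : ∀ i, σ i = i
  · simp [hfix _ (hall _)]
  simp only [← hsq]
  -- every coordinate occurs in the factors `i` and `σ⁻¹ i`; for fixed points there is none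
  push Not at hall
  obtain ⟨i₀, hi₀⟩ := hall
  have key := lmarginal_prod_le_prod_sqrt μ (fun i x => k i (x i) (x (σ i))) hkm
    -- At a fixed point `i` only the factor `i` can involve the coordinate `i`, so the second index
    -- is a dummy: it just has to differ from `i`, and one of `i₀`, `σ i₀` does.
    (fun i => i) (fun i => if σ i = i then (if i = i₀ then σ i₀ else i₀) else σ.symm i) ?_ ?_
    Finset.univ x₀
  · simpa only [lmarginal_univ] using key
  · intro i
    split_ifs with h1 h2
    · subst h2; exact absurd h1 hi₀
    · exact h2
    · intro h; apply h1; conv_lhs => rw [h]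
      simp
  · intro i e h1 h2 x t
    rw [Function.update_of_ne h1]
    by_cases h : σ i = i
    · have : σ e ≠ i := by
        intro h'; apply h1; apply σ.injective; rw [h', h]
      rw [Function.update_of_ne this]
    · rw [if_neg h] at h2
      have : σ e ≠ i := by
        intro h'; apply h2; rw [← h']; simp
      rw [Function.update_of_ne this]

/-! ### Deterministic consequences of optimality -/

section Deterministic

variable {U : Type*} {V : Type*} [Fintype U] [Fintype V] [DecidableEq V]

/-- Without the column constraint the programs decouple over rows, so optimality is only ever tested
against the change of one row. -/
lemma objective_update_row [DecidableEq U] (G m : Matrix U V ℝ) (τ : ℝ) (u : U) (r : V → ℝ) :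
    objective G τ (m.updateRow u r) =
      objective G τ m + ∑ v, (G u v - τ) * (r v - m u v) := by
  unfold objective
  rw [← Finset.add_sum_erase _ _ (Finset.mem_univ u),
    ← Finset.add_sum_erase _ (fun u => ∑ v, (G u v - τ) * m u v) (Finset.mem_univ u)]
  have h : ∑ x ∈ Finset.univ.erase u, ∑ v, (G x v - τ) * m.updateRow u r x v =
      ∑ x ∈ Finset.univ.erase u, ∑ v, (G x v - τ) * m x v :=
    Finset.sum_congr rfl fun x hx => by rw [Matrix.updateRow_ne (Finset.ne_of_mem_erase hx)]
  rw [h, Matrix.updateRow_self]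
  simp only [mul_sub, Finset.sum_sub_distrib]
  ring

lemma threshold_entry {G m : Matrix U V ℝ} {τ : ℝ}
    (h : Algorithm.threshold.IsOutput G τ m) (u : U) (v : V) (t : ℝ) (ht : 0 ≤ t ∧ t ≤ 1) :
    (G u v - τ) * (t - m u v) ≤ 0 := by
  classical
  have hf : Algorithm.threshold.Feasible (m.updateRow u (Function.update (m u) v t)) := by
    intro a b
    by_cases ha : a = u
    · subst ha
      rw [Matrix.updateRow_self]
      by_cases hb : b = v
      · subst hb; rwa [Function.update_self]
      · rw [Function.update_of_ne hb]; exact h.1 a b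
    · rw [Matrix.updateRow_ne ha]; exact h.1 a b
  have := h.2.2 _ hf
  rw [objective_update_row] at this
  have hs : ∑ b, (G u b - τ) * (Function.update (m u) v t b - m u b) =
      (G u v - τ) * (t - m u v) := by
    rw [Finset.sum_eq_single v]
    · simp
    · intro b _ hb; simp [Function.update_of_ne hb]
    · simp
  rw [hs] at this
  linarith

lemma exists_row_eq {m : Matrix U V ℝ} (hr : RowConstraint m)
    (hi : ∀ u v, m u v = 0 ∨ m u v = 1) (u : U) :
    ∃ w, m u = fun v => if w = v then 1 else 0 := by
  have hex : ∃ w, m u w = 1 := by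
    by_contra hcon
    push Not at hcon
    have : ∀ v, m u v = 0 := fun v => (hi u v).resolve_right (hcon v)
    have h := hr u
    simp [this] at h
  obtain ⟨w, hw⟩ := hex
  refine ⟨w, ?_⟩
  ext v
  split_ifs with hv
  · rw [← hv, hw]
  · have h := hr u
    rw [← Finset.add_sum_erase _ _ (Finset.mem_univ w), hw] at h
    have hz : ∑ x ∈ Finset.univ.erase w, m u x = 0 := by linarith
    rw [Finset.sum_eq_zero_iff_of_nonneg] at hz
    · exact hz v (by simp [Ne.symm hv])
    · intro x _; rcases hi u x with h | h <;> simp [h]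

lemma sum_mul_indicator (g : V → ℝ) (w : V) : ∑ v, g v * (if w = v then 1 else 0) = g w := by
  simp

lemma maxRow_error {G m : Matrix U V ℝ} {τ : ℝ} {M : U ≃ V}
    (h : Algorithm.maxRow.IsOutput G τ m) {u : U} (hu : m u ≠ mapMatrix M u) :
    ∃ v, M u ≠ v ∧ G u (M u) ≤ G u v := by
  classical
  obtain ⟨w, hw⟩ := exists_row_eq h.1.1 h.2.1 u
  have hne : M u ≠ w := by
    intro he; apply hu; rw [hw, ← he]; rfl
  refine ⟨w, hne, ?_⟩
  have hf : Algorithm.maxRow.Feasible (m.updateRow u (mapMatrix M u)) := by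
    refine ⟨fun a => ?_, fun a b => ?_⟩
    · by_cases ha : a = u
      · subst ha; simp [mapMatrix]
      · rw [Matrix.updateRow_ne ha]; exact h.1.1 a
    · by_cases ha : a = u
      · subst ha; rw [Matrix.updateRow_self, mapMatrix]; split_ifs <;> norm_num
      · rw [Matrix.updateRow_ne ha]; exact h.1.2 a b
  have := h.2.2 _ hf
  rw [objective_update_row, hw] at this
  simp only [mul_sub, Finset.sum_sub_distrib, mapMatrix, sum_mul_indicator] at this
  linarith

/-- The column constraint makes the row choices injective, hence bijective since |U| = |V|, so the
output is M ∘ σ. The offset contributes the same |U|τ to every permutation and drops out of the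
comparison. -/
lemma maxLikelihood_output {G m : Matrix U V ℝ} {τ : ℝ} (M : U ≃ V) [DecidableEq U]
    (h : Algorithm.maxLikelihood.IsOutput G τ m) :
    ∃ σ : Equiv.Perm U, userErrors M m = σ.support.card ∧
      ∀ π : Equiv.Perm U, ∑ u, G u (M (π u)) ≤ ∑ u, G u (M (σ u)) := by
  choose f hf using fun u => exists_row_eq h.1.2.1 h.2.1 u
  have hinj : Function.Injective f := by
    intro a b hab
    by_contra hne
    have hc := h.1.1 (f a)
    rw [← Finset.add_sum_erase _ _ (Finset.mem_univ a),
      ← Finset.add_sum_erase _ _ (Finset.mem_erase.2 ⟨Ne.symm hne, Finset.mem_univ b⟩)] at hc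
    have hnn : 0 ≤ ∑ x ∈ (Finset.univ.erase a).erase b, m x (f a) :=
      Finset.sum_nonneg fun x _ => (h.1.2.2 x _).1
    simp only [hf a, hf b, hab, if_true] at hc hnn
    linarith
  have hbij : Function.Bijective f :=
    (Fintype.bijective_iff_injective_and_card f).2 ⟨hinj, Fintype.card_congr M⟩
  set F : U ≃ V := Equiv.ofBijective f hbij with hF
  set σ : Equiv.Perm U := F.trans M.symm with hσ
  have hMσ : ∀ u, M (σ u) = f u := by intro u; simp [hσ, hF]
  have hobj : ∀ π : Equiv.Perm U, objective G τ (fun u v => if M (π u) = v then 1 else 0) =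
      ∑ u, G u (M (π u)) - Fintype.card U * τ := by
    intro π
    unfold objective
    simp only [sum_mul_indicator, Finset.sum_sub_distrib]
    simp
  have hm : m = fun u v => if M (σ u) = v then 1 else 0 := by
    ext u v; rw [hf u, hMσ]
  refine ⟨σ, ?_, fun π => ?_⟩
  · unfold userErrors
    rw [← Set.ncard_coe_finset]
    congr 1
    ext u
    simp only [Set.mem_ofPred_eq, Finset.mem_coe, Equiv.Perm.mem_support, ne_eq, not_iff_not]
    rw [hf u]
    constructor
    · intro he
      have := congrFun he (f u)
      simp only [mapMatrix, if_true] at this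
      have h1 : M u = f u := by by_contra hc; simp [hc] at this
      apply M.injective; rw [hMσ, h1]
    · intro he
      have h1 : f u = M u := by rw [← hMσ, he]
      rw [h1]; rfl
  · have hfe : Algorithm.maxLikelihood.Feasible
        (fun u v => if M (π u) = v then (1 : ℝ) else 0) := by
      refine ⟨fun v => ?_, fun u => by simp, fun u v => by dsimp only; split_ifs <;> norm_num⟩
      have : ∀ u, (M (π u) = v) ↔ (u = π.symm (M.symm v)) := by
        intro u
        rw [Equiv.eq_symm_apply, Equiv.eq_symm_apply]
      simp [this]
    have := h.2.2 _ hfe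
    rw [hobj, hm, hobj] at this
    linarith

/-- Every cycle of an optimal matching is augmenting for the true matching. -/
lemma augmenting_of_mem_cycleFactors [DecidableEq U] {G : Matrix U V ℝ} {M : U ≃ V}
    {σ : Equiv.Perm U} (hσ : ∀ π : Equiv.Perm U, ∑ u, G u (M (π u)) ≤ ∑ u, G u (M (σ u)))
    {c : Equiv.Perm U} (hc : c ∈ σ.cycleFactorsFinset) :
    ∑ u ∈ c.support, G u (M u) ≤ ∑ u ∈ c.support, G u (M (c u)) := by
  have hsup := (Equiv.Perm.mem_cycleFactorsFinset_iff.1 hc).2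
  -- The competitor σc⁻¹ undoes the cycle `c` and agrees with σ elsewhere.
  have h := hσ (σ * c⁻¹)
  rw [← Finset.sum_add_sum_compl c.support, ← Finset.sum_add_sum_compl c.support
    (fun u => G u (M (σ u)))] at h
  have h1 : ∑ u ∈ c.support, G u (M ((σ * c⁻¹) u)) = ∑ u ∈ c.support, G u (M u) := by
    refine Finset.sum_congr rfl fun u hu => ?_
    have : c⁻¹ u ∈ c.support := by
      rw [← Equiv.Perm.support_inv] at hu ⊢
      exact Equiv.Perm.apply_mem_support.2 hu
    rw [Equiv.Perm.mul_apply, ← hsup _ this]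
    simp
  have h2 : ∑ u ∈ c.supportᶜ, G u (M ((σ * c⁻¹) u)) = ∑ u ∈ c.supportᶜ, G u (M (σ u)) := by
    refine Finset.sum_congr rfl fun u hu => ?_
    rw [Finset.mem_compl, ← Equiv.Perm.support_inv, Equiv.Perm.notMem_support] at hu
    rw [Equiv.Perm.mul_apply, hu]
  have h3 : ∑ u ∈ c.support, G u (M (σ u)) = ∑ u ∈ c.support, G u (M (c u)) :=
    Finset.sum_congr rfl fun u hu => by rw [hsup u hu]
  rw [h1, h2, h3] at h
  linarith

lemma augmenting_support [DecidableEq U] {G : Matrix U V ℝ} {M : U ≃ V}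
    {σ : Equiv.Perm U} (hσ : ∀ π : Equiv.Perm U, ∑ u, G u (M (π u)) ≤ ∑ u, G u (M (σ u))) :
    ∑ u ∈ σ.support, G u (M u) ≤ ∑ u ∈ σ.support, G u (M (σ u)) := by
  have h := hσ 1
  rw [← Finset.sum_add_sum_compl σ.support, ← Finset.sum_add_sum_compl σ.support
    (fun u => G u (M (σ u)))] at h
  have h2 : ∑ u ∈ σ.supportᶜ, G u (M ((1 : Equiv.Perm U) u)) =
      ∑ u ∈ σ.supportᶜ, G u (M (σ u)) := by
    refine Finset.sum_congr rfl fun u hu => ?_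
    rw [Finset.mem_compl, Equiv.Perm.notMem_support] at hu
    rw [hu]; rfl
  rw [h2] at h
  simpa using h

end Deterministic

/-! ### Moment conditions on a random score matrix -/

section Moments

variable {U : Type*} {V : Type*} [Fintype U] [Fintype V] [DecidableEq V]
  {Ω : Type*} [MeasurableSpace Ω]

/-- Exponential moment bound for the scores of true pairs. -/
def TrueMoment (P : Measure Ω) (M : U ≃ V) (G : Ω → Matrix U V ℝ) (θ z : ℝ) : Prop :=
  ∀ S : Finset U, ∫⁻ ω, eexp (-(θ * ∑ u ∈ S, G ω u (M u))) ∂P ≤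
    eexp (-(θ * (1 - θ) * z)) ^ S.card

/-- Exponential moment bound for the score of a false pair. -/
def FalseMoment (P : Measure Ω) (M : U ≃ V) (G : Ω → Matrix U V ℝ) (θ z : ℝ) : Prop :=
  ∀ u v, M u ≠ v → ∫⁻ ω, eexp ((1 - θ) * G ω u v) ∂P ≤ eexp (-(θ * (1 - θ) * z))

/-- Joint exponential moment bound for the true pairs and the false pairs given by a
permutation. -/
def PairMoment [DecidableEq U] (P : Measure Ω) (M : U ≃ V) (G : Ω → Matrix U V ℝ) (θ z : ℝ) :
    Prop :=
  ∀ (σ : Equiv.Perm U) (S : Finset U), S ⊆ σ.support →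
    ∫⁻ ω, eexp (∑ u ∈ S, ((1 - θ) * G ω u (M (σ u)) - θ * G ω u (M u))) ∂P ≤
      eexp (-(2 * θ * (1 - θ) * z)) ^ S.card

/-- Tail bound for the event that the transposition of two users is augmenting. -/
def SwapTail (P : Measure Ω) (M : U ≃ V) (G : Ω → Matrix U V ℝ) (z : ℝ) : Prop :=
  ∀ u u' : U, u ≠ u' →
    P {ω | G ω u (M u) + G ω u' (M u') ≤ G ω u (M u') + G ω u' (M u)} ≤ eexp (-z) / 2

/-- Entrywise measurability of a random matrix. -/
def ScoreMeasurable (P : Measure Ω) (G : Ω → Matrix U V ℝ) : Prop :=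
  ∀ u v, AEMeasurable (fun ω => G ω u v) P

variable {P : Measure Ω} {M : U ≃ V} {G : Ω → Matrix U V ℝ} {τ : ℝ} {m : Ω → Matrix U V ℝ}

lemma userErrors_eq_sum (m : Matrix U V ℝ) [DecidableEq U] [∀ u, Decidable (m u ≠ mapMatrix M u)] :
    (userErrors M m : ℝ≥0∞) = ∑ u, if m u ≠ mapMatrix M u then 1 else 0 := by
  unfold userErrors
  rw [Set.ncard_eq_toFinset_card']
  rw [Finset.sum_boole]
  congr 2
  ext u
  simp

lemma pairErrors_eq_sum (m : Matrix U V ℝ) [DecidableEq U]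
    [∀ u v, Decidable (m u v ≠ mapMatrix M u v)] :
    (pairErrors M m : ℝ≥0∞) = ∑ u, ∑ v, if m u v ≠ mapMatrix M u v then 1 else 0 := by
  unfold pairErrors
  rw [Set.ncard_eq_toFinset_card', ← Fintype.sum_prod_type', Finset.sum_boole]
  congr 2
  ext u
  simp

/-- A missed true pair has G ≤ τ and a false alarm has G ≥ τ. With τ = log n the n true pairs cost
n·n^θ and the n² false pairs n²·n^(-(1-θ)), both times the moment bound: the two kinds of error
balance, whence the factor 2. -/
theorem lintegral_threshold_errors_le {n : ℕ} (hn : 1 ≤ n) (hU : Fintype.card U = n)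
    (hG : ScoreMeasurable P G) {θ z : ℝ} (h0 : 0 ≤ θ) (h1 : θ ≤ 1)
    (hT : TrueMoment P M G θ z) (hF : FalseMoment P M G θ z)
    (hτ : τ = Real.log n) (hm : ∀ᵐ ω ∂P, Algorithm.threshold.IsOutput (G ω) τ (m ω)) :
    ∫⁻ ω, (pairErrors M (m ω) : ℝ≥0∞) ∂P ≤
      2 * eexp ((1 + θ) * Real.log n - θ * (1 - θ) * z) := by
  classical
  have hV : Fintype.card V = n := by rw [← Fintype.card_congr M, hU]
  have hpt : ∀ᵐ ω ∂P, (pairErrors M (m ω) : ℝ≥0∞) ≤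
      ∑ u, ∑ v, ((if M u = v then eexp (θ * τ) * eexp (-(θ * G ω u v)) else 0) +
        (if M u = v then 0 else eexp (-((1 - θ) * τ)) * eexp ((1 - θ) * G ω u v))) := by
    filter_upwards [hm] with ω hω
    rw [pairErrors_eq_sum]
    refine Finset.sum_le_sum fun u _ => Finset.sum_le_sum fun v _ => ?_
    split_ifs with he hv hv
    · rw [add_zero, ← eexp_add]
      apply one_le_eexp
      rw [mapMatrix, if_pos hv] at he
      have := threshold_entry hω u v 1 (by norm_num)
      rw [(hω.2.1 u v).resolve_right he] at this
      nlinarith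
    · rw [zero_add, ← eexp_add]
      apply one_le_eexp
      rw [mapMatrix, if_neg hv] at he
      have := threshold_entry hω u v 0 (by norm_num)
      rw [(hω.2.1 u v).resolve_left he] at this
      nlinarith
    · simp
    · simp
  have hmeas : ∀ c u v, AEMeasurable (fun ω => eexp (c * G ω u v)) P := fun c u v =>
    ((hG u v).const_mul c).eexp
  refine (lintegral_mono_ae hpt).trans ?_
  have hmT : ∀ u v, AEMeasurable (fun ω => if M u = v then
      eexp (θ * τ) * eexp (-(θ * G ω u v)) else 0) P := by
    intro u v
    split_ifs
    · exact (((hG u v).const_mul θ).fun_neg.eexp).const_mul _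
    · fun_prop
  have hmF : ∀ u v, AEMeasurable (fun ω => if M u = v then 0 else
      eexp (-((1 - θ) * τ)) * eexp ((1 - θ) * G ω u v)) P := by
    intro u v
    split_ifs
    · fun_prop
    · exact (hmeas _ u v).const_mul _
  rw [lintegral_finsetSum' _ fun u _ => Finset.aemeasurable_fun_sum _ fun v _ =>
    (hmT u v).fun_add (hmF u v)]
  have hT1 : ∀ u, ∫⁻ ω, eexp (-(θ * G ω u (M u))) ∂P ≤ eexp (-(θ * (1 - θ) * z)) := by
    intro u
    simpa using hT {u}
  calc ∑ u, ∫⁻ ω, ∑ v, ((if M u = v then eexp (θ * τ) * eexp (-(θ * G ω u v)) else 0) +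
        (if M u = v then 0 else eexp (-((1 - θ) * τ)) * eexp ((1 - θ) * G ω u v))) ∂P
      ≤ ∑ u : U, ∑ v : V, ((if M u = v then eexp (θ * τ) * eexp (-(θ * (1 - θ) * z)) else 0) +
        eexp (-((1 - θ) * τ)) * eexp (-(θ * (1 - θ) * z))) := by
        refine Finset.sum_le_sum fun u _ => ?_
        rw [lintegral_finsetSum' _ fun v _ => (hmT u v).fun_add (hmF u v)]
        refine Finset.sum_le_sum fun v _ => ?_
        rw [lintegral_add_left' (hmT u v)]
        gcongr
        · split_ifs with hv
          · subst hv
            rw [lintegral_const_mul'' _ ((hG u (M u)).const_mul θ).fun_neg.eexp]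
            gcongr
            exact hT1 u
          · simp
        · split_ifs with hv
          · simp
          · rw [lintegral_const_mul'' _ (hmeas _ u v)]
            gcongr
            exact hF u v hv
    _ = 2 * eexp ((1 + θ) * Real.log n - θ * (1 - θ) * z) := by
        simp only [Finset.sum_add_distrib, Finset.sum_ite_eq, Finset.mem_univ, if_true,
          Finset.sum_const, Finset.card_univ, hU, hV, nsmul_eq_mul, natCast_eq_eexp hn,
          ← eexp_add, hτ]
        rw [two_mul]
        congr 2 <;> ring

/-- The elementary inequality behind random coding bounds: if some `c j` is at least `T`, a weight
`D` is bounded by a geometric mean of exponential weights. -/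
lemma weight_le_geometric_mean {J : Type*} (s : Finset J) (c : J → ℝ) (T : ℝ) (D : ℝ≥0∞)
    (hD : D ≠ ∞) {r θ : ℝ} (hr0 : 0 < r) (hr1 : r ≤ 1) (hθ : r * (1 - θ) = θ) (hθ0 : 0 ≤ θ)
    {j : J} (hj : j ∈ s) (hc : T ≤ c j) :
    D ≤ (D * eexp (-(θ * T))) ^ (1 - r) *
      (∑ j ∈ s, D * eexp ((1 - θ) * c j - θ * T)) ^ r := by
  rcases eq_or_ne D 0 with h0 | h0
  · rw [h0]; exact zero_le
  calc D ≤ D * eexp (-(θ * T) * (1 - r) + ((1 - θ) * c j - θ * T) * r) := by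
        -- The relation r(1-θ) = θ collapses the exponent to θ(c j - T).
        have : 0 ≤ -(θ * T) * (1 - r) + ((1 - θ) * c j - θ * T) * r := by
          have : -(θ * T) * (1 - r) + ((1 - θ) * c j - θ * T) * r =
            r * (1 - θ) * c j - θ * T := by ring
          rw [this, hθ]
          linarith [mul_le_mul_of_nonneg_left hc hθ0]
        calc D = D * 1 := (mul_one D).symm
          _ ≤ _ := by gcongr; exact one_le_eexp this
    _ = (D * eexp (-(θ * T))) ^ (1 - r) * (D * eexp ((1 - θ) * c j - θ * T)) ^ r := by
        rw [ENNReal.mul_rpow_of_nonneg _ _ (by linarith), ENNReal.mul_rpow_of_nonneg _ _ hr0.le,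
          eexp_rpow, eexp_rpow, eexp_add]
        have : D = D ^ (1 - r) * D ^ r := by
          rw [← ENNReal.rpow_add _ _ h0 hD]; simp
        conv_lhs => rw [this]
        ring
    _ ≤ _ := by
        gcongr
        exact Finset.single_le_sum (f := fun j => D * eexp ((1 - θ) * c j - θ * T))
          (fun _ _ => zero_le) hj

lemma lintegral_geometric_mean_le {f g : Ω → ℝ≥0∞} (hf : AEMeasurable f P) (hg : AEMeasurable g P)
    {r : ℝ} (hr0 : 0 ≤ r) (hr1 : r ≤ 1) :
    ∫⁻ ω, f ω ^ (1 - r) * g ω ^ r ∂P ≤ (∫⁻ ω, f ω ∂P) ^ (1 - r) * (∫⁻ ω, g ω ∂P) ^ r :=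
  ENNReal.lintegral_mul_norm_pow_le hf hg (by linarith) hr0 (by ring)

/-- Per user, `weight_le_geometric_mean` and Hölder give the (1-r)-th power of a true moment times
the r-th power of a sum of at most n pair moments; summing over users gives the remaining factor n.
-/
theorem lintegral_maxRow_errors_le [DecidableEq U] {n : ℕ} (hn : 1 ≤ n)
    (hU : Fintype.card U = n)
    (hG : ScoreMeasurable P G) {r θ z z' : ℝ} (hr0 : 0 < r) (hr1 : r ≤ 1)
    (hθ : r * (1 - θ) = θ) (hθ0 : 0 ≤ θ)
    (hT : TrueMoment P M G θ z) (hF : PairMoment P M G θ z')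
    (hm : ∀ᵐ ω ∂P, Algorithm.maxRow.IsOutput (G ω) τ (m ω)) :
    ∫⁻ ω, (userErrors M (m ω) : ℝ≥0∞) ∂P ≤
      eexp ((1 + r) * Real.log n - θ * (1 - θ) * ((1 - r) * z + 2 * r * z')) := by
  classical
  have hV : Fintype.card V = n := by rw [← Fintype.card_congr M, hU]
  set f : U → Ω → ℝ≥0∞ := fun u ω => 1 * eexp (-(θ * G ω u (M u))) with hf
  set g : U → V → Ω → ℝ≥0∞ := fun u v ω => 1 * eexp ((1 - θ) * G ω u v - θ * G ω u (M u)) with hg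
  have hfm : ∀ u, AEMeasurable (f u) P := fun u =>
    (((hG u (M u)).const_mul θ).fun_neg.eexp).const_mul _
  have hgm : ∀ u v, AEMeasurable (g u v) P := fun u v =>
    ((((hG u v).const_mul (1 - θ)).fun_sub ((hG u (M u)).const_mul θ)).eexp).const_mul _
  have hgs : ∀ u, AEMeasurable (fun ω => ∑ v ∈ Finset.univ.filter (M u ≠ ·), g u v ω) P := fun u =>
    Finset.aemeasurable_fun_sum _ fun v _ => hgm u v
  have hpt : ∀ᵐ ω ∂P, (userErrors M (m ω) : ℝ≥0∞) ≤
      ∑ u, f u ω ^ (1 - r) * (∑ v ∈ Finset.univ.filter (M u ≠ ·), g u v ω) ^ r := by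
    filter_upwards [hm] with ω hω
    rw [userErrors_eq_sum]
    refine Finset.sum_le_sum fun u _ => ?_
    split_ifs with he
    · obtain ⟨v, hv, hle⟩ := maxRow_error hω he
      exact weight_le_geometric_mean _ (fun v => G ω u v) (G ω u (M u)) 1 (by simp) hr0 hr1 hθ hθ0
        (j := v) (by simp [hv]) hle
    · exact zero_le
  refine (lintegral_mono_ae hpt).trans ?_
  rw [lintegral_finsetSum' _ fun u _ => ((hfm u).pow_const _).fun_mul ((hgs u).pow_const _)]
  have hterm : ∀ u, ∫⁻ ω, f u ω ^ (1 - r) *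
      (∑ v ∈ Finset.univ.filter (M u ≠ ·), g u v ω) ^ r ∂P ≤
      eexp (r * Real.log n - θ * (1 - θ) * ((1 - r) * z + 2 * r * z')) := by
    intro u
    refine (lintegral_geometric_mean_le (hfm u) (hgs u) hr0.le hr1).trans ?_
    have h1 : ∫⁻ ω, f u ω ∂P ≤ eexp (-(θ * (1 - θ) * z)) := by
      have := hT {u}
      simpa [hf] using this
    have h2 : ∫⁻ ω, ∑ v ∈ Finset.univ.filter (M u ≠ ·), g u v ω ∂P ≤
        eexp (Real.log n) * eexp (-(2 * θ * (1 - θ) * z')) := by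
      rw [lintegral_finsetSum' _ fun v _ => hgm u v]
      calc ∑ v ∈ Finset.univ.filter (M u ≠ ·), ∫⁻ ω, g u v ω ∂P
          ≤ ∑ v ∈ Finset.univ.filter (M u ≠ ·), eexp (-(2 * θ * (1 - θ) * z')) := by
            refine Finset.sum_le_sum fun v hv => ?_
            have hv' : M u ≠ v := by simpa using hv
            have hne : M.symm v ≠ u := by rintro rfl; simp at hv'
            -- The false pair (u, v) is realized by the transposition of `u` with M⁻¹v, restricted
            -- to the single user `u`.
            have := hF (Equiv.swap u (M.symm v)) {u} (by
              rw [Finset.singleton_subset_iff, Equiv.Perm.mem_support, Equiv.swap_apply_left]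
              exact hne)
            simpa [hg] using this
        _ ≤ ∑ v : V, eexp (-(2 * θ * (1 - θ) * z')) :=
            Finset.sum_le_sum_of_subset (Finset.filter_subset _ _)
        _ = _ := by
            rw [Finset.sum_const, Finset.card_univ, hV, nsmul_eq_mul, natCast_eq_eexp hn]
    calc (∫⁻ ω, f u ω ∂P) ^ (1 - r) *
          (∫⁻ ω, ∑ v ∈ Finset.univ.filter (M u ≠ ·), g u v ω ∂P) ^ r
        ≤ eexp (-(θ * (1 - θ) * z)) ^ (1 - r) *
          (eexp (Real.log n) * eexp (-(2 * θ * (1 - θ) * z'))) ^ r := by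
          have : 0 ≤ 1 - r := by linarith
          gcongr
      _ = _ := by
          rw [← eexp_add, eexp_rpow, eexp_rpow, ← eexp_add]
          congr 1; ring
  refine (Finset.sum_le_sum fun u _ => hterm u).trans (le_of_eq ?_)
  rw [Finset.sum_const, Finset.card_univ, hU, nsmul_eq_mul, natCast_eq_eexp hn, ← eexp_add]
  congr 1; ring

/-- The event that a permutation is augmenting has exponentially small probability. -/
lemma measure_augmenting_le [DecidableEq U] (hG : ScoreMeasurable P G) {z : ℝ}
    (hF : PairMoment P M G (1 / 2) z) (c : Equiv.Perm U) :
    P {ω | ∑ u ∈ c.support, G ω u (M u) ≤ ∑ u ∈ c.support, G ω u (M (c u))} ≤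
      eexp (-(z / 2)) ^ c.support.card := by
  have h := hF c c.support (Finset.Subset.refl _)
  refine le_trans ?_ (h.trans (le_of_eq ?_))
  · have hmeas : AEMeasurable (fun ω => eexp (∑ u ∈ c.support,
        ((1 - 1 / 2 : ℝ) * G ω u (M (c u)) - 1 / 2 * G ω u (M u)))) P :=
      AEMeasurable.eexp (Finset.aemeasurable_fun_sum _ fun u _ =>
        ((hG _ _).const_mul _).fun_sub ((hG _ _).const_mul _))
    refine le_trans (measure_mono ?_) ((mul_meas_ge_le_lintegral₀ hmeas 1).trans' (by rw [one_mul]))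
    intro ω hω
    simp only [Set.mem_ofPred_eq] at hω ⊢
    apply one_le_eexp
    rw [Finset.sum_sub_distrib, ← Finset.mul_sum, ← Finset.mul_sum]
    linarith
  · congr 2; ring

/-- There are C(n,l)·(l-1)! cycles of length l. The extra factor l is the number of users that such
a cycle misaligns. -/
lemma card_isCycle_mul_eq [DecidableEq U] {n l : ℕ} (hU : Fintype.card U = n) (hl : 2 ≤ l)
    (hln : l ≤ n) (T : Finset (Equiv.Perm U)) (hT : ∀ c, c ∈ T ↔ c.IsCycle ∧ c.support.card = l) :
    T.card * l = n.descFactorial l := by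
  have h1 : T = Finset.univ.filter fun c : Equiv.Perm U => c.cycleType = {l} := by
    ext c
    rw [hT]
    simp only [Finset.mem_filter, Finset.mem_univ, true_and]
    constructor
    · rintro ⟨h, h'⟩; rw [h.cycleType, h']
    · intro h
      refine ⟨Equiv.Perm.card_cycleType_eq_one.1 (by rw [h]; simp), ?_⟩
      rw [← Equiv.Perm.sum_cycleType, h]; simp
  have h2 := Equiv.Perm.card_of_cycleType_singleton (α := U) hl (by rw [hU]; exact hln)
  rw [h1, h2, hU, Nat.descFactorial_eq_factorial_mul_choose]
  rw [mul_right_comm, mul_comm _ l, Nat.mul_factorial_pred (by lia)]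

/-- The misaligned users are the disjoint union of the supports of the cycles of σ, all of them
augmenting. So the error count is at most the total length of all augmenting cycles, whose
expectation is linear. -/
theorem lintegral_maxLikelihood_errors_le_sum_cycles [DecidableEq U] {n : ℕ}
    (hU : Fintype.card U = n) (p : ℕ → ℝ≥0∞)
    (hG : ScoreMeasurable P G)
    (hp : ∀ c : Equiv.Perm U, c.IsCycle →
      P {ω | ∑ u ∈ c.support, G ω u (M u) ≤ ∑ u ∈ c.support, G ω u (M (c u))} ≤
        p c.support.card)
    (hm : ∀ᵐ ω ∂P, Algorithm.maxLikelihood.IsOutput (G ω) τ (m ω)) :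
    ∫⁻ ω, (userErrors M (m ω) : ℝ≥0∞) ∂P ≤
      ∑ l ∈ Finset.Icc 2 n, (n.descFactorial l : ℝ≥0∞) * p l := by
  classical
  set A : Equiv.Perm U → Set Ω := fun c =>
    {ω | ∑ u ∈ c.support, G ω u (M u) ≤ ∑ u ∈ c.support, G ω u (M (c u))} with hA
  set C : Finset (Equiv.Perm U) := Finset.univ.filter fun c => c.IsCycle with hC
  have hpt : ∀ᵐ ω ∂P, (userErrors M (m ω) : ℝ≥0∞) ≤
      ∑ c ∈ C, (A c).indicator (fun _ => (c.support.card : ℝ≥0∞)) ω := by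
    filter_upwards [hm] with ω hω
    obtain ⟨σ, hσ, hopt⟩ := maxLikelihood_output M hω
    rw [hσ, ← Equiv.Perm.sum_cycleType, Equiv.Perm.cycleType_def]
    have hs : ((σ.cycleFactorsFinset.1.map (Finset.card ∘ Equiv.Perm.support)).sum : ℝ≥0∞) =
        ∑ c ∈ σ.cycleFactorsFinset, (c.support.card : ℝ≥0∞) := by
      rw [← Finset.sum_eq_multiset_sum]; push_cast; rfl
    rw [hs]
    calc ∑ c ∈ σ.cycleFactorsFinset, (c.support.card : ℝ≥0∞)
        = ∑ c ∈ σ.cycleFactorsFinset,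
          (A c).indicator (fun _ => (c.support.card : ℝ≥0∞)) ω := by
          refine Finset.sum_congr rfl fun c hc => ?_
          rw [Set.indicator_of_mem]
          exact augmenting_of_mem_cycleFactors hopt hc
      _ ≤ _ := by
          apply Finset.sum_le_sum_of_subset
          intro c hc
          simp [hC, (Equiv.Perm.mem_cycleFactorsFinset_iff.1 hc).1]
  refine (lintegral_mono_ae hpt).trans ?_
  have hAm : ∀ c, NullMeasurableSet (A c) P := fun c =>
    nullMeasurableSet_le (Finset.aemeasurable_fun_sum _ fun u _ => hG _ _)
      (Finset.aemeasurable_fun_sum _ fun u _ => hG _ _)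
  rw [lintegral_finsetSum' _ fun c _ => (aemeasurable_const.indicator₀ (hAm c))]
  have h1 : ∀ c ∈ C, ∫⁻ ω, (A c).indicator (fun _ => (c.support.card : ℝ≥0∞)) ω ∂P ≤
      c.support.card * p c.support.card := by
    intro c hc
    rw [lintegral_indicator_const₀ (hAm c)]
    gcongr
    exact hp c (by simpa [hC] using hc)
  refine (Finset.sum_le_sum h1).trans ?_
  have hmaps : ∀ c ∈ C, c.support.card ∈ Finset.Icc 2 n := by
    intro c hc
    rw [Finset.mem_Icc]
    refine ⟨Equiv.Perm.IsCycle.two_le_card_support (by simpa [hC] using hc), ?_⟩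
    rw [← hU]; exact Finset.card_le_univ _
  rw [← Finset.sum_fiberwise_of_maps_to hmaps]
  refine Finset.sum_le_sum fun l hl => le_of_eq ?_
  rw [Finset.mem_Icc] at hl
  have h2 : ∀ c ∈ C.filter (fun c => c.support.card = l),
      (c.support.card : ℝ≥0∞) * p c.support.card = l * p l := by
    intro c hc
    rw [(Finset.mem_filter.1 hc).2]
  rw [Finset.sum_congr rfl h2, Finset.sum_const, nsmul_eq_mul, ← mul_assoc, ←
    card_isCycle_mul_eq hU hl.1 hl.2 (C.filter fun c => c.support.card = l) (by simp [hC])]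
  push_cast
  rfl

/-- Derangements of `S` are counted among all permutations of `S`. -/
lemma card_support_eq_le_factorial [DecidableEq U] (S : Finset U) :
    (Finset.univ.filter fun σ : Equiv.Perm U => σ.support = S).card ≤ S.card.factorial := by
  classical
  have h : Fintype.card {f : Equiv.Perm U // ∀ a, ¬ a ∈ S → f a = a} = S.card.factorial := by
    rw [← Fintype.card_congr (Equiv.Perm.subtypeEquivSubtypePerm (fun a => a ∈ S)),
      Fintype.card_perm]
    simp
  rw [← h, Fintype.card_subtype]
  refine Finset.card_le_card fun σ hσ => ?_
  simp only [Finset.mem_filter, Finset.mem_univ, true_and] at hσ ⊢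
  intro a ha
  rw [← hσ] at ha
  exact Equiv.Perm.notMem_support.1 ha

/-- Random coding bound for maximum likelihood estimation: a union bound over the set `S` of
misaligned users, and a geometric mean bound over the permutations with support `S`. -/
theorem lintegral_maxLikelihood_errors_le_sum_supports [DecidableEq U] [IsProbabilityMeasure P]
    {n : ℕ}
    (hU : Fintype.card U = n) (hG : ScoreMeasurable P G) {r θ : ℝ} (hr0 : 0 < r) (hr1 : r ≤ 1)
    (hθ : r * (1 - θ) = θ) (hθ0 : 0 ≤ θ) (L : ℕ)
    (Y : Finset U → Ω → ℝ≥0∞) (hY : ∀ S, AEMeasurable (Y S) P) (hYtop : ∀ S ω, Y S ω ≠ ∞)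
    (bad : Set Ω) (hbad : NullMeasurableSet bad P) (D A B : ℝ≥0∞)
    (hD : ∀ ω, ω ∉ bad → ∀ S, 1 ≤ D * Y S ω)
    (hA : ∀ S : Finset U, ∫⁻ ω, Y S ω * eexp (-(θ * ∑ u ∈ S, G ω u (M u))) ∂P ≤ A ^ S.card)
    (hB : ∀ σ : Equiv.Perm U, ∫⁻ ω, Y σ.support ω *
      eexp (∑ u ∈ σ.support, ((1 - θ) * G ω u (M (σ u)) - θ * G ω u (M u))) ∂P ≤
        B ^ σ.support.card)
    (hm : ∀ᵐ ω ∂P, Algorithm.maxLikelihood.IsOutput (G ω) τ (m ω)) :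
    ∫⁻ ω, (userErrors M (m ω) : ℝ≥0∞) ∂P ≤ L + n * (P bad + ∑ k ∈ Finset.Ioc L n,
      (n.choose k : ℝ≥0∞) *
        (D * ((A ^ k) ^ (1 - r) * ((k.factorial : ℝ≥0∞) * B ^ k) ^ r))) := by
  classical
  set f : Finset U → Ω → ℝ≥0∞ := fun S ω => Y S ω * eexp (-(θ * ∑ u ∈ S, G ω u (M u))) with hf
  set g : Equiv.Perm U → Finset U → Ω → ℝ≥0∞ := fun σ S ω => Y S ω *
    eexp ((1 - θ) * (∑ u ∈ S, G ω u (M (σ u))) - θ * ∑ u ∈ S, G ω u (M u)) with hg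
  set Q : Finset U → Finset (Equiv.Perm U) := fun S => Finset.univ.filter fun σ => σ.support = S
    with hQ
  set F : Finset U → Ω → ℝ≥0∞ := fun S ω => f S ω ^ (1 - r) * (∑ σ ∈ Q S, g σ S ω) ^ r with hF
  have hsum : ∀ (S : Finset U) (π : U → U), AEMeasurable (fun ω => ∑ u ∈ S, G ω u (M (π u))) P :=
    fun S π => Finset.aemeasurable_fun_sum _ fun u _ => hG _ _
  have hfm : ∀ S, AEMeasurable (f S) P := fun S => (hY S).fun_mul
    ((hsum S id).const_mul θ).fun_neg.eexp
  have hgm : ∀ σ S, AEMeasurable (g σ S) P := fun σ S => (hY S).fun_mul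
    (((hsum S σ).const_mul (1 - θ)).fun_sub ((hsum S id).const_mul θ)).eexp
  have hgs : ∀ S, AEMeasurable (fun ω => ∑ σ ∈ Q S, g σ S ω) P := fun S =>
    Finset.aemeasurable_fun_sum _ fun σ _ => hgm σ S
  have hFm : ∀ S, AEMeasurable (F S) P := fun S => ((hfm S).pow_const _).fun_mul ((hgs S).pow_const _)
  -- Supports of size at most `L` are charged `L`. A larger one costs at most `n`, and then either
  -- `bad` occurs or the term of its own support is at least 1, because 1 ≤ D·Y and Y is bounded by
  -- the geometric mean `F`.
  have hpt : ∀ᵐ ω ∂P, (userErrors M (m ω) : ℝ≥0∞) ≤ L + n * (bad.indicator (fun _ => 1) ω +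
      ∑ k ∈ Finset.Ioc L n, ∑ S ∈ Finset.univ.powersetCard k, D * F S ω) := by
    filter_upwards [hm] with ω hω
    obtain ⟨σ, hσ, hopt⟩ := maxLikelihood_output M hω
    have hle : σ.support.card ≤ n := by rw [← hU]; exact Finset.card_le_univ _
    rw [hσ]
    by_cases hL : σ.support.card ≤ L
    · exact le_add_right (by exact_mod_cast hL)
    · refine le_add_left ?_
      have h1 : (1 : ℝ≥0∞) ≤ bad.indicator (fun _ => 1) ω +
          ∑ k ∈ Finset.Ioc L n, ∑ S ∈ Finset.univ.powersetCard k, D * F S ω := by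
        by_cases hb : ω ∈ bad
        · rw [Set.indicator_of_mem hb]; exact le_add_right le_rfl
        · refine le_add_left ?_
          calc (1 : ℝ≥0∞) ≤ D * Y σ.support ω := hD ω hb _
            _ ≤ D * F σ.support ω := by
                gcongr
                exact weight_le_geometric_mean (Q σ.support)
                  (fun π => ∑ u ∈ σ.support, G ω u (M (π u))) (∑ u ∈ σ.support, G ω u (M u))
                  (Y σ.support ω) (hYtop _ _) hr0 hr1 hθ hθ0 (j := σ) (by simp [hQ])
                  (augmenting_support hopt)
            _ ≤ ∑ S ∈ Finset.univ.powersetCard σ.support.card, D * F S ω :=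
                Finset.single_le_sum (f := fun S => D * F S ω) (fun _ _ => zero_le)
                  (by simp [Finset.mem_powersetCard])
            _ ≤ _ := Finset.single_le_sum
                (f := fun k => ∑ S ∈ Finset.univ.powersetCard k, D * F S ω)
                (fun _ _ => zero_le) (by rw [Finset.mem_Ioc]; exact ⟨by lia, hle⟩)
      calc (σ.support.card : ℝ≥0∞) ≤ n := by exact_mod_cast hle
        _ = n * 1 := (mul_one _).symm
        _ ≤ _ := by gcongr
  refine (lintegral_mono_ae hpt).trans ?_
  have hDF : ∀ k, AEMeasurable (fun ω => ∑ S ∈ Finset.univ.powersetCard k, D * F S ω) P :=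
    fun k => Finset.aemeasurable_fun_sum _ fun S _ => (hFm S).const_mul D
  have hDF' : AEMeasurable (fun ω => ∑ k ∈ Finset.Ioc L n,
      ∑ S ∈ Finset.univ.powersetCard k, D * F S ω) P :=
    Finset.aemeasurable_fun_sum _ fun k _ => hDF k
  have hind : AEMeasurable (bad.indicator fun _ => (1 : ℝ≥0∞)) P := aemeasurable_const.indicator₀ hbad
  rw [lintegral_add_left' aemeasurable_const, lintegral_const, measure_univ, mul_one,
    lintegral_const_mul'' _ (hind.fun_add hDF'), lintegral_add_left' hind,
    lintegral_indicator_const₀ hbad, one_mul, lintegral_finsetSum' _ fun k _ => hDF k]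
  gcongr with k hk
  rw [lintegral_finsetSum' _ fun S _ => (hFm S).const_mul D]
  have hS : ∀ S ∈ Finset.univ.powersetCard k, ∫⁻ ω, D * F S ω ∂P ≤
      D * ((A ^ k) ^ (1 - r) * ((k.factorial : ℝ≥0∞) * B ^ k) ^ r) := by
    intro S hSk
    rw [Finset.mem_powersetCard] at hSk
    rw [lintegral_const_mul'' _ (hFm S)]
    gcongr
    refine (lintegral_geometric_mean_le (hfm S) (hgs S) hr0.le hr1).trans ?_
    have h1r : 0 ≤ 1 - r := by linarith
    gcongr
    · rw [← hSk.2]; exact hA S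
    · rw [lintegral_finsetSum' _ fun σ _ => hgm σ S]
      calc ∑ σ ∈ Q S, ∫⁻ ω, g σ S ω ∂P ≤ ∑ σ ∈ Q S, B ^ k := by
            refine Finset.sum_le_sum fun σ hσ => ?_
            have hσ' : σ.support = S := by simpa [hQ] using hσ
            rw [← hSk.2, ← hσ']
            refine le_trans (le_of_eq ?_) (hB σ)
            refine lintegral_congr fun ω => ?_
            rw [hg]
            simp only [Finset.sum_sub_distrib, Finset.mul_sum]
        _ = (Q S).card * B ^ k := by rw [Finset.sum_const, nsmul_eq_mul]
        _ ≤ _ := by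
            gcongr
            rw [← hSk.2]
            exact card_support_eq_le_factorial S
  refine (Finset.sum_le_sum hS).trans (le_of_eq ?_)
  rw [Finset.sum_const, Finset.card_powersetCard, Finset.card_univ, hU, nsmul_eq_mul]

end Moments

/-! ### Gaussian integrals on the line -/

section GaussianLine

open scoped NNReal

/-- Tilting a real Gaussian by the exponential of a quadratic polynomial. -/
lemma lintegral_mul_eexp_quadratic_gaussianReal {f : ℝ → ℝ≥0∞} (hf : Measurable f)
    (m : ℝ) (v : ℝ≥0) (b p : ℝ) (hq : 0 < 1 + p * v) :
    ∫⁻ x, f x * eexp (b * x - p * x ^ 2 / 2) ∂gaussianReal m v =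
      eexp ((b * m + b ^ 2 * v / 2 - p * m ^ 2 / 2) / (1 + p * v) - Real.log (1 + p * v) / 2) *
        ∫⁻ x, f x ∂gaussianReal ((m + b * v) / (1 + p * v)) (v / (1 + p * v).toNNReal) := by
  rcases eq_or_ne v 0 with hv | hv
  · subst hv
    simp only [NNReal.coe_zero, mul_zero, add_zero, div_one, Real.log_one, zero_div, sub_zero,
      gaussianReal_zero_var, lintegral_dirac' _ hf]
    rw [lintegral_dirac' _ (by fun_prop), mul_comm]
  have hv0 : (0 : ℝ) < v := lt_of_le_of_ne v.2 (by exact_mod_cast hv.symm)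
  set q : ℝ := 1 + p * v with hqdef
  set v' : ℝ≥0 := v / q.toNNReal with hv'
  have hv'r : (v' : ℝ) = v / q := by
    rw [hv', NNReal.coe_div, Real.coe_toNNReal _ hq.le]
  have hv'0 : v' ≠ 0 := by
    have : (0 : ℝ) < v' := by rw [hv'r]; positivity
    intro h; rw [h] at this; simp at this
  set m' : ℝ := (m + b * v) / q with hm'
  set K : ℝ := (b * m + b ^ 2 * v / 2 - p * m ^ 2 / 2) / q - Real.log q / 2 with hK
  -- Completing the square: the tilted density is a multiple of the Gaussian density with mean `m'`
  -- and variance `v'`.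
  have key : ∀ x, gaussianPDF m v x * eexp (b * x - p * x ^ 2 / 2) =
      eexp K * gaussianPDF m' v' x := by
    intro x
    rw [gaussianPDF, gaussianPDF, eexp, eexp, ← ENNReal.ofReal_mul (gaussianPDFReal_nonneg _ _ _),
      ← ENNReal.ofReal_mul (Real.exp_pos _).le]
    congr 1
    rw [gaussianPDFReal, gaussianPDFReal, hv'r]
    have hs : Real.sqrt (2 * Real.pi * (v / q)) = Real.sqrt (2 * Real.pi * v) * (Real.sqrt q)⁻¹ := by
      rw [← mul_div_assoc, Real.sqrt_div (by positivity)]; rfl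
    have he : Real.exp K = Real.exp ((b * m + b ^ 2 * v / 2 - p * m ^ 2 / 2) / q) *
        (Real.sqrt q)⁻¹ := by
      rw [hK, sub_eq_add_neg, Real.exp_add, Real.exp_neg, Real.sqrt_eq_rpow, Real.rpow_def_of_pos hq]
      congr 3; ring
    rw [hs, he, mul_inv, inv_inv]
    have hsq : Real.sqrt q ≠ 0 := (Real.sqrt_pos.2 hq).ne'
    have : Real.exp (-(x - m) ^ 2 / (2 * v)) * Real.exp (b * x - p * x ^ 2 / 2) =
        Real.exp ((b * m + b ^ 2 * v / 2 - p * m ^ 2 / 2) / q) *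
          Real.exp (-(x - m') ^ 2 / (2 * (v / q))) := by
      rw [← Real.exp_add, ← Real.exp_add]
      congr 1
      rw [hm']
      field_simp
      rw [hqdef]
      ring
    calc (Real.sqrt (2 * Real.pi * v))⁻¹ * Real.exp (-(x - m) ^ 2 / (2 * v)) *
          Real.exp (b * x - p * x ^ 2 / 2)
        = (Real.sqrt (2 * Real.pi * v))⁻¹ * (Real.exp (-(x - m) ^ 2 / (2 * v)) *
          Real.exp (b * x - p * x ^ 2 / 2)) := by ring
      _ = _ := by rw [this]; field_simp
  rw [gaussianReal_of_var_ne_zero _ hv, gaussianReal_of_var_ne_zero _ hv'0,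
    lintegral_withDensity_eq_lintegral_mul _ (measurable_gaussianPDF _ _) (by fun_prop),
    lintegral_withDensity_eq_lintegral_mul _ (measurable_gaussianPDF _ _) hf,
    ← lintegral_const_mul _ (by fun_prop)]
  refine lintegral_congr fun x => ?_
  simp only [Pi.mul_apply]
  rw [mul_left_comm, key x]
  ring

lemma lintegral_eexp_quadratic_gaussianReal (m : ℝ) (v : ℝ≥0) (b p : ℝ) (hq : 0 < 1 + p * v) :
    ∫⁻ x, eexp (b * x - p * x ^ 2 / 2) ∂gaussianReal m v =
      eexp ((b * m + b ^ 2 * v / 2 - p * m ^ 2 / 2) / (1 + p * v) -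
        Real.log (1 + p * v) / 2) := by
  have := lintegral_mul_eexp_quadratic_gaussianReal (f := fun _ => 1) measurable_const m v b p hq
  simpa using this

lemma lintegral_mul_eexp_linear_gaussianReal {f : ℝ → ℝ≥0∞} (hf : Measurable f)
    (m : ℝ) (v : ℝ≥0) (b : ℝ) :
    ∫⁻ x, f x * eexp (b * x) ∂gaussianReal m v =
      eexp (b * m + b ^ 2 * v / 2) * ∫⁻ x, f x ∂gaussianReal (m + b * v) v := by
  have := lintegral_mul_eexp_quadratic_gaussianReal hf m v b 0 (by norm_num)
  simpa using this

lemma lintegral_eexp_linear_gaussianReal (m : ℝ) (v : ℝ≥0) (b : ℝ) :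
    ∫⁻ x, eexp (b * x) ∂gaussianReal m v = eexp (b * m + b ^ 2 * v / 2) := by
  have := lintegral_mul_eexp_linear_gaussianReal (f := fun _ => 1) measurable_const m v b
  simpa using this

lemma gaussianReal_zero_Ici_zero {v : ℝ≥0} (hv : v ≠ 0) :
    gaussianReal 0 v (Set.Ici 0) = 1 / 2 := by
  have := nullSingletonClass_gaussianReal (μ := 0) hv
  have h1 : gaussianReal 0 v (Set.Iic 0) = gaussianReal 0 v (Set.Ici 0) := by
    have h := gaussianReal_map_neg (μ := 0) (v := v)
    rw [neg_zero] at h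
    conv_lhs => rw [← h]
    rw [Measure.map_apply (by fun_prop) measurableSet_Iic]
    congr 1
    ext x; simp
  have h2 : gaussianReal 0 v (Set.Iic 0) + gaussianReal 0 v (Set.Ici 0) = 1 := by
    rw [measure_congr (Iio_ae_eq_Iic (a := (0 : ℝ))).symm, ← measure_union _ measurableSet_Ici,
      Set.Iio_union_Ici, measure_univ]
    rw [Set.disjoint_left]
    intro x hx hx'
    simp at hx hx'
    linarith
  rw [h1, ← two_mul] at h2
  rw [ENNReal.eq_div_iff (by norm_num) (by norm_num)]
  exact h2

/-- Chernoff's bound for a Gaussian with nonpositive mean, with the additional factor `1 / 2`. -/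
lemma gaussianReal_Ici_zero_le {m : ℝ} (hm : m ≤ 0) {v : ℝ≥0} (hv : v ≠ 0) (t : ℝ) :
    gaussianReal m v (Set.Ici 0) ≤ eexp (t * m + t ^ 2 * v / 2) / 2 := by
  have hv0 : (0 : ℝ) < v := lt_of_le_of_ne v.2 (by exact_mod_cast hv.symm)
  -- N(m,v) is the tilt of N(0,v) by exp(bx - b²v/2). Since b ≤ 0 the tilt is at most exp(-b²v/2) on
  -- the half-line, which has mass 1/2 under N(0,v). A general t only does worse: the exponents
  -- differ by (b+t)²v/2.
  set b : ℝ := m / v with hb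
  have hbv : b * v = m := by rw [hb]; field_simp
  have hb0 : b ≤ 0 := div_nonpos_of_nonpos_of_nonneg hm hv0.le
  have h := lintegral_mul_eexp_linear_gaussianReal (f := (Set.Ici (0 : ℝ)).indicator 1)
    (measurable_one.indicator measurableSet_Ici) 0 v b
  rw [lintegral_indicator_one measurableSet_Ici, zero_add, hbv, mul_zero, zero_add] at h
  have h2 : ∫⁻ x, (Set.Ici (0 : ℝ)).indicator 1 x * eexp (b * x) ∂gaussianReal 0 v ≤ 1 / 2 := by
    rw [← gaussianReal_zero_Ici_zero hv, ← lintegral_indicator_one measurableSet_Ici]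
    refine lintegral_mono fun x => ?_
    by_cases hx : x ∈ Set.Ici (0 : ℝ)
    · rw [Set.indicator_of_mem hx]
      simp only [Pi.one_apply, one_mul]
      rw [← eexp_zero]
      exact eexp_mono (mul_nonpos_of_nonpos_of_nonneg hb0 hx)
    · simp [Set.indicator_of_notMem hx]
  rw [h] at h2
  calc gaussianReal m v (Set.Ici 0)
      = eexp (-(b ^ 2 * v / 2)) * (eexp (b ^ 2 * v / 2) * gaussianReal m v (Set.Ici 0)) := by
        rw [← mul_assoc, ← eexp_add, neg_add_cancel, eexp_zero, one_mul]
    _ ≤ eexp (-(b ^ 2 * v / 2)) * (1 / 2) := by gcongr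
    _ ≤ eexp (t * m + t ^ 2 * v / 2) * (1 / 2) := by
        gcongr
        apply eexp_mono
        rw [← hbv]
        nlinarith [mul_nonneg (sq_nonneg (b + t)) hv0.le]
    _ = _ := by rw [mul_one_div]

/-- The density is at most 1, so the interval [-h, 0) adds at most h to the half-line. -/
lemma gaussianReal_Ici_neg_le (h : ℝ) :
    gaussianReal 0 1 (Set.Ici (-h)) ≤ 1 / 2 + ENNReal.ofReal h := by
  have hsub : Set.Ici (-h) ⊆ Set.Ici 0 ∪ Set.Ico (-h) 0 := by
    intro x hx
    rcases le_or_gt 0 x with h0 | h0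
    · exact Or.inl h0
    · exact Or.inr ⟨hx, h0⟩
  refine (measure_mono hsub).trans ((measure_union_le _ _).trans ?_)
  rw [gaussianReal_zero_Ici_zero one_ne_zero]
  gcongr
  rw [gaussianReal_apply _ one_ne_zero]
  have hpdf : ∀ x, gaussianPDF 0 1 x ≤ 1 := by
    intro x
    rw [gaussianPDF, ← ENNReal.ofReal_one]
    apply ENNReal.ofReal_le_ofReal
    rw [gaussianPDFReal]
    have h1 : (Real.sqrt (2 * Real.pi * (1 : ℝ≥0)))⁻¹ ≤ 1 := by
      apply inv_le_one_of_one_le₀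
      rw [Real.one_le_sqrt]
      have := Real.pi_gt_three
      norm_num; linarith
    have h2 : Real.exp (-(x - 0) ^ 2 / (2 * (1 : ℝ≥0))) ≤ 1 := by
      rw [Real.exp_le_one_iff]
      norm_num
      have := sq_nonneg x
      linarith
    calc _ ≤ (1 : ℝ) * 1 := by gcongr
      _ = 1 := one_mul 1
  calc ∫⁻ x in Set.Ico (-h) 0, gaussianPDF 0 1 x ≤ ∫⁻ x in Set.Ico (-h) 0, 1 :=
        lintegral_mono fun x => hpdf x
    _ = ENNReal.ofReal h := by simp

/-- A linear combination of independent real Gaussians is Gaussian. -/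
lemma hasLaw_sum_gaussianReal {ι Ω : Type*} [MeasurableSpace Ω] {P : Measure Ω}
    [IsProbabilityMeasure P] {X : ι → Ω → ℝ} {m : ι → ℝ} {v : ι → ℝ≥0}
    (hX : ∀ i, HasLaw (X i) (gaussianReal (m i) (v i)) P) (hind : iIndepFun X P) (c : ι → ℝ)
    (s : Finset ι) :
    HasLaw (fun ω => ∑ i ∈ s, c i * X i ω)
      (gaussianReal (∑ i ∈ s, c i * m i) (∑ i ∈ s, .mk (c i ^ 2) (sq_nonneg _) * v i)) P := by
  classical
  have hc : ∀ i, HasLaw (fun ω => c i * X i ω)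
      (gaussianReal (c i * m i) ((.mk (c i ^ 2) (sq_nonneg _)) * v i)) P := fun i =>
    gaussianReal_const_mul (hX i) (c i)
  have hind' : iIndepFun (fun i ω => c i * X i ω) P :=
    hind.comp (fun i x => c i * x) fun i => by fun_prop
  induction s using Finset.induction_on with
  | empty =>
    simp only [Finset.sum_empty, gaussianReal_zero_var]
    exact ⟨aemeasurable_const, by simp⟩
  | insert i s hi ih =>
    simp only [Finset.sum_insert hi]
    have hI : IndepFun (fun ω => c i * X i ω) (fun ω => ∑ j ∈ s, c j * X j ω) P := by
      have := (hind'.indepFun_finsetSum_of_notMem₀ (fun i => (hc i).aemeasurable) hi).symm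
      convert! this using 1
      ext ω; simp
    exact ⟨(hc i).aemeasurable.add ih.aemeasurable,
      gaussianReal_add_gaussianReal_of_indepFun hI (hc i).map_eq ih.map_eq⟩

/-- The Chernoff bound with its factor 1/2, kept in terms of the exponential moment of `Y` itself.
For the gain of a transposition and t = 1/2 that moment is a pair moment at θ = 1/2. -/
lemma measure_nonneg_le_of_hasLaw_gaussianReal {Ω : Type*} [MeasurableSpace Ω] {P : Measure Ω}
    {Y : Ω → ℝ} {m : ℝ} {v : ℝ≥0} (hY : HasLaw Y (gaussianReal m v) P) (hm : m ≤ 0)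
    (hv : v ≠ 0) (t : ℝ) :
    P {ω | 0 ≤ Y ω} ≤ (∫⁻ ω, eexp (t * Y ω) ∂P) / 2 := by
  rw [hY.lintegral_comp (f := fun y => eexp (t * y)) (by fun_prop),
    lintegral_eexp_linear_gaussianReal, hY.measure_eq (p := fun y => 0 ≤ y) measurableSet_Ici]
  exact gaussianReal_Ici_zero_le hm hv t

end GaussianLine

/-! ### Moments of the planted matching scores -/

section Planted

variable {U : Type*} {V : Type*} [Fintype U] [Fintype V] [DecidableEq V] [DecidableEq U]
  {Ω : Type*} [MeasurableSpace Ω] {P : Measure Ω} {M : U ≃ V} {μ : ℝ} {W : U → V → Ω → ℝ}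

lemma IsPlantedMatching.lintegral_prod (h : IsPlantedMatching P M μ W)
    (F : U → V → ℝ → ℝ≥0∞) (hF : ∀ u v, Measurable (F u v)) :
    ∫⁻ ω, ∏ u, ∏ v, F u v (W u v ω) ∂P =
      ∏ u, ∏ v, ∫⁻ x, F u v x ∂gaussianReal (if M u = v then μ else 0) 1 := by
  have hlaw : ∀ p : U × V, HasLaw (W p.1 p.2) (gaussianReal (if M p.1 = p.2 then μ else 0) 1) P :=
    fun p => h.law p.1 p.2
  have := lintegral_prod_comp_of_iIndepFun (X := fun _ => ℝ) hlaw h.indep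
    (fun p => F p.1 p.2) (fun p => hF p.1 p.2)
  simpa only [Fintype.prod_prod_type] using this

lemma IsPlantedMatching.lintegral_prod_true (h : IsPlantedMatching P M μ W)
    (S : Finset U) (a : ℝ → ℝ≥0∞) (ha : Measurable a) :
    ∫⁻ ω, ∏ u ∈ S, a (W u (M u) ω) ∂P = (∫⁻ x, a x ∂gaussianReal μ 1) ^ S.card := by
  have key := h.lintegral_prod (fun u v x => if M u = v then (if u ∈ S then a x else 1) else 1)
    (fun u v => by split_ifs <;> fun_prop)
  simp only [Finset.prod_ite_eq, Finset.mem_univ, if_true, Finset.prod_ite_mem,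
    Finset.univ_inter] at key
  rw [key]
  have : ∀ u, ∏ v, ∫⁻ x, (if M u = v then (if u ∈ S then a x else 1) else 1)
      ∂gaussianReal (if M u = v then μ else 0) 1 =
      if u ∈ S then ∫⁻ x, a x ∂gaussianReal μ 1 else 1 := by
    intro u
    rw [Finset.prod_eq_single (M u)]
    · simp only [if_true]; split_ifs <;> simp
    · intro v _ hv
      simp [Ne.symm hv]
    · simp
  rw [Finset.prod_congr rfl fun u _ => this u, Finset.prod_ite_mem, Finset.univ_inter,
    Finset.prod_const]

/-- Since σ moves every user of `S`, the true and the false pairs involved are 2|S| distinct pairs,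
so all the weights are independent. -/
lemma IsPlantedMatching.lintegral_prod_pair (h : IsPlantedMatching P M μ W) (σ : Equiv.Perm U)
    (S : Finset U) (hS : S ⊆ σ.support) (a b : ℝ → ℝ≥0∞) (ha : Measurable a) (hb : Measurable b) :
    ∫⁻ ω, ∏ u ∈ S, (a (W u (M u) ω) * b (W u (M (σ u)) ω)) ∂P =
      ((∫⁻ x, a x ∂gaussianReal μ 1) * ∫⁻ x, b x ∂gaussianReal 0 1) ^ S.card := by
  have hne : ∀ u ∈ S, M u ≠ M (σ u) := fun u hu he =>
    Equiv.Perm.mem_support.1 (hS hu) (M.injective he).symm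
  have key := h.lintegral_prod (fun u v x => if u ∈ S then
    (if M u = v then a x else if M (σ u) = v then b x else 1) else 1)
    (fun u v => by split_ifs <;> fun_prop)
  have hprod : ∀ (u : U) (A B : V → ℝ≥0∞), u ∈ S →
      ∏ v, (if M u = v then A v else if M (σ u) = v then B v else 1) =
        A (M u) * B (M (σ u)) := by
    intro u A B hu
    have : ∀ v, (if M u = v then A v else if M (σ u) = v then B v else 1) =
        (if M u = v then A v else 1) * (if M (σ u) = v then B v else 1) := by
      intro v
      by_cases h1 : M u = v
      · have h2 : M (σ u) ≠ v := fun h2 => hne u hu (h1.trans h2.symm)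
        rw [if_pos h1, if_pos h1, if_neg h2, mul_one]
      · rw [if_neg h1, if_neg h1, one_mul]
    rw [Finset.prod_congr rfl fun v _ => this v, Finset.prod_mul_distrib]
    simp
  have hl : ∀ ω, ∏ u, ∏ v, (if u ∈ S then (if M u = v then a (W u v ω) else
      if M (σ u) = v then b (W u v ω) else 1) else 1) =
      ∏ u ∈ S, (a (W u (M u) ω) * b (W u (M (σ u)) ω)) := by
    intro ω
    have : ∀ u, ∏ v, (if u ∈ S then (if M u = v then a (W u v ω) else
        if M (σ u) = v then b (W u v ω) else 1) else 1) =
        if u ∈ S then a (W u (M u) ω) * b (W u (M (σ u)) ω) else 1 := by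
      intro u
      split_ifs with hu
      · exact hprod u (fun v => a (W u v ω)) (fun v => b (W u v ω)) hu
      · simp
    rw [Finset.prod_congr rfl fun u _ => this u, Finset.prod_ite_mem, Finset.univ_inter]
  simp only [hl] at key
  rw [key]
  have hr : ∀ u, ∏ v, ∫⁻ x, (if u ∈ S then (if M u = v then a x else
      if M (σ u) = v then b x else 1) else 1) ∂gaussianReal (if M u = v then μ else 0) 1 =
      if u ∈ S then (∫⁻ x, a x ∂gaussianReal μ 1) * ∫⁻ x, b x ∂gaussianReal 0 1 else 1 := by
    intro u
    split_ifs with hu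
    · rw [← hprod u (fun _ => ∫⁻ x, a x ∂gaussianReal μ 1)
        (fun _ => ∫⁻ x, b x ∂gaussianReal 0 1) hu]
      refine Finset.prod_congr rfl fun v _ => ?_
      split_ifs <;> simp
    · simp
  rw [Finset.prod_congr rfl fun u _ => hr u, Finset.prod_ite_mem, Finset.univ_inter,
    Finset.prod_const]

lemma IsPlantedMatching.scoreMeasurable (h : IsPlantedMatching P M μ W) :
    ScoreMeasurable P (plantedScore μ W) := by
  intro u v
  have := (h.law u v).aemeasurable
  unfold plantedScore
  fun_prop

/-- Weighted moments of the true pairs: the weight is averaged under the tilted law. -/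
lemma lintegral_weight_true_score (μ θ : ℝ) (φ : ℝ → ℝ≥0∞) (hφ : Measurable φ) :
    ∫⁻ x, φ x * eexp (-(θ * (μ * x - μ ^ 2 / 2))) ∂gaussianReal μ 1 =
      eexp (-(θ * (1 - θ) * (μ ^ 2 / 2))) * ∫⁻ x, φ x ∂gaussianReal ((1 - θ) * μ) 1 := by
  have h1 : ∀ x, φ x * eexp (-(θ * (μ * x - μ ^ 2 / 2))) =
      eexp (θ * μ ^ 2 / 2) * (φ x * eexp (-(θ * μ) * x)) := by
    intro x
    rw [mul_left_comm, ← eexp_add]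
    congr 2; ring
  simp only [h1]
  rw [lintegral_const_mul _ (by fun_prop), lintegral_mul_eexp_linear_gaussianReal hφ, ← mul_assoc,
    ← eexp_add]
  congr 2
  · norm_num; ring
  · norm_num; ring_nf

lemma lintegral_false_score (μ θ : ℝ) :
    ∫⁻ x, eexp ((1 - θ) * (μ * x - μ ^ 2 / 2)) ∂gaussianReal 0 1 =
      eexp (-(θ * (1 - θ) * (μ ^ 2 / 2))) := by
  have h1 : ∀ x : ℝ, eexp ((1 - θ) * (μ * x - μ ^ 2 / 2)) =
      eexp (-((1 - θ) * μ ^ 2 / 2)) * eexp (((1 - θ) * μ) * x) := by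
    intro x
    rw [← eexp_add]
    congr 1; ring
  simp only [h1]
  rw [lintegral_const_mul _ (by fun_prop), lintegral_eexp_linear_gaussianReal, ← eexp_add]
  congr 1
  norm_num; ring

/-- Moment bounds for the true pairs, weighted by a function of each true weight. -/
lemma IsPlantedMatching.lintegral_weight_true (h : IsPlantedMatching P M μ W) (θ : ℝ)
    (φ : ℝ → ℝ≥0∞) (hφ : Measurable φ) (S : Finset U) :
    ∫⁻ ω, (∏ u ∈ S, φ (W u (M u) ω)) *
        eexp (-(θ * ∑ u ∈ S, plantedScore μ W ω u (M u))) ∂P =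
      (eexp (-(θ * (1 - θ) * (μ ^ 2 / 2))) * ∫⁻ x, φ x ∂gaussianReal ((1 - θ) * μ) 1) ^ S.card := by
  rw [← lintegral_weight_true_score μ θ φ hφ, ← h.lintegral_prod_true S _ (by fun_prop)]
  refine lintegral_congr fun ω => ?_
  rw [Finset.mul_sum, ← Finset.sum_neg_distrib, eexp_sum, ← Finset.prod_mul_distrib]
  rfl

lemma IsPlantedMatching.lintegral_weight_pair (h : IsPlantedMatching P M μ W) (θ : ℝ)
    (φ : ℝ → ℝ≥0∞) (hφ : Measurable φ) (σ : Equiv.Perm U) (S : Finset U) (hS : S ⊆ σ.support) :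
    ∫⁻ ω, (∏ u ∈ S, φ (W u (M u) ω)) * eexp (∑ u ∈ S,
        ((1 - θ) * plantedScore μ W ω u (M (σ u)) - θ * plantedScore μ W ω u (M u))) ∂P =
      (eexp (-(2 * θ * (1 - θ) * (μ ^ 2 / 2))) *
        ∫⁻ x, φ x ∂gaussianReal ((1 - θ) * μ) 1) ^ S.card := by
  have h2 : eexp (-(2 * θ * (1 - θ) * (μ ^ 2 / 2))) = eexp (-(θ * (1 - θ) * (μ ^ 2 / 2))) *
      eexp (-(θ * (1 - θ) * (μ ^ 2 / 2))) := by
    rw [← eexp_add]; congr 1; ring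
  rw [h2, mul_right_comm]
  conv_rhs => rw [← lintegral_weight_true_score μ θ φ hφ, ← lintegral_false_score μ θ]
  rw [← h.lintegral_prod_pair σ S hS _ _ (by fun_prop) (by fun_prop)]
  refine lintegral_congr fun ω => ?_
  rw [eexp_sum, ← Finset.prod_mul_distrib]
  refine Finset.prod_congr rfl fun u _ => ?_
  rw [sub_eq_add_neg, add_comm, eexp_add, ← mul_assoc]
  rfl

lemma IsPlantedMatching.trueMoment (h : IsPlantedMatching P M μ W) (θ : ℝ) :
    TrueMoment P M (plantedScore μ W) θ (μ ^ 2 / 2) := by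
  intro S
  have := h.lintegral_weight_true θ (fun _ => 1) measurable_const S
  simp only [Finset.prod_const_one, one_mul, lintegral_one, measure_univ, mul_one] at this
  exact this.le

lemma IsPlantedMatching.pairMoment (h : IsPlantedMatching P M μ W) (θ : ℝ) :
    PairMoment P M (plantedScore μ W) θ (μ ^ 2 / 2) := by
  intro σ S hS
  have := h.lintegral_weight_pair θ (fun _ => 1) measurable_const σ S hS
  simp only [Finset.prod_const_one, one_mul, lintegral_one, measure_univ, mul_one] at this
  exact this.le

lemma IsPlantedMatching.falseMoment (h : IsPlantedMatching P M μ W) (θ : ℝ) :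
    FalseMoment P M (plantedScore μ W) θ (μ ^ 2 / 2) := by
  intro u v huv
  rw [← lintegral_false_score μ θ]
  have hl := h.law u v
  rw [if_neg huv] at hl
  exact (hl.lintegral_comp (f := fun x => eexp ((1 - θ) * (μ * x - μ ^ 2 / 2)))
    (by fun_prop)).le

lemma sum_swap_support {u u' : U} (huu : u ≠ u') (f : U → ℝ) :
    ∑ x ∈ (Equiv.swap u u').support, f x = f u + f u' := by
  rw [Equiv.Perm.support_swap huu, Finset.sum_pair huu]

/-- A tail bound for transpositions from a Gaussian law and a moment bound. -/
lemma measure_swap_le_of_pairMoment {G : Ω → Matrix U V ℝ} {z : ℝ}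
    (hF : PairMoment P M G (1 / 2) z) {u u' : U} (huu : u ≠ u')
    (hle : P {ω | G ω u (M u) + G ω u' (M u') ≤ G ω u (M u') + G ω u' (M u)} ≤
      (∫⁻ ω, eexp (1 / 2 * (G ω u (M u') + G ω u' (M u) - G ω u (M u) - G ω u' (M u'))) ∂P) / 2) :
    P {ω | G ω u (M u) + G ω u' (M u') ≤ G ω u (M u') + G ω u' (M u)} ≤ eexp (-z) / 2 := by
  refine hle.trans ?_
  gcongr
  have h := hF (Equiv.swap u u') (Equiv.swap u u').support (Finset.Subset.refl _)
  simp only [sum_swap_support huu] at h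
  rw [Equiv.Perm.support_swap huu, Finset.card_pair huu, Equiv.swap_apply_left,
    Equiv.swap_apply_right, eexp_pow] at h
  refine le_trans (le_of_eq ?_) (h.trans (le_of_eq ?_))
  · refine lintegral_congr fun ω => ?_
    congr 1; ring
  · congr 1; push_cast; ring

/-- The gain is a linear combination of four independent weights, thus Gaussian, with mean -2μ² < 0
and nonzero variance. -/
lemma IsPlantedMatching.swapTail [IsProbabilityMeasure P] (h : IsPlantedMatching P M μ W)
    (hμ : 0 < μ) : SwapTail P M (plantedScore μ W) (μ ^ 2 / 2) := by
  intro u u' huu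
  refine measure_swap_le_of_pairMoment (h.pairMoment (1 / 2)) huu ?_
  have hMu : M u ≠ M u' := fun he => huu (M.injective he)
  set c : U × V → ℝ := fun p => (if p = (u, M u') then μ else 0) + (if p = (u', M u) then μ else 0)
    - (if p = (u, M u) then μ else 0) - (if p = (u', M u') then μ else 0) with hc
  have hlaw := hasLaw_sum_gaussianReal (P := P) (X := fun p : U × V => W p.1 p.2)
    (fun p => h.law p.1 p.2) h.indep c Finset.univ
  have hsum : ∀ f : U × V → ℝ, ∑ p, c p * f p =
      μ * f (u, M u') + μ * f (u', M u) - μ * f (u, M u) - μ * f (u', M u') := by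
    intro f
    simp only [hc, sub_mul, add_mul, Finset.sum_sub_distrib, Finset.sum_add_distrib, ite_mul,
      zero_mul, Finset.sum_ite_eq', Finset.mem_univ, if_true]
  have hd : ∀ ω, ∑ p, c p * W p.1 p.2 ω = plantedScore μ W ω u (M u') + plantedScore μ W ω u' (M u)
      - plantedScore μ W ω u (M u) - plantedScore μ W ω u' (M u') := by
    intro ω
    rw [hsum fun p => W p.1 p.2 ω]
    simp only [plantedScore]
    ring
  have hmean : ∑ p, c p * (if M p.1 = p.2 then μ else 0) ≤ 0 := by
    rw [hsum fun p => if M p.1 = p.2 then μ else 0]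
    simp only [hMu, hMu.symm, if_true, if_false]
    nlinarith
  have hvar : (∑ p, NNReal.mk (c p ^ 2) (sq_nonneg _) * 1) ≠ 0 := by
    intro h0
    rw [Finset.sum_eq_zero_iff] at h0
    have := h0 (u, M u) (Finset.mem_univ _)
    rw [mul_one] at this
    have h2 : c (u, M u) ^ 2 = 0 := congrArg NNReal.toReal this
    have h3 : c (u, M u) = -μ := by
      simp [hc, hMu, huu]
    rw [h3] at h2
    nlinarith
  have key := measure_nonneg_le_of_hasLaw_gaussianReal hlaw hmean hvar (1 / 2)
  simp only [hd] at key
  refine le_trans (measure_mono fun ω hω => ?_) key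
  simp only [Set.mem_ofPred_eq] at hω ⊢
  linarith

end Planted

/-! ### Gaussian integrals for one pair of canonical coordinates -/

section Coordinate

open scoped NNReal

/-- The information density of a pair `(x, w)` with `w` centered of variance `t` and
`x - w` independent of `w`, centered of variance `1 - t`. -/
noncomputable def coordScore (t x w : ℝ) : ℝ :=
  -(Real.log (1 - t) / 2) + x ^ 2 / 2 - (x - w) ^ 2 / (2 * (1 - t))

@[fun_prop]
lemma measurable_coordScore {α : Type*} [MeasurableSpace α] (t : ℝ) {f g : α → ℝ}
    (hf : Measurable f) (hg : Measurable g) : Measurable fun a => coordScore t (f a) (g a) := by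
  unfold coordScore; fun_prop

/-- Bernoulli's inequality (1-t)^p ≤ 1 - pt. Both one-coordinate moments below equal
(1-t)^(θ/2)·(1-θ²t)^(-1/2), and the case p = θ² bounds this by (1-t)^(θ(1-θ)/2), the share of the
coordinate in exp(-θ(1-θ)ζ). -/
lemma log_one_sub_mul_le {t p : ℝ} (ht1 : t < 1) (hp0 : 0 ≤ p) (hp1 : p ≤ 1) :
    p * Real.log (1 - t) ≤ Real.log (1 - p * t) := by
  have h := rpow_one_add_le_one_add_mul_self (s := -t) (by linarith) hp0 hp1
  have h1 : (0 : ℝ) < 1 + -t := by linarith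
  have := Real.log_le_log (Real.rpow_pos_of_pos h1 p) h
  rw [Real.log_rpow h1] at this
  convert this using 2 <;> ring_nf

/-- Two successive Gaussian integrals: the noise z = x - w first, which leaves a quadratic
exponential in w. -/
lemma lintegral_eexp_neg_coordScore {t : ℝ} (ht0 : 0 ≤ t) (ht1 : t < 1) {θ : ℝ} (h0 : 0 ≤ θ)
    (h1 : θ ≤ 1) :
    ∫⁻ w, ∫⁻ z, eexp (-(θ * coordScore t (w + z) w)) ∂gaussianReal 0 (1 - t).toNNReal
      ∂gaussianReal 0 t.toNNReal ≤ eexp (-(θ * (1 - θ) * (-(Real.log (1 - t) / 2)))) := by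
  have hs : 0 < 1 - t := by linarith
  have hq : 0 < 1 - θ * t := by nlinarith
  have hθ2 : θ ^ 2 ≤ 1 := by nlinarith
  have hq2 : 0 < 1 - θ ^ 2 * t := by nlinarith
  have hts : ((1 - t).toNNReal : ℝ) = 1 - t := Real.coe_toNNReal _ hs.le
  have htt : (t.toNNReal : ℝ) = t := Real.coe_toNNReal _ ht0
  have e1 : 1 + (-(θ * t / (1 - t))) * ((1 - t).toNNReal : ℝ) = 1 - θ * t := by
    rw [hts]; field_simp; ring
  have e2 : 1 + (θ * (1 - θ) / (1 - θ * t)) * (t.toNNReal : ℝ) =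
      (1 - θ ^ 2 * t) / (1 - θ * t) := by
    rw [htt]; field_simp; ring
  have hin : ∀ w : ℝ, ∫⁻ z, eexp (-(θ * coordScore t (w + z) w)) ∂gaussianReal 0 (1 - t).toNNReal =
      eexp (θ * Real.log (1 - t) / 2 - Real.log (1 - θ * t) / 2) *
        eexp (0 * w - (θ * (1 - θ) / (1 - θ * t)) * w ^ 2 / 2) := by
    intro w
    have hint : ∀ z, eexp (-(θ * coordScore t (w + z) w)) =
        eexp (θ * Real.log (1 - t) / 2 - θ * w ^ 2 / 2) *
          eexp ((-(θ * w)) * z - (-(θ * t / (1 - t))) * z ^ 2 / 2) := by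
      intro z
      rw [← eexp_add, coordScore]
      congr 1
      field_simp
      ring
    simp only [hint]
    rw [lintegral_const_mul _ (by fun_prop),
      lintegral_eexp_quadratic_gaussianReal _ _ _ _ (by rw [e1]; exact hq), e1, hts, ← eexp_add,
      ← eexp_add]
    congr 1
    field_simp
    ring
  simp only [hin]
  rw [lintegral_const_mul _ (by fun_prop),
    lintegral_eexp_quadratic_gaussianReal _ _ _ _ (by rw [e2]; positivity), e2, ← eexp_add,
    Real.log_div hq2.ne' hq.ne']
  apply eexp_mono
  have := log_one_sub_mul_le (p := θ ^ 2) ht1 (by positivity) (by nlinarith)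
  norm_num
  linarith

/-- The value before the final estimate is that of the true pair, as it must be: the score is a
log-likelihood ratio, so E exp((1-θ)G) under independence equals E exp(-θG) under the joint law. -/
lemma lintegral_eexp_coordScore {t : ℝ} (ht0 : 0 ≤ t) (ht1 : t < 1) {θ : ℝ} (h0 : 0 ≤ θ)
    (h1 : θ ≤ 1) :
    ∫⁻ w, ∫⁻ x, eexp ((1 - θ) * coordScore t x w) ∂gaussianReal 0 1
      ∂gaussianReal 0 t.toNNReal ≤ eexp (-(θ * (1 - θ) * (-(Real.log (1 - t) / 2)))) := by
  have hs : 0 < 1 - t := by linarith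
  have hq : 0 < 1 - θ * t := by nlinarith
  have hθ2 : θ ^ 2 ≤ 1 := by nlinarith
  have hq2 : 0 < 1 - θ ^ 2 * t := by nlinarith
  have htt : (t.toNNReal : ℝ) = t := Real.coe_toNNReal _ ht0
  have e1 : 1 + ((1 - θ) * t / (1 - t)) * ((1 : ℝ≥0) : ℝ) = (1 - θ * t) / (1 - t) := by
    norm_num; field_simp; ring
  have e2 : 1 + (θ * (1 - θ) / (1 - θ * t)) * (t.toNNReal : ℝ) =
      (1 - θ ^ 2 * t) / (1 - θ * t) := by
    rw [htt]; field_simp; ring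
  have hin : ∀ w : ℝ, ∫⁻ x, eexp ((1 - θ) * coordScore t x w) ∂gaussianReal 0 1 =
      eexp (-((1 - θ) * Real.log (1 - t) / 2) -
        (Real.log (1 - θ * t) - Real.log (1 - t)) / 2) *
        eexp (0 * w - (θ * (1 - θ) / (1 - θ * t)) * w ^ 2 / 2) := by
    intro w
    have hint : ∀ x, eexp ((1 - θ) * coordScore t x w) =
        eexp (-((1 - θ) * Real.log (1 - t) / 2) - (1 - θ) * w ^ 2 / (2 * (1 - t))) *
          eexp (((1 - θ) * w / (1 - t)) * x - ((1 - θ) * t / (1 - t)) * x ^ 2 / 2) := by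
      intro x
      rw [← eexp_add, coordScore]
      congr 1
      field_simp
      ring
    simp only [hint]
    rw [lintegral_const_mul _ (by fun_prop),
      lintegral_eexp_quadratic_gaussianReal _ _ _ _ (by rw [e1]; positivity), e1, ← eexp_add,
      ← eexp_add, Real.log_div hq.ne' hs.ne']
    congr 1
    norm_num
    field_simp
    ring
  simp only [hin]
  rw [lintegral_const_mul _ (by fun_prop),
    lintegral_eexp_quadratic_gaussianReal _ _ _ _ (by rw [e2]; positivity), e2, ← eexp_add,
    Real.log_div hq2.ne' hq.ne']
  apply eexp_mono
  have := log_one_sub_mul_le (p := θ ^ 2) ht1 (by positivity) (by nlinarith)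
  norm_num
  linarith

/-- Mean of the pair weight over the noise `z`, as a kernel in the two values of `w`. -/
noncomputable def coordKernel (t θ w w' : ℝ) : ℝ≥0∞ :=
  ∫⁻ z, eexp ((1 - θ) * coordScore t (w + z) w' - θ * coordScore t (w + z) w)
    ∂gaussianReal 0 (1 - t).toNNReal

/-- Completing the square in the noise leaves a Gaussian kernel whose quadratic form is symmetric in
w and w'. With θ ≤ 1/2 the normalizing factor 1 + (1-2θ)t is positive. -/
lemma coordKernel_eq {t : ℝ} (ht0 : 0 ≤ t) (ht1 : t < 1) {θ : ℝ} (h1 : θ ≤ 1 / 2) (w w' : ℝ) :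
    coordKernel t θ w w' = eexp (-((1 - 2 * θ) * Real.log (1 - t) / 2) -
        Real.log (1 + (1 - 2 * θ) * t) / 2 -
        (1 - θ) / ((1 - t) * (1 + (1 - 2 * θ) * t)) *
          ((θ + (1 - 2 * θ) * t) * (w ^ 2 + w' ^ 2) - 2 * (1 - θ) * w * w') / 2) := by
  have hs : 0 < 1 - t := by linarith
  have hq : 0 < 1 + (1 - 2 * θ) * t := by nlinarith
  have hts : ((1 - t).toNNReal : ℝ) = 1 - t := Real.coe_toNNReal _ hs.le
  have e1 : 1 + ((1 - 2 * θ) * t / (1 - t)) * ((1 - t).toNNReal : ℝ) = 1 + (1 - 2 * θ) * t := by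
    rw [hts]; field_simp
  unfold coordKernel
  have hint : ∀ z, eexp ((1 - θ) * coordScore t (w + z) w' - θ * coordScore t (w + z) w) =
      eexp (-((1 - 2 * θ) * Real.log (1 - t) / 2) + (1 - 2 * θ) * w ^ 2 / 2 -
        (1 - θ) * (w - w') ^ 2 / (2 * (1 - t))) *
      eexp (((1 - 2 * θ) * w - (1 - θ) * (w - w') / (1 - t)) * z -
        ((1 - 2 * θ) * t / (1 - t)) * z ^ 2 / 2) := by
    intro z
    rw [← eexp_add, coordScore, coordScore]
    congr 1
    field_simp
    ring
  simp only [hint]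
  rw [lintegral_const_mul _ (by fun_prop),
    lintegral_eexp_quadratic_gaussianReal _ _ _ _ (by rw [e1]; exact hq), e1, hts, ← eexp_add]
  congr 1
  field_simp
  ring

lemma measurable_coordKernel {t : ℝ} (ht0 : 0 ≤ t) (ht1 : t < 1) {θ : ℝ} (h1 : θ ≤ 1 / 2) :
    Measurable (Function.uncurry (coordKernel t θ)) := by
  have : Function.uncurry (coordKernel t θ) = fun p : ℝ × ℝ => eexp (-((1 - 2 * θ) *
        Real.log (1 - t) / 2) - Real.log (1 + (1 - 2 * θ) * t) / 2 -
        (1 - θ) / ((1 - t) * (1 + (1 - 2 * θ) * t)) *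
          ((θ + (1 - 2 * θ) * t) * (p.1 ^ 2 + p.2 ^ 2) - 2 * (1 - θ) * p.1 * p.2) / 2) := by
    ext p
    exact coordKernel_eq ht0 ht1 h1 p.1 p.2
  rw [this]
  fun_prop

/-- The quadratic form has the eigenvalues α - γ and α + γ, each contributing one factor to the
determinant. -/
lemma lintegral_eexp_quadratic_two {t α γ : ℝ} (ht0 : 0 ≤ t) (h1 : 0 < 1 + (α - γ) * t)
    (h2 : 0 < 1 + (α + γ) * t) :
    ∫⁻ w, ∫⁻ w', eexp (-((α * (w ^ 2 + w' ^ 2) - 2 * γ * w * w') / 2)) ∂gaussianReal 0 t.toNNReal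
      ∂gaussianReal 0 t.toNNReal =
      eexp (-(Real.log ((1 + (α - γ) * t) * (1 + (α + γ) * t)) / 2)) := by
  have htt : (t.toNNReal : ℝ) = t := Real.coe_toNNReal _ ht0
  have hA : 0 < 1 + α * t := by nlinarith
  have e1 : 1 + α * (t.toNNReal : ℝ) = 1 + α * t := by rw [htt]
  have e2 : 1 + (α - γ ^ 2 * t / (1 + α * t)) * (t.toNNReal : ℝ) =
      (1 + (α - γ) * t) * (1 + (α + γ) * t) / (1 + α * t) := by
    rw [htt]; field_simp; ring
  have hin : ∀ w : ℝ, ∫⁻ w', eexp (-((α * (w ^ 2 + w' ^ 2) - 2 * γ * w * w') / 2))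
      ∂gaussianReal 0 t.toNNReal = eexp (-(Real.log (1 + α * t) / 2)) *
        eexp (0 * w - (α - γ ^ 2 * t / (1 + α * t)) * w ^ 2 / 2) := by
    intro w
    have hint : ∀ w', eexp (-((α * (w ^ 2 + w' ^ 2) - 2 * γ * w * w') / 2)) =
        eexp (-(α * w ^ 2 / 2)) * eexp ((γ * w) * w' - α * w' ^ 2 / 2) := by
      intro w'
      rw [← eexp_add]; congr 1; ring
    simp only [hint]
    rw [lintegral_const_mul _ (by fun_prop),
      lintegral_eexp_quadratic_gaussianReal _ _ _ _ (by rw [e1]; exact hA), e1, htt, ← eexp_add,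
      ← eexp_add]
    congr 1
    field_simp
    ring
  simp only [hin]
  rw [lintegral_const_mul _ (by fun_prop),
    lintegral_eexp_quadratic_gaussianReal _ _ _ _ (by rw [e2]; positivity), e2, ← eexp_add,
    Real.log_div (by positivity) hA.ne']
  congr 1
  norm_num
  ring

lemma lintegral_coordKernel_sq {t : ℝ} (ht0 : 0 ≤ t) (ht1 : t < 1) {θ : ℝ} (h0 : 0 < θ)
    (h1 : θ ≤ 1 / 2) :
    ∫⁻ w, ∫⁻ w', coordKernel t θ w w' ^ 2 ∂gaussianReal 0 t.toNNReal ∂gaussianReal 0 t.toNNReal =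
      eexp ((1 / 2 - (1 - 2 * θ)) * Real.log (1 - t) - Real.log (1 + (1 - 2 * θ) * t) -
        Real.log (1 - (1 - 2 * θ) ^ 2 * t) / 2) := by
  have hs : 0 < 1 - t := by linarith
  have hq : 0 < 1 + (1 - 2 * θ) * t := by nlinarith
  have hd : (1 - 2 * θ) ^ 2 ≤ 1 := by nlinarith
  have hq2 : 0 < 1 - (1 - 2 * θ) ^ 2 * t := by nlinarith
  set κ : ℝ := 2 * (1 - θ) / ((1 - t) * (1 + (1 - 2 * θ) * t)) with hκ
  have hint : ∀ w w', coordKernel t θ w w' ^ 2 =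
      eexp (-((1 - 2 * θ) * Real.log (1 - t)) - Real.log (1 + (1 - 2 * θ) * t)) *
      eexp (-(((κ * (θ + (1 - 2 * θ) * t)) * (w ^ 2 + w' ^ 2) - 2 * (κ * (1 - θ)) * w * w') / 2)) := by
    intro w w'
    rw [coordKernel_eq ht0 ht1 h1, eexp_pow, ← eexp_add]
    congr 1
    rw [hκ]
    push_cast
    ring
  have hκq : κ * ((1 - t) * (1 + (1 - 2 * θ) * t)) = 2 * (1 - θ) :=
    div_mul_cancel₀ _ (by positivity)
  -- The two determinant factors; 1 + (1-2θ)t cancels in their product.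
  have e1 : 1 + (κ * (θ + (1 - 2 * θ) * t) - κ * (1 - θ)) * t =
      (1 - (1 - 2 * θ) ^ 2 * t) / (1 + (1 - 2 * θ) * t) := by
    rw [eq_div_iff hq.ne']
    linear_combination (-(1 - 2 * θ) * t) * hκq
  have e2 : 1 + (κ * (θ + (1 - 2 * θ) * t) + κ * (1 - θ)) * t =
      (1 + (1 - 2 * θ) * t) / (1 - t) := by
    rw [eq_div_iff hs.ne']
    linear_combination t * hκq
  simp only [hint]
  have hm : ∀ w : ℝ, Measurable fun w' : ℝ => eexp (-(((κ * (θ + (1 - 2 * θ) * t)) *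
      (w ^ 2 + w' ^ 2) - 2 * (κ * (1 - θ)) * w * w') / 2)) := fun w => by fun_prop
  simp only [lintegral_const_mul _ (hm _)]
  rw [lintegral_const_mul'  _ _ (eexp_ne_top _), lintegral_eexp_quadratic_two ht0
    (by rw [e1]; positivity) (by rw [e2]; positivity), e1, e2, ← eexp_add]
  congr 1
  have e3 : (1 - (1 - 2 * θ) ^ 2 * t) / (1 + (1 - 2 * θ) * t) *
      ((1 + (1 - 2 * θ) * t) / (1 - t)) = (1 - (1 - 2 * θ) ^ 2 * t) / (1 - t) := by
    field_simp
  rw [e3, Real.log_div hq2.ne' hs.ne']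
  ring

/-- The `L²` bound for the kernel at `θ = 1 / 2`. -/
lemma lintegral_coordKernel_sq_half {t : ℝ} (ht0 : 0 ≤ t) (ht1 : t < 1) :
    ∫⁻ w, ∫⁻ w', coordKernel t (1 / 2) w w' ^ 2 ∂gaussianReal 0 t.toNNReal
      ∂gaussianReal 0 t.toNNReal ≤ eexp (-(4 * (1 / 2) * (1 - 1 / 2) * (-(Real.log (1 - t) / 2)))) := by
  rw [lintegral_coordKernel_sq ht0 ht1 (by norm_num) le_rfl]
  apply eexp_mono
  norm_num
  linarith

/-- The `L²` bound for the kernel at small correlation. -/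
lemma lintegral_coordKernel_sq_le {t : ℝ} (ht0 : 0 ≤ t) {θ : ℝ} (h0 : 0 < θ)
    (h1 : θ ≤ 1 / 2) {ε : ℝ} (hε0 : 0 ≤ ε) (hε1 : ε ≤ 1) (htε : t ≤ 2 * θ * (1 - θ) * ε / 5) :
    ∫⁻ w, ∫⁻ w', coordKernel t θ w w' ^ 2 ∂gaussianReal 0 t.toNNReal
      ∂gaussianReal 0 t.toNNReal ≤
      eexp (-(4 * θ * (1 - θ) * ((1 - ε) * (-(Real.log (1 - t) / 2))))) := by
  have hθ : θ * (1 - θ) ≤ 1 / 4 := by nlinarith [sq_nonneg (1 - 2 * θ)]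
  have hθ0 : 0 < θ * (1 - θ) := by nlinarith
  have ht : t ≤ 1 / 2 := by nlinarith
  have ht1 : t < 1 := by linarith
  rw [lintegral_coordKernel_sq ht0 ht1 h0 h1]
  apply eexp_mono
  -- In terms of d = 1 - 2θ the exponent is -(1-d²)t/2 to first order in t, exactly the target with
  -- ε = 0. The rest bounds the second-order terms.
  set d : ℝ := 1 - 2 * θ with hd
  have hd0 : 0 ≤ d := by rw [hd]; linarith
  have hd1 : d ≤ 1 := by rw [hd]; linarith
  have hθd : θ * (1 - θ) = (1 - d ^ 2) / 4 := by rw [hd]; ring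
  have hd2 : d ^ 2 ≤ 1 := by nlinarith
  have hs : 0 < 1 - t := by linarith
  set l : ℝ := -Real.log (1 - t) with hl
  have hlog : Real.log (1 - t) = -l := by rw [hl]; ring
  have hl1 : t ≤ l := by
    have := Real.log_le_sub_one_of_pos hs
    rw [hl]; linarith
  have hl2 : l ≤ t + 2 * t ^ 2 := by
    have h := Real.one_sub_inv_le_log_of_pos hs
    have h' : (1 - t)⁻¹ ≤ 1 + t + 2 * t ^ 2 := by
      rw [inv_le_iff_one_le_mul₀ hs]
      nlinarith [mul_nonneg ht0 ht0]
    rw [hl]; linarith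
  have hA : d * t - t ^ 2 ≤ Real.log (1 + d * t) := by
    have hp : 0 < 1 + d * t := by positivity
    have h := Real.one_sub_inv_le_log_of_pos hp
    have h' : (1 + d * t)⁻¹ ≤ 1 - d * t + t ^ 2 := by
      rw [inv_le_iff_one_le_mul₀ hp]
      have : (d * t) ^ 2 ≤ t ^ 2 := by nlinarith [mul_nonneg ht0 ht0]
      nlinarith [mul_nonneg (mul_nonneg hd0 ht0) (mul_nonneg ht0 ht0)]
    linarith
  have hB : -(d ^ 2 * t) - 2 * t ^ 2 ≤ Real.log (1 - d ^ 2 * t) := by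
    have hp : 0 < 1 - d ^ 2 * t := by nlinarith
    have h := Real.one_sub_inv_le_log_of_pos hp
    have hx0 : 0 ≤ d ^ 2 * t := by positivity
    have hx1 : d ^ 2 * t ≤ t := by nlinarith
    have h' : (1 - d ^ 2 * t)⁻¹ ≤ 1 + d ^ 2 * t + 2 * t ^ 2 := by
      rw [inv_le_iff_one_le_mul₀ hp]
      nlinarith [mul_nonneg hx0 ht0, mul_nonneg hx0 (mul_nonneg ht0 ht0),
        mul_nonneg ht0 ht0]
    linarith
  rw [hlog]
  have hgoal : (d - d ^ 2 / 2) * l ≤ (d - d ^ 2 / 2) * (t + 2 * t ^ 2) :=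
    mul_le_mul_of_nonneg_left hl2 (by nlinarith)
  -- The second-order errors add up to at most 3t², while the loss ε provides 2θ(1-θ)εl; the
  -- hypothesis `htε` makes the latter at least 5t².
  have h5 : 5 * t ^ 2 ≤ 2 * (θ * (1 - θ)) * ε * l := by
    have : 5 * t ^ 2 ≤ 2 * (θ * (1 - θ)) * ε * t := by nlinarith
    refine this.trans (mul_le_mul_of_nonneg_left hl1 (by positivity))
  have h6 : (d - d ^ 2 / 2) * t ^ 2 ≤ t ^ 2 / 2 := by
    nlinarith [mul_nonneg (sq_nonneg (1 - d)) (sq_nonneg t)]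
  rw [hθd] at h5
  have : 4 * θ * (1 - θ) = 1 - d ^ 2 := by linarith [hθd]
  rw [this]
  nlinarith

end Coordinate

/-! ### Canonical coordinates of a pair of feature vectors -/

namespace FeatureStats

open Matrix

lemma mulVec_single_dotProduct_mulVec {k m n : Type*} [Fintype k] [DecidableEq k] [Fintype m]
    [Fintype n] (A : Matrix k m ℝ) (B : Matrix m n ℝ) (C : Matrix k n ℝ) (i : k) :
    (Aᵀ.mulVec (Pi.single i 1)) ⬝ᵥ B.mulVec (Cᵀ.mulVec (Pi.single i 1)) = (A * B * Cᵀ) i i := by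
  have e1 : ∀ A : Matrix k k ℝ, A i i = (Pi.single i (1 : ℝ)) ⬝ᵥ A.mulVec (Pi.single i 1) := by
    intro A; simp
  rw [e1 (A * B * Cᵀ), ← mulVec_mulVec, ← mulVec_mulVec, dotProduct_mulVec _ A, ← mulVec_transpose]

variable {Da : Type*} {Db : Type*} [Fintype Da] [Fintype Db] [DecidableEq Da] [DecidableEq Db]

/-- The linear maps `T` and `N` bring a pair of feature vectors to canonical form: `T x` is white,
and `N y`, the regression of `T x` on `y`, has the diagonal covariance `t`. -/
structure IsCanonical (s : FeatureStats Da Db) (T : Matrix Da Da ℝ) (N : Matrix Da Db ℝ)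
    (t : Da → ℝ) : Prop where
  regression : T * s.covAB * s.covB⁻¹ = N
  covX : T * s.covA * Tᵀ = 1
  covXW : T * s.covAB * Nᵀ = diagonal t

lemma posDef_covA (s : FeatureStats Da Db) : s.covA.PosDef := by
  have := s.posDef.submatrix (e := Sum.inl) Sum.inl_injective
  simpa [Matrix.submatrix] using! this

lemma posDef_covB (s : FeatureStats Da Db) : s.covB.PosDef := by
  have := s.posDef.submatrix (e := Sum.inr) Sum.inr_injective
  simpa [Matrix.submatrix] using! this

lemma transpose_covB (s : FeatureStats Da Db) : s.covBᵀ = s.covB := by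
  simpa using s.posDef_covB.isHermitian.eq

lemma isUnit_det_covB (s : FeatureStats Da Db) : IsUnit s.covB.det :=
  (Matrix.isUnit_iff_isUnit_det _).1 s.posDef_covB.isUnit

lemma transpose_covB_inv (s : FeatureStats Da Db) : (s.covB⁻¹)ᵀ = s.covB⁻¹ := by
  rw [transpose_nonsing_inv, transpose_covB]

namespace IsCanonical

variable {s : FeatureStats Da Db} {T : Matrix Da Da ℝ} {N : Matrix Da Db ℝ} {t : Da → ℝ}

lemma covW (h : s.IsCanonical T N t) : N * s.covB * Nᵀ = diagonal t := by
  have h1 : N * s.covB = T * s.covAB := by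
    rw [← h.regression, Matrix.mul_assoc, nonsing_inv_mul _ s.isUnit_det_covB, Matrix.mul_one]
  rw [h1, h.covXW]

/-- Both sides are the variance of the i-th residual (Tx - Ny)_i. Positive definiteness of the joint
covariance then gives t i < 1. -/
lemma one_sub_eq (h : s.IsCanonical T N t) (i : Da) :
    1 - t i = Sum.elim (Tᵀ.mulVec (Pi.single i 1)) (-Nᵀ.mulVec (Pi.single i 1)) ⬝ᵥ
      (fromBlocks s.covA s.covAB s.covABᵀ s.covB).mulVec
        (Sum.elim (Tᵀ.mulVec (Pi.single i 1)) (-Nᵀ.mulVec (Pi.single i 1))) := by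
  have hXW : N * s.covABᵀ * Tᵀ = diagonal t := by
    have := congrArg Matrix.transpose h.covXW
    simpa [transpose_mul, Matrix.mul_assoc] using this
  rw [fromBlocks_mulVec, sumElim_dotProduct_sumElim]
  simp only [Sum.elim_comp_inl, Sum.elim_comp_inr, mulVec_neg, neg_dotProduct, dotProduct_add,
    dotProduct_neg, mulVec_single_dotProduct_mulVec, h.covX, h.covW, h.covXW, hXW, diagonal_apply_eq, one_apply_eq]
  ring

lemma lt_one (h : s.IsCanonical T N t) (i : Da) : t i < 1 := by
  have hne : Sum.elim (Tᵀ.mulVec (Pi.single i 1)) (-Nᵀ.mulVec (Pi.single i 1)) ≠ 0 := by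
    intro h0
    have h1 : Tᵀ.mulVec (Pi.single i (1 : ℝ)) = 0 := by
      ext j; simpa using congrFun h0 (Sum.inl j)
    have h2 : (T * s.covA * Tᵀ).mulVec (Pi.single i 1) i = 0 := by
      rw [← mulVec_mulVec, h1]; simp
    rw [h.covX] at h2
    simp at h2
  have := s.posDef.dotProduct_mulVec_pos hne
  rw [star_trivial, ← h.one_sub_eq i] at this
  linarith

lemma nonneg (h : s.IsCanonical T N t) (i : Da) : 0 ≤ t i := by
  have := (s.posDef_covB.posSemidef.mul_mul_conjTranspose_same N).diag_nonneg (i := i)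
  rw [conjTranspose_eq_transpose_of_trivial, h.covW] at this
  simpa using this

end IsCanonical

open scoped MatrixOrder in
lemma sqrt_covA (s : FeatureStats Da Db) : (CFC.sqrt s.covA)ᵀ = CFC.sqrt s.covA ∧
    CFC.sqrt s.covA * CFC.sqrt s.covA = s.covA ∧ IsUnit (CFC.sqrt s.covA).det := by
  have h0 : 0 ≤ s.covA := Matrix.nonneg_iff_posSemidef.2 s.posDef_covA.posSemidef
  refine ⟨?_, CFC.sqrt_mul_sqrt_self _ h0, ?_⟩
  · have := (Matrix.nonneg_iff_posSemidef.1 (CFC.sqrt_nonneg s.covA)).isHermitian.eq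
    simpa using this
  · rw [← Matrix.isUnit_iff_isUnit_det, CFC.isUnit_sqrt_iff _ h0]
    exact s.posDef_covA.isUnit

open scoped MatrixOrder in
lemma sqrt_covB (s : FeatureStats Da Db) : (CFC.sqrt s.covB)ᵀ = CFC.sqrt s.covB ∧
    CFC.sqrt s.covB * CFC.sqrt s.covB = s.covB := by
  have h0 : 0 ≤ s.covB := Matrix.nonneg_iff_posSemidef.2 s.posDef_covB.posSemidef
  refine ⟨?_, CFC.sqrt_mul_sqrt_self _ h0⟩
  have := (Matrix.nonneg_iff_posSemidef.1 (CFC.sqrt_nonneg s.covB)).isHermitian.eq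
  simpa using this

open scoped MatrixOrder in
lemma normalizedCov_mul_transpose (s : FeatureStats Da Db) :
    s.normalizedCov * s.normalizedCovᵀ =
      (CFC.sqrt s.covA)⁻¹ * s.covAB * s.covB⁻¹ * s.covABᵀ * (CFC.sqrt s.covA)⁻¹ := by
  obtain ⟨hA, -, -⟩ := s.sqrt_covA
  obtain ⟨hB, hBB⟩ := s.sqrt_covB
  have : s.covB⁻¹ = (CFC.sqrt s.covB)⁻¹ * (CFC.sqrt s.covB)⁻¹ := by
    rw [← Matrix.mul_inv_rev, hBB]
  rw [normalizedCov, transpose_mul, transpose_mul, transpose_nonsing_inv, transpose_nonsing_inv,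
    hA, hB, this]
  simp only [Matrix.mul_assoc]

-- Apply K Kᵀ, with K the normalized cross-covariance, to a unit eigenvector and use ‖K Kᵀ‖ = ‖K‖².
open scoped Matrix.Norms.L2Operator in
lemma eigenvalues_le_sq_maxCorrelation (s : FeatureStats Da Db)
    (h : (s.normalizedCov * s.normalizedCovᵀ).IsHermitian) (i : Da) :
    h.eigenvalues i ≤ s.maxCorrelation ^ 2 := by
  have h1 := l2_opNorm_mulVec (s.normalizedCov * s.normalizedCovᵀ) (h.eigenvectorBasis i)
  have h2 : ‖h.eigenvectorBasis i‖ = 1 := h.eigenvectorBasis.orthonormal.1 i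
  have h3 : ‖s.normalizedCov * s.normalizedCovᵀ‖ = s.maxCorrelation ^ 2 := by
    have := l2_opNorm_conjTranspose_mul_self (s.normalizedCovᴴ)
    rw [conjTranspose_conjTranspose, l2_opNorm_conjTranspose] at this
    rw [maxCorrelation, sq, ← this, conjTranspose_eq_transpose_of_trivial]
  rw [h.mulVec_eigenvectorBasis, map_smul, norm_smul, h3, h2] at h1
  have := le_abs_self (h.eigenvalues i)
  simp only [Real.norm_eq_abs, mul_one] at h1
  have h4 : ‖(EuclideanSpace.equiv Da ℝ).symm (h.eigenvectorBasis i).ofLp‖ = 1 := h2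
  rw [h4] at h1
  linarith

-- Diagonalize K Kᵀ = E diag(t) Eᵀ for K = Σ_a^(-1/2) Σ_ab Σ_b^(-1/2), and take T = Eᵀ Σ_a^(-1/2)
-- and N = T Σ_ab Σ_b⁻¹. Only the first vector is whitened; replacing the second by the regression
-- of Tx on it avoids a singular value decomposition and keeps both sets of coordinates indexed by
-- `Da`.
open scoped MatrixOrder in
lemma exists_isCanonical (s : FeatureStats Da Db) :
    ∃ T N t, s.IsCanonical T N t ∧ ∀ i, t i ≤ s.maxCorrelation ^ 2 := by
  have hH : (s.normalizedCov * s.normalizedCovᵀ).IsHermitian := by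
    rw [IsHermitian, conjTranspose_eq_transpose_of_trivial, transpose_mul, transpose_transpose]
  obtain ⟨hA, hAA, hu⟩ := s.sqrt_covA
  set Q := CFC.sqrt s.covA
  set E : Matrix Da Da ℝ := (hH.eigenvectorUnitary).1 with hE
  have hEE : Eᵀ * E = 1 := by
    have := Unitary.coe_star_mul_self hH.eigenvectorUnitary
    rwa [star_eq_conjTranspose, conjTranspose_eq_transpose_of_trivial] at this
  have hD : Eᵀ * (s.normalizedCov * s.normalizedCovᵀ) * E = diagonal hH.eigenvalues := by
    have := hH.conjStarAlgAut_star_eigenvectorUnitary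
    rw [Unitary.conjStarAlgAut_star_apply, star_eq_conjTranspose,
      conjTranspose_eq_transpose_of_trivial] at this
    simpa using! this
  have hQt : (Q⁻¹)ᵀ = Q⁻¹ := by rw [transpose_nonsing_inv, hA]
  refine ⟨Eᵀ * Q⁻¹, Eᵀ * Q⁻¹ * s.covAB * s.covB⁻¹, hH.eigenvalues, ⟨rfl, ?_, ?_⟩,
    s.eigenvalues_le_sq_maxCorrelation hH⟩
  · rw [transpose_mul, hQt, transpose_transpose, ← hAA]
    calc Eᵀ * Q⁻¹ * (Q * Q) * (Q⁻¹ * E) = Eᵀ * (Q⁻¹ * Q) * (Q * Q⁻¹) * E := by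
          simp only [Matrix.mul_assoc]
      _ = 1 := by
          rw [nonsing_inv_mul _ hu, mul_nonsing_inv _ hu, Matrix.mul_one, Matrix.mul_one, hEE]
  · rw [← hD, normalizedCov_mul_transpose]
    simp only [transpose_mul, transpose_covB_inv, hQt, transpose_transpose, Matrix.mul_assoc]
    rfl

end FeatureStats

/-! ### The information density as a sum over canonical coordinates. -/

namespace FeatureStats

open Matrix

variable {Da : Type*} {Db : Type*} [Fintype Da] [Fintype Db] [DecidableEq Da] [DecidableEq Db]

lemma log_gaussianDensity {D : Type*} [Fintype D] [DecidableEq D] (c : D → ℝ) {S : Matrix D D ℝ}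
    (hS : S.PosDef) (x : D → ℝ) :
    Real.log (gaussianDensity c S x) = -(Fintype.card D * Real.log (2 * Real.pi) / 2) -
      Real.log S.det / 2 - ((x - c) ⬝ᵥ (S⁻¹).mulVec (x - c)) / 2 := by
  have h1 : 0 < (2 * Real.pi) ^ Fintype.card D := by positivity
  have h2 := hS.det_pos
  rw [gaussianDensity, Real.log_mul (by positivity) (Real.exp_ne_zero _), Real.log_exp,
    Real.log_inv, Real.log_sqrt (by positivity), Real.log_mul h1.ne' h2.ne', Real.log_pow]
  ring

lemma gaussianDensity_pos {D : Type*} [Fintype D] [DecidableEq D] (c : D → ℝ) {S : Matrix D D ℝ}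
    (hS : S.PosDef) (x : D → ℝ) : 0 < gaussianDensity c S x := by
  have h2 := hS.det_pos
  rw [gaussianDensity]
  positivity

/-- The conditional covariance of the first feature vector given the second one. -/
noncomputable def condCov (s : FeatureStats Da Db) : Matrix Da Da ℝ :=
  s.covA - s.covAB * s.covB⁻¹ * s.covABᵀ

namespace IsCanonical

variable {s : FeatureStats Da Db} {T : Matrix Da Da ℝ} {N : Matrix Da Db ℝ} {t : Da → ℝ}

lemma transpose_mul_self (h : s.IsCanonical T N t) : Tᵀ * T = s.covA⁻¹ := by
  have h1 : (T * s.covA) * Tᵀ = 1 := h.covX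
  have h2 : Tᵀ * (T * s.covA) = 1 := mul_eq_one_comm.1 h1
  rw [← Matrix.mul_assoc] at h2
  exact (Matrix.inv_eq_left_inv h2).symm

lemma mul_condCov_mul (h : s.IsCanonical T N t) :
    T * s.condCov * Tᵀ = diagonal fun i => 1 - t i := by
  have : T * (s.covAB * s.covB⁻¹ * s.covABᵀ) * Tᵀ = diagonal t := by
    rw [← h.covXW, ← h.regression]
    simp only [transpose_mul, transpose_covB_inv, Matrix.mul_assoc]
  rw [condCov, Matrix.mul_sub, Matrix.sub_mul, this, h.covX, ← diagonal_one, diagonal_sub]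

lemma condCov_inv (h : s.IsCanonical T N t) :
    s.condCov * (Tᵀ * (diagonal (fun i => (1 - t i)⁻¹) * T)) = 1 := by
  have h1 : (T * s.condCov) * (Tᵀ * diagonal (fun i => (1 - t i)⁻¹)) = 1 := by
    rw [← Matrix.mul_assoc, h.mul_condCov_mul, diagonal_mul_diagonal, ← diagonal_one]
    congr 1
    ext i
    exact mul_inv_cancel₀ (sub_pos.2 (h.lt_one i)).ne'
  have h2 := mul_eq_one_comm.1 h1
  rw [← Matrix.mul_assoc] at h2
  have h3 := mul_eq_one_comm.1 h2
  rw [← h3]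
  simp only [Matrix.mul_assoc]

/-- The quadratic form of the joint law splits into a conditional and a marginal part. -/
lemma joint_quadratic (h : s.IsCanonical T N t) (x : Da → ℝ) (y : Db → ℝ) :
    Sum.elim x y ⬝ᵥ ((fromBlocks s.covA s.covAB s.covABᵀ s.covB)⁻¹).mulVec (Sum.elim x y) =
      ∑ i, (T.mulVec x i - N.mulVec y i) ^ 2 / (1 - t i) + y ⬝ᵥ (s.covB⁻¹).mulVec y := by
  set K := s.covAB * s.covB⁻¹ with hK
  set H := Tᵀ * (diagonal (fun i => (1 - t i)⁻¹) * T) with hH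
  set d := x - K.mulVec y with hd
  set p := H.mulVec d with hp
  set q := (s.covB⁻¹).mulVec y - Kᵀ.mulVec p with hq
  have hKt : s.covB * Kᵀ = s.covABᵀ := by
    rw [hK, transpose_mul, transpose_covB_inv, ← Matrix.mul_assoc,
      mul_nonsing_inv _ s.isUnit_det_covB, Matrix.one_mul]
  have hSp : s.condCov.mulVec p = d := by
    rw [hp, mulVec_mulVec, h.condCov_inv, one_mulVec]
  -- Instead of inverting the block matrix, the linear system is solved: p is the inverse
  -- conditional covariance applied to the residual x - Ky, and q follows by back substitution.
  have hsol : (fromBlocks s.covA s.covAB s.covABᵀ s.covB).mulVec (Sum.elim p q) = Sum.elim x y := by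
    rw [fromBlocks_mulVec]
    simp only [Sum.elim_comp_inl, Sum.elim_comp_inr]
    congr 1
    · have : s.covAB.mulVec q = K.mulVec y - (s.covAB * s.covB⁻¹ * s.covABᵀ).mulVec p := by
        rw [hq, mulVec_sub, mulVec_mulVec, mulVec_mulVec, hK]
        simp only [transpose_mul, transpose_covB_inv, Matrix.mul_assoc]
      rw [this]
      have : s.covA.mulVec p - (s.covAB * s.covB⁻¹ * s.covABᵀ).mulVec p = d := by
        rw [← sub_mulVec, ← hSp, condCov]
      rw [hd] at this
      linear_combination this
    · rw [hq, mulVec_sub, mulVec_mulVec y, mulVec_mulVec p, hKt, mul_nonsing_inv _ s.isUnit_det_covB,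
        one_mulVec]
      abel
  have hinv : ((fromBlocks s.covA s.covAB s.covABᵀ s.covB)⁻¹).mulVec (Sum.elim x y) =
      Sum.elim p q := by
    rw [← hsol, mulVec_mulVec, nonsing_inv_mul _
      ((Matrix.isUnit_iff_isUnit_det _).1 s.posDef.isUnit), one_mulVec]
  rw [hinv, sumElim_dotProduct_sumElim, hq, dotProduct_sub]
  have h1 : y ⬝ᵥ Kᵀ.mulVec p = K.mulVec y ⬝ᵥ p := by
    rw [dotProduct_mulVec, vecMul_transpose]
  have hTd : T.mulVec d = T.mulVec x - N.mulVec y := by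
    rw [hd, mulVec_sub, mulVec_mulVec, hK, ← Matrix.mul_assoc, h.regression]
  have h2 : d ⬝ᵥ p = ∑ i, (T.mulVec x i - N.mulVec y i) ^ 2 / (1 - t i) := by
    rw [hp, hH, ← mulVec_mulVec, ← mulVec_mulVec, dotProduct_mulVec, vecMul_transpose, hTd]
    simp only [dotProduct, mulVec_diagonal, Pi.sub_apply]
    refine Finset.sum_congr rfl fun i _ => ?_
    rw [div_eq_mul_inv]
    ring
  rw [h1, ← h2, hd, sub_dotProduct]
  ring

/-- By the Schur complement the joint determinant is det Σ_b times that of the conditional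
covariance, and `T` whitens Σ_a while turning the conditional covariance into diag(1 - t). -/
lemma log_det (h : s.IsCanonical T N t) :
    Real.log (fromBlocks s.covA s.covAB s.covABᵀ s.covB).det =
      Real.log s.covA.det + Real.log s.covB.det + ∑ i, Real.log (1 - t i) := by
  have hT : T.det ≠ 0 := by
    intro h0
    have := congrArg det h.covX
    simp [h0] at this
  have hA := s.posDef_covA.det_pos
  have hB := s.posDef_covB.det_pos
  have e1 : T.det ^ 2 * s.covA.det = 1 := by
    have := congrArg det h.covX
    rw [det_mul, det_mul, det_transpose, det_one] at this
    linarith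
  have e2 : T.det ^ 2 * s.condCov.det = ∏ i, (1 - t i) := by
    have := congrArg det h.mul_condCov_mul
    rw [det_mul, det_mul, det_transpose, det_diagonal] at this
    linarith
  have e3 : (fromBlocks s.covA s.covAB s.covABᵀ s.covB).det = s.covB.det * s.condCov.det := by
    have := s.covB.invertibleOfIsUnitDet s.isUnit_det_covB
    rw [det_fromBlocks₂₂, invOf_eq_nonsing_inv, condCov]
  have hpos : ∀ i, 1 - t i ≠ 0 := fun i => (sub_pos.2 (h.lt_one i)).ne'
  have e4 : s.condCov.det = s.covA.det * ∏ i, (1 - t i) := by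
    have : T.det ^ 2 * s.condCov.det = T.det ^ 2 * (s.covA.det * ∏ i, (1 - t i)) := by
      rw [e2, ← mul_assoc, e1, one_mul]
    exact mul_left_cancel₀ (pow_ne_zero 2 hT) this
  rw [e3, e4, ← Real.log_prod fun i _ => hpos i, ← Real.log_mul hA.ne' hB.ne',
    ← Real.log_mul (by positivity) (Finset.prod_ne_zero_iff.2 fun i _ => hpos i)]
  congr 1
  ring

/-- The information density in canonical coordinates. -/
lemma infoDensity_eq (h : s.IsCanonical T N t) (x : Da → ℝ) (y : Db → ℝ) :
    s.infoDensity x y =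
      ∑ i, coordScore (t i) (T.mulVec (x - s.meanA) i) (N.mulVec (y - s.meanB) i) := by
  have hpA := gaussianDensity_pos s.meanA s.posDef_covA x
  have hpB := gaussianDensity_pos s.meanB s.posDef_covB y
  have hpJ := gaussianDensity_pos (Sum.elim s.meanA s.meanB) s.posDef (Sum.elim x y)
  have hsub : Sum.elim x y - Sum.elim s.meanA s.meanB = Sum.elim (x - s.meanA) (y - s.meanB) := by
    ext i; cases i <;> rfl
  have hqA : (x - s.meanA) ⬝ᵥ (s.covA⁻¹).mulVec (x - s.meanA) =
      ∑ i, (T.mulVec (x - s.meanA) i) ^ 2 := by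
    rw [← h.transpose_mul_self, ← mulVec_mulVec, dotProduct_mulVec, vecMul_transpose]
    simp only [dotProduct, sq]
  rw [infoDensity, jointDensity, Real.log_div hpJ.ne' (by positivity), Real.log_mul hpA.ne' hpB.ne',
    log_gaussianDensity _ s.posDef, log_gaussianDensity _ s.posDef_covA,
    log_gaussianDensity _ s.posDef_covB, h.log_det, hsub, h.joint_quadratic, hqA,
    Fintype.card_sum]
  simp only [coordScore, Finset.sum_add_distrib, Finset.sum_sub_distrib, Finset.sum_neg_distrib,
    ← Finset.sum_div]
  have : ∑ i, (T.mulVec (x - s.meanA) i - N.mulVec (y - s.meanB) i) ^ 2 / (2 * (1 - t i)) =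
      (∑ i, (T.mulVec (x - s.meanA) i - N.mulVec (y - s.meanB) i) ^ 2 / (1 - t i)) / 2 := by
    rw [Finset.sum_div]
    refine Finset.sum_congr rfl fun i _ => ?_
    rw [div_div, mul_comm]
  rw [this]
  push_cast
  ring

end IsCanonical

end FeatureStats

/-! ### Mutual information in canonical coordinates -/

section Density

open Matrix

variable {D : Type*} [Fintype D] [DecidableEq D]

lemma pi_gaussianReal_eq_withDensity :
    Measure.pi (fun _ : D => gaussianReal 0 1) =
      (volume : Measure (D → ℝ)).withDensity fun y => ∏ i, gaussianPDF 0 1 (y i) := by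
  symm
  refine (Measure.pi_eq fun s hs => ?_).symm
  set g : D → ℝ → ℝ := fun i => (s i).indicator (gaussianPDFReal 0 1) with hg
  have hg0 : ∀ i x, 0 ≤ g i x := fun i =>
    Set.indicator_nonneg fun x _ => gaussianPDFReal_nonneg 0 1 x
  have hgi : ∀ i, Integrable (g i) := fun i => (integrable_gaussianPDFReal 0 1).indicator (hs i)
  have hind : ∀ y : D → ℝ, (Set.univ.pi s).indicator (fun y => ∏ i, gaussianPDF 0 1 (y i)) y =
      ENNReal.ofReal (∏ i, g i (y i)) := by
    intro y
    rw [ENNReal.ofReal_prod_of_nonneg fun i _ => hg0 i _]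
    by_cases hy : y ∈ Set.univ.pi s
    · rw [Set.indicator_of_mem hy]
      refine Finset.prod_congr rfl fun i _ => ?_
      simp only [hg, Set.indicator_of_mem (hy i trivial), gaussianPDF]
    · rw [Set.indicator_of_notMem hy]
      obtain ⟨i, hi⟩ : ∃ i, y i ∉ s i := by simpa [Set.mem_univ_pi] using hy
      refine (Finset.prod_eq_zero (Finset.mem_univ i) ?_).symm
      simp only [hg, Set.indicator_of_notMem hi, ENNReal.ofReal_zero]
  rw [withDensity_apply _ (MeasurableSet.univ_pi hs),
    ← lintegral_indicator (MeasurableSet.univ_pi hs), lintegral_congr hind,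
    volume_pi, ← ofReal_integral_eq_lintegral_ofReal (Integrable.fintype_prod (f := g) hgi)
      (Filter.Eventually.of_forall fun y => Finset.prod_nonneg fun i _ => hg0 i _),
    integral_fintype_prod_eq_prod, ENNReal.ofReal_prod_of_nonneg fun i _ =>
      integral_nonneg (hg0 i)]
  refine Finset.prod_congr rfl fun i _ => ?_
  rw [gaussianReal_apply_eq_integral _ one_ne_zero, integral_indicator (hs i)]

lemma prod_gaussianPDFReal_eq {S Q : Matrix D D ℝ} (hQ : Q * Qᵀ = S) (hS : S.PosDef)
    (c y : D → ℝ) :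
    ∏ i, gaussianPDFReal 0 1 (y i) = |Q.det| * gaussianDensity c S (Q.mulVec y + c) := by
  have hdet : S.det = Q.det ^ 2 := by rw [← hQ, det_mul, det_transpose, sq]
  have hQ0 : Q.det ≠ 0 := by
    intro h0
    have := hS.det_pos
    rw [hdet, h0] at this
    simp at this
  have hQu : IsUnit Q.det := isUnit_iff_ne_zero.2 hQ0
  have hquad : Q.mulVec y ⬝ᵥ (S⁻¹).mulVec (Q.mulVec y) = ∑ i, y i ^ 2 := by
    rw [← hQ, Matrix.mul_inv_rev, ← mulVec_mulVec, mulVec_mulVec _ Q⁻¹, nonsing_inv_mul _ hQu,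
      one_mulVec, dotProduct_mulVec, vecMul_mulVec,
      mul_nonsing_inv _ (by rwa [det_transpose])]
    simp [dotProduct, sq]
  have hpi : Real.sqrt ((2 * Real.pi) ^ Fintype.card D) =
      Real.sqrt (2 * Real.pi) ^ Fintype.card D := by
    rw [Real.sqrt_eq_iff_mul_self_eq (by positivity) (by positivity), ← mul_pow,
      Real.mul_self_sqrt (by positivity)]
  have hsq : Real.sqrt ((2 * Real.pi) ^ Fintype.card D * S.det) =
      Real.sqrt (2 * Real.pi) ^ Fintype.card D * |Q.det| := by
    rw [hdet, Real.sqrt_mul (by positivity), Real.sqrt_sq_eq_abs, hpi]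
  rw [gaussianDensity, add_sub_cancel_right, hquad, hsq]
  simp only [gaussianPDFReal, Finset.prod_mul_distrib, Finset.prod_const, Finset.card_univ,
    ← Real.exp_sum, NNReal.coe_one, mul_one, sub_zero]
  have hQa : |Q.det| ≠ 0 := abs_ne_zero.2 hQ0
  rw [mul_inv, mul_comm (Real.sqrt (2 * Real.pi) ^ Fintype.card D)⁻¹, ← mul_assoc, ← mul_assoc,
    mul_inv_cancel₀ hQa, one_mul, inv_pow, ← Finset.sum_div, Finset.sum_neg_distrib]

lemma measurable_gaussianDensity (c : D → ℝ) (S : Matrix D D ℝ) :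
    Measurable (gaussianDensity c S) := by
  have : Continuous (gaussianDensity c S) := by
    unfold gaussianDensity
    fun_prop
  exact this.measurable

/-- The explicit density belongs to the affine image Qy + c of a standard Gaussian y. So Lebesgue
integrals against `gaussianDensity`, such as the one defining `mutualInfo`, become standard Gaussian
moments. -/
lemma map_pi_gaussianReal_eq_withDensity {S Q : Matrix D D ℝ} (hQ : Q * Qᵀ = S) (hS : S.PosDef)
    (c : D → ℝ) :
    (Measure.pi fun _ : D => gaussianReal 0 1).map (fun y => Q.mulVec y + c) =
      (volume : Measure (D → ℝ)).withDensity fun x => ENNReal.ofReal (gaussianDensity c S x) := by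
  have hdet : S.det = Q.det ^ 2 := by rw [← hQ, det_mul, det_transpose, sq]
  have hQ0 : Q.det ≠ 0 := by
    intro h0
    have := hS.det_pos
    rw [hdet, h0] at this
    simp at this
  have hm : Measurable fun y : D → ℝ => Q.mulVec y + c := by
    have : Continuous fun y : D → ℝ => Q.mulVec y + c := by fun_prop
    exact this.measurable
  have hvol : (volume : Measure (D → ℝ)).map (fun y => Q.mulVec y + c) =
      ENNReal.ofReal |Q.det⁻¹| • volume := by
    have h1 := Real.map_matrix_volume_pi_eq_smul_volume_pi (M := Q) hQ0
    have h2 : (fun y : D → ℝ => Q.mulVec y + c) = (fun y => y + c) ∘ (Matrix.toLin' Q) := by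
      ext y; simp
    have hlin : Measurable (Matrix.toLin' Q) := by
      have : Continuous (Matrix.toLin' Q) := (Matrix.toLin' Q).continuous_of_finiteDimensional
      exact this.measurable
    rw [h2, ← Measure.map_map (by fun_prop) hlin, h1, Measure.map_smul,
      (measurePreserving_add_right volume c).map_eq]
  have hdm := measurable_gaussianDensity c S
  ext s hs
  rw [Measure.map_apply hm hs, pi_gaussianReal_eq_withDensity, withDensity_apply _ (hm hs),
    withDensity_apply _ hs]
  have hpdf : ∀ y : D → ℝ, ∏ i, gaussianPDF 0 1 (y i) =
      ENNReal.ofReal |Q.det| * ENNReal.ofReal (gaussianDensity c S (Q.mulVec y + c)) := by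
    intro y
    simp only [gaussianPDF]
    rw [← ENNReal.ofReal_prod_of_nonneg fun i _ => gaussianPDFReal_nonneg 0 1 (y i),
      prod_gaussianPDFReal_eq hQ hS c y, ENNReal.ofReal_mul (abs_nonneg _)]
  simp only [hpdf]
  rw [lintegral_const_mul _ (by fun_prop), ← setLIntegral_map (f := fun x => ENNReal.ofReal (gaussianDensity c S x)) hs (by fun_prop) hm,
    hvol,
    Measure.restrict_smul, lintegral_smul_measure, smul_eq_mul, ← mul_assoc,
    ← ENNReal.ofReal_mul (abs_nonneg _), ← abs_mul, mul_inv_cancel₀ hQ0]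
  simp

lemma integral_sq_dotProduct_pi_gaussianReal (b : D → ℝ) :
    Integrable (fun y : D → ℝ => (b ⬝ᵥ y) ^ 2) (Measure.pi fun _ : D => gaussianReal 0 1) ∧
      ∫ y, (b ⬝ᵥ y) ^ 2 ∂(Measure.pi fun _ : D => gaussianReal 0 1) = b ⬝ᵥ b := by
  have hlaw := hasLaw_sum_gaussianReal (P := Measure.pi fun _ : D => gaussianReal 0 1)
    (X := fun i (y : D → ℝ) => y i) (m := fun _ => 0) (v := fun _ => 1)
    (fun i => ⟨(measurable_pi_apply i).aemeasurable, (measurePreserving_eval _ i).map_eq⟩)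
    (iIndepFun_pi (X := fun _ x => x) fun i => aemeasurable_id) b Finset.univ
  set v : NNReal := ∑ i, (.mk (b i ^ 2) (sq_nonneg _)) * (1 : NNReal) with hv
  have hvb : (v : ℝ) = b ⬝ᵥ b := by
    rw [hv]; push_cast; simp [dotProduct, sq]
  have hg : HasLaw (fun y : D → ℝ => b ⬝ᵥ y) (gaussianReal 0 v)
      (Measure.pi fun _ : D => gaussianReal 0 1) := by
    simpa [dotProduct] using! hlaw
  have h2 : MemLp id 2 (gaussianReal 0 v) := memLp_id_gaussianReal 2
  have hint : Integrable (fun x : ℝ => x ^ 2) (gaussianReal 0 v) := h2.integrable_sq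
  have hvar : ∫ x, x ^ 2 ∂gaussianReal 0 v = v := by
    have h3 := variance_id_gaussianReal (μ := 0) (v := v)
    rw [variance_eq_integral aemeasurable_id] at h3
    simpa using h3
  constructor
  · rw [← hg.map_eq, integrable_map_measure (by fun_prop) hg.aemeasurable] at hint
    exact hint
  · rw [← hvb, ← hvar]
    exact hg.integral_comp (f := fun x : ℝ => x ^ 2) (by fun_prop)

-- With Q the symmetric square root of S, a · (x - c) becomes Qa · y for a standard Gaussian y,
-- whose second moment is |Qa|² = a · Sa.
open scoped MatrixOrder in
lemma integral_gaussianDensity_mul_sq {S : Matrix D D ℝ} (hS : S.PosDef) (c a : D → ℝ) :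
    Integrable (fun x => gaussianDensity c S x * (a ⬝ᵥ (x - c)) ^ 2) ∧
      ∫ x, gaussianDensity c S x * (a ⬝ᵥ (x - c)) ^ 2 = a ⬝ᵥ S.mulVec a := by
  have h0 : 0 ≤ S := Matrix.nonneg_iff_posSemidef.2 hS.posSemidef
  set Q := CFC.sqrt S with hQdef
  have hQt : Qᵀ = Q := by
    have := (Matrix.nonneg_iff_posSemidef.1 (CFC.sqrt_nonneg S)).isHermitian.eq
    simpa using this
  have hQ : Q * Qᵀ = S := by rw [hQt]; exact CFC.sqrt_mul_sqrt_self _ h0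
  obtain ⟨hi, he⟩ := integral_sq_dotProduct_pi_gaussianReal (Q.mulVec a)
  have hm : Measurable fun y : D → ℝ => Q.mulVec y + c := by
    have : Continuous fun y : D → ℝ => Q.mulVec y + c := by fun_prop
    exact this.measurable
  have hmap := map_pi_gaussianReal_eq_withDensity hQ hS c
  have hf : Measurable fun x : D → ℝ => (a ⬝ᵥ (x - c)) ^ 2 := by
    have : Continuous fun x : D → ℝ => (a ⬝ᵥ (x - c)) ^ 2 := by fun_prop
    exact this.measurable
  have hcomp : ∀ y : D → ℝ, (a ⬝ᵥ (Q.mulVec y + c - c)) ^ 2 = (Q.mulVec a ⬝ᵥ y) ^ 2 := by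
    intro y
    rw [add_sub_cancel_right, dotProduct_mulVec, ← mulVec_transpose, hQt]
  have hqq : Q.mulVec a ⬝ᵥ Q.mulVec a = a ⬝ᵥ S.mulVec a := by
    rw [← hQ, hQt, ← mulVec_mulVec, dotProduct_mulVec a, ← mulVec_transpose, hQt]
  have hpos : ∀ x, 0 ≤ gaussianDensity c S x := fun x =>
    (FeatureStats.gaussianDensity_pos c hS x).le
  have hfin : ∀ᵐ x ∂(volume : Measure (D → ℝ)), ENNReal.ofReal (gaussianDensity c S x) < ∞ :=
    Filter.Eventually.of_forall fun x => ENNReal.ofReal_lt_top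
  have hdm : Measurable fun x => ENNReal.ofReal (gaussianDensity c S x) :=
    (measurable_gaussianDensity c S).ennreal_ofReal
  have hI : Integrable (fun x : D → ℝ => (a ⬝ᵥ (x - c)) ^ 2)
      ((Measure.pi fun _ : D => gaussianReal 0 1).map (fun y => Q.mulVec y + c)) := by
    rw [integrable_map_measure hf.aestronglyMeasurable hm.aemeasurable]
    simpa only [Function.comp_def, hcomp] using hi
  have hE : ∫ x, (a ⬝ᵥ (x - c)) ^ 2
      ∂((Measure.pi fun _ : D => gaussianReal 0 1).map (fun y => Q.mulVec y + c)) =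
      a ⬝ᵥ S.mulVec a := by
    rw [integral_map hm.aemeasurable hf.aestronglyMeasurable]
    simp only [hcomp]
    rw [he, hqq]
  rw [hmap] at hI hE
  rw [integrable_withDensity_iff_integrable_smul' hdm hfin] at hI
  rw [integral_withDensity_eq_integral_toReal_smul hdm hfin] at hE
  simp only [ENNReal.toReal_ofReal (hpos _), smul_eq_mul] at hI hE
  exact ⟨hI, hE⟩

open scoped MatrixOrder in
lemma integral_gaussianDensity {S : Matrix D D ℝ} (hS : S.PosDef) (c : D → ℝ) :
    Integrable (gaussianDensity c S) ∧ ∫ x, gaussianDensity c S x = 1 := by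
  have h0 : 0 ≤ S := Matrix.nonneg_iff_posSemidef.2 hS.posSemidef
  set Q := CFC.sqrt S with hQdef
  have hQt : Qᵀ = Q := by
    have := (Matrix.nonneg_iff_posSemidef.1 (CFC.sqrt_nonneg S)).isHermitian.eq
    simpa using this
  have hQ : Q * Qᵀ = S := by rw [hQt]; exact CFC.sqrt_mul_sqrt_self _ h0
  have hm : Measurable fun y : D → ℝ => Q.mulVec y + c := by
    have : Continuous fun y : D → ℝ => Q.mulVec y + c := by fun_prop
    exact this.measurable
  have hmap := congrArg (fun ν => ν Set.univ) (map_pi_gaussianReal_eq_withDensity hQ hS c)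
  simp only [Measure.map_apply hm MeasurableSet.univ, Set.preimage_univ, measure_univ,
    withDensity_apply _ MeasurableSet.univ, Measure.restrict_univ] at hmap
  have hpos : ∀ x, 0 ≤ gaussianDensity c S x := fun x =>
    (FeatureStats.gaussianDensity_pos c hS x).le
  have hme := (measurable_gaussianDensity c S).aestronglyMeasurable (μ := volume)
  constructor
  · refine ⟨hme, ?_⟩
    rw [hasFiniteIntegral_iff_ofReal (Filter.Eventually.of_forall hpos), ← hmap]
    exact ENNReal.one_lt_top
  · rw [integral_eq_lintegral_of_nonneg_ae (Filter.Eventually.of_forall hpos) hme, ← hmap]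
    simp

end Density

namespace FeatureStats

open Matrix

variable {Da : Type*} {Db : Type*} [Fintype Da] [Fintype Db] [DecidableEq Da] [DecidableEq Db]
  {s : FeatureStats Da Db} {T : Matrix Da Da ℝ} {N : Matrix Da Db ℝ} {t : Da → ℝ}

/-- Under the joint law (Tx)_i has variance 1 and its residual variance 1 - t i, so the two
quadratic terms of `coordScore` average to 1/2 - 1/2 and only the logarithm survives. -/
lemma IsCanonical.mutualInfo_eq (h : s.IsCanonical T N t) :
    s.mutualInfo = ∑ i, -(Real.log (1 - t i) / 2) := by
  set c : Da ⊕ Db → ℝ := Sum.elim s.meanA s.meanB with hc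
  set f : (Da ⊕ Db → ℝ) → ℝ := gaussianDensity c
    (fromBlocks s.covA s.covAB s.covABᵀ s.covB) with hf
  set a : Da → Da ⊕ Db → ℝ := fun i => Sum.elim (Tᵀ.mulVec (Pi.single i 1)) 0 with ha
  set b : Da → Da ⊕ Db → ℝ :=
    fun i => Sum.elim (Tᵀ.mulVec (Pi.single i 1)) (-Nᵀ.mulVec (Pi.single i 1)) with hb
  have hrow : ∀ (n : Type _) [Fintype n] (A : Matrix Da n ℝ) (i : Da) (x : n → ℝ),
      Aᵀ.mulVec (Pi.single i 1) ⬝ᵥ x = A.mulVec x i := by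
    intro n _ A i x
    rw [mulVec_transpose, ← dotProduct_mulVec]; simp
  -- A second copy for `Db`, which may lie in another universe than `Da`.
  have hrow' : ∀ (n : Type _) [Fintype n] (A : Matrix Da n ℝ) (i : Da) (x : n → ℝ),
      Aᵀ.mulVec (Pi.single i 1) ⬝ᵥ x = A.mulVec x i := by
    intro n _ A i x
    rw [mulVec_transpose, ← dotProduct_mulVec]; simp
  have hax : ∀ i (x : Da → ℝ) (y : Db → ℝ),
      a i ⬝ᵥ (Sum.elim x y - c) = T.mulVec (x - s.meanA) i := by
    intro i x y
    have : Sum.elim x y - c = Sum.elim (x - s.meanA) (y - s.meanB) := by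
      ext i; cases i <;> rfl
    rw [this, ha, sumElim_dotProduct_sumElim, hrow, zero_dotProduct, add_zero]
  have hbx : ∀ i (x : Da → ℝ) (y : Db → ℝ), b i ⬝ᵥ (Sum.elim x y - c) =
      T.mulVec (x - s.meanA) i - N.mulVec (y - s.meanB) i := by
    intro i x y
    have : Sum.elim x y - c = Sum.elim (x - s.meanA) (y - s.meanB) := by
      ext i; cases i <;> rfl
    rw [this, hb, sumElim_dotProduct_sumElim, hrow, neg_dotProduct, hrow']
    ring
  have hpair : s.mutualInfo = ∫ z : Da ⊕ Db → ℝ, f z * ∑ i, (-(Real.log (1 - t i) / 2) +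
      (a i ⬝ᵥ (z - c)) ^ 2 / 2 - (b i ⬝ᵥ (z - c)) ^ 2 / (2 * (1 - t i))) := by
    rw [mutualInfo, ← (volume_measurePreserving_sumPiEquivProdPi
      (fun _ : Da ⊕ Db => ℝ)).integral_comp (MeasurableEquiv.measurableEmbedding _)]
    congr 1
    ext z
    obtain ⟨x, y, rfl⟩ : ∃ x y, z = Sum.elim x y :=
      ⟨z ∘ Sum.inl, z ∘ Sum.inr, (Sum.elim_comp_inl_inr z).symm⟩
    have e : (MeasurableEquiv.sumPiEquivProdPi fun _ : Da ⊕ Db => ℝ) (Sum.elim x y) = (x, y) := rfl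
    rw [e]
    simp only [h.infoDensity_eq, hax, hbx, coordScore]
    rfl
  have hA : ∀ i, Integrable (fun z => f z * (a i ⬝ᵥ (z - c)) ^ 2) ∧
      ∫ z, f z * (a i ⬝ᵥ (z - c)) ^ 2 = 1 := by
    intro i
    have := integral_gaussianDensity_mul_sq s.posDef c (a i)
    refine ⟨this.1, this.2.trans ?_⟩
    rw [ha, fromBlocks_mulVec, sumElim_dotProduct_sumElim]
    simp only [Sum.elim_comp_inl, Sum.elim_comp_inr, mulVec_zero, add_zero, zero_dotProduct,
      mulVec_single_dotProduct_mulVec, h.covX, one_apply_eq]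
  have hB : ∀ i, Integrable (fun z => f z * (b i ⬝ᵥ (z - c)) ^ 2) ∧
      ∫ z, f z * (b i ⬝ᵥ (z - c)) ^ 2 = 1 - t i := by
    intro i
    have := integral_gaussianDensity_mul_sq s.posDef c (b i)
    exact ⟨this.1, this.2.trans (h.one_sub_eq i).symm⟩
  obtain ⟨hd1, hd2⟩ := integral_gaussianDensity s.posDef c
  rw [← hf] at hd1 hd2
  rw [hpair]
  have hexp : ∀ z, f z * ∑ i, (-(Real.log (1 - t i) / 2) +
      (a i ⬝ᵥ (z - c)) ^ 2 / 2 - (b i ⬝ᵥ (z - c)) ^ 2 / (2 * (1 - t i))) =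
      ∑ i, (-(Real.log (1 - t i) / 2) * f z + 1 / 2 * (f z * (a i ⬝ᵥ (z - c)) ^ 2) -
        1 / (2 * (1 - t i)) * (f z * (b i ⬝ᵥ (z - c)) ^ 2)) := by
    intro z
    rw [Finset.mul_sum]
    refine Finset.sum_congr rfl fun i _ => ?_
    ring
  simp only [hexp]
  rw [integral_finsetSum]
  · refine Finset.sum_congr rfl fun i _ => ?_
    rw [integral_sub ((hd1.const_mul _).fun_add ((hA i).1.const_mul _)) ((hB i).1.const_mul _),
      integral_add (hd1.const_mul _) ((hA i).1.const_mul _), integral_const_mul,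
      integral_const_mul, integral_const_mul, hd2, (hA i).2, (hB i).2]
    have := (sub_pos.2 (h.lt_one i)).ne'
    field_simp
    ring
  · intro i _
    exact ((hd1.const_mul _).add ((hA i).1.const_mul _)).sub ((hB i).1.const_mul _)

end FeatureStats

/-! ### The joint law of the canonical coordinates -/

section GaussianFamilies

open scoped NNReal

variable {Ω : Type*} [MeasurableSpace Ω] {P : Measure Ω}

lemma hasGaussianLaw_sub_const {E : Type*} [NormedAddCommGroup E] [NormedSpace ℝ E]
    [MeasurableSpace E] [BorelSpace E] [SecondCountableTopology E] [CompleteSpace E]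
    {X : Ω → E} (hX : HasGaussianLaw X P) (c : E) : HasGaussianLaw (fun ω => X ω - c) P := by
  have := hX.isGaussian_map
  refine ⟨?_⟩
  have h : P.map (fun ω => X ω - c) = (P.map X).map (fun x => x + -c) := by
    rw [AEMeasurable.map_map_of_aemeasurable (by fun_prop) hX.aemeasurable]
    simp only [Function.comp_def, sub_eq_add_neg]
  rw [h]
  infer_instance

/-- Uncorrelated centered linear images of a Gaussian vector are independent Gaussians. -/
lemma iIndepFun_linear_of_covariance {E κ : Type*} [Finite κ] [NormedAddCommGroup E]
    [NormedSpace ℝ E] [FiniteDimensional ℝ E] [MeasurableSpace E] [BorelSpace E]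
    {D : Ω → E} (hD : HasGaussianLaw D P) (L : κ → E →ₗ[ℝ] ℝ) (v : κ → ℝ≥0)
    (hmean : ∀ k, ∫ ω, L k (D ω) ∂P = 0)
    (hvar : ∀ k, covariance (fun ω => L k (D ω)) (fun ω => L k (D ω)) P = v k)
    (hcov : ∀ k l, k ≠ l → covariance (fun ω => L k (D ω)) (fun ω => L l (D ω)) P = 0) :
    iIndepFun (fun k ω => L k (D ω)) P ∧
      ∀ k, HasLaw (fun ω => L k (D ω)) (gaussianReal 0 (v k)) P := by
  cases nonempty_fintype κ
  have hG : HasGaussianLaw (fun ω k => L k (D ω)) P :=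
    hD.map_fun (LinearMap.toContinuousLinearMap (LinearMap.pi L))
  refine ⟨hG.iIndepFun_of_covariance_eq_zero fun k l hkl => hcov k l hkl, fun k => ?_⟩
  have hk : HasGaussianLaw (fun ω => L k (D ω)) P := hG.eval k
  refine ⟨hk.aemeasurable, ?_⟩
  rw [hk.map_eq_gaussianReal, hmean, ← covariance_self hk.aemeasurable, hvar, Real.toNNReal_coe]

lemma hasLaw_prod_of_iIndepFun_sum {κ l : Type*} [Fintype κ] [Fintype l] {Y : κ ⊕ l → Ω → ℝ}
    {μ : κ ⊕ l → Measure ℝ} [∀ k, IsProbabilityMeasure (μ k)] (hY : ∀ k, HasLaw (Y k) (μ k) P)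
    (hind : iIndepFun Y P) :
    HasLaw (fun ω => ((fun k => Y (Sum.inl k) ω, fun k => Y (Sum.inr k) ω) : (κ → ℝ) × (l → ℝ)))
      ((Measure.pi fun k => μ (Sum.inl k)).prod (Measure.pi fun k => μ (Sum.inr k))) P := by
  have h1 := hind.hasLaw_pi hY
  have h2 := measurePreserving_sumPiEquivProdPi (X := fun _ : κ ⊕ l => ℝ) μ
  exact HasLaw.comp ⟨h2.measurable.aemeasurable, h2.map_eq⟩ h1

lemma covariance_sum_sub_const [IsProbabilityMeasure P] {J K : Type*} [Fintype J] [Fintype K]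
    {F : J → Ω → ℝ} {H : K → Ω → ℝ} (hF : ∀ j, MemLp (F j) 2 P) (hH : ∀ k, MemLp (H k) 2 P)
    (a c : J → ℝ) (b d : K → ℝ) :
    covariance (fun ω => ∑ j, a j * (F j ω - c j)) (fun ω => ∑ k, b k * (H k ω - d k)) P =
      ∑ j, ∑ k, a j * (covariance (F j) (H k) P * b k) := by
  have hF' : ∀ j, MemLp (fun ω => a j * (F j ω - c j)) 2 P := fun j =>
    ((hF j).sub (memLp_const (c j))).const_mul (a j)
  have hH' : ∀ k, MemLp (fun ω => b k * (H k ω - d k)) 2 P := fun k =>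
    ((hH k).sub (memLp_const (d k))).const_mul (b k)
  rw [covariance_fun_sum_fun_sum hF' hH']
  refine Finset.sum_congr rfl fun j _ => Finset.sum_congr rfl fun k _ => ?_
  rw [covariance_const_mul_left, covariance_const_mul_right,
    covariance_sub_const_left ((hF j).integrable one_le_two),
    covariance_sub_const_right ((hH k).integrable one_le_two), mul_comm (b k)]

end GaussianFamilies

section Canonical

open Matrix

variable {U : Type*} {V : Type*} [Fintype U] [Fintype V] [DecidableEq V] [DecidableEq U]
  {Ω : Type*} [MeasurableSpace Ω] {P : Measure Ω} {M : U ≃ V}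
  {Da : Type*} {Db : Type*} [Fintype Da] [Fintype Db] [DecidableEq Da] [DecidableEq Db]
  {s : FeatureStats Da Db} {A : U → Ω → Da → ℝ} {B : V → Ω → Db → ℝ}
  {T : Matrix Da Da ℝ} {N : Matrix Da Db ℝ} {t : Da → ℝ}

/-- The canonical coordinates of the first feature vectors. -/
noncomputable def canonX (s : FeatureStats Da Db) (A : U → Ω → Da → ℝ) (T : Matrix Da Da ℝ)
    (u : U) (i : Da) (ω : Ω) : ℝ := T.mulVec (A u ω - s.meanA) i

/-- The canonical coordinates of the second feature vectors. -/
noncomputable def canonW (s : FeatureStats Da Db) (B : V → Ω → Db → ℝ) (N : Matrix Da Db ℝ)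
    (v : V) (i : Da) (ω : Ω) : ℝ := N.mulVec (B v ω - s.meanB) i

namespace IsCorrelatedDatabases

lemma isProbabilityMeasure (h : IsCorrelatedDatabases P M s A B) : IsProbabilityMeasure P :=
  h.gaussian.isProbabilityMeasure

lemma memLp_A (h : IsCorrelatedDatabases P M s A B) (u : U) (i : Da) :
    MemLp (fun ω => A u ω i) 2 P := by
  have h1 : HasGaussianLaw (fun ω u => A u ω) P := h.gaussian.fst
  have h2 : HasGaussianLaw (fun ω => A u ω) P := h1.eval u
  have h3 : HasGaussianLaw (fun ω => A u ω i) P :=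
    h2.map_fun (ContinuousLinearMap.proj i : (Da → ℝ) →L[ℝ] ℝ)
  exact h3.memLp_two

lemma memLp_B (h : IsCorrelatedDatabases P M s A B) (v : V) (j : Db) :
    MemLp (fun ω => B v ω j) 2 P := by
  have h1 : HasGaussianLaw (fun ω v => B v ω) P := h.gaussian.snd
  have h2 : HasGaussianLaw (fun ω => B v ω) P := h1.eval v
  have h3 : HasGaussianLaw (fun ω => B v ω j) P :=
    h2.map_fun (ContinuousLinearMap.proj j : (Db → ℝ) →L[ℝ] ℝ)
  exact h3.memLp_two

lemma memLp_canonX (h : IsCorrelatedDatabases P M s A B) (u : U) (i : Da) :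
    MemLp (canonX s A T u i) 2 P := by
  have := h.isProbabilityMeasure
  exact memLp_finsetSum _ fun j _ => ((h.memLp_A u j).sub (memLp_const (s.meanA j))).const_mul (T i j)

lemma memLp_canonW (h : IsCorrelatedDatabases P M s A B) (v : V) (i : Da) :
    MemLp (canonW s B N v i) 2 P := by
  have := h.isProbabilityMeasure
  exact memLp_finsetSum _ fun j _ => ((h.memLp_B v j).sub (memLp_const (s.meanB j))).const_mul (N i j)

lemma integral_canonX (h : IsCorrelatedDatabases P M s A B) (u : U) (i : Da) :
    ∫ ω, canonX s A T u i ω ∂P = 0 := by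
  have := h.isProbabilityMeasure
  have hi : ∀ j, Integrable (fun ω => A u ω j) P := fun j => (h.memLp_A u j).integrable one_le_two
  have e : ∀ ω, canonX s A T u i ω = ∑ j, T i j * (A u ω j - s.meanA j) := fun ω => rfl
  simp only [e]
  rw [integral_finsetSum _ fun j _ => Integrable.const_mul (f := fun ω => _ - _) ((hi j).sub (integrable_const _)) _]
  refine Finset.sum_eq_zero fun j _ => ?_
  rw [integral_const_mul, integral_sub (hi j) (integrable_const _), h.meanA]
  simp

lemma integral_canonW (h : IsCorrelatedDatabases P M s A B) (v : V) (i : Da) :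
    ∫ ω, canonW s B N v i ω ∂P = 0 := by
  have := h.isProbabilityMeasure
  have hi : ∀ j, Integrable (fun ω => B v ω j) P := fun j => (h.memLp_B v j).integrable one_le_two
  have e : ∀ ω, canonW s B N v i ω = ∑ j, N i j * (B v ω j - s.meanB j) := fun ω => rfl
  simp only [e]
  rw [integral_finsetSum _ fun j _ => Integrable.const_mul (f := fun ω => _ - _) ((hi j).sub (integrable_const _)) _]
  refine Finset.sum_eq_zero fun j _ => ?_
  rw [integral_const_mul, integral_sub (hi j) (integrable_const _), h.meanB]
  simp

lemma sum_sum_mul_mul_eq {I J K L : Type*} [Fintype J] [Fintype K]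
    (X : Matrix I J ℝ) (C : Matrix J K ℝ) (Y : Matrix L K ℝ) (i : I) (l : L) :
    ∑ j, ∑ k, X i j * (C j k * Y l k) = (X * C * Yᵀ) i l := by
  rw [Matrix.mul_assoc]
  simp [Matrix.mul_apply, Finset.mul_sum]

lemma covariance_canonX (h : IsCorrelatedDatabases P M s A B) (hc : s.IsCanonical T N t)
    (u u' : U) (i i' : Da) :
    covariance (canonX s A T u i) (canonX s A T u' i') P =
      if u = u' ∧ i = i' then 1 else 0 := by
  have := h.isProbabilityMeasure
  have key := covariance_sum_sub_const (h.memLp_A u) (h.memLp_A u') (T i) s.meanA (T i') s.meanA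
  refine Eq.trans key ?_
  by_cases hu : u = u'
  · subst hu
    simp only [h.covA, sum_sum_mul_mul_eq, hc.covX, one_apply, true_and]
  · have hz : ∀ j k, covariance (fun ω => A u ω j) (fun ω => A u' ω k) P = 0 := by
      intro j k
      have hi := (h.indepA.indepFun hu).comp (measurable_pi_apply j) (measurable_pi_apply k)
      exact IndepFun.covariance_eq_zero hi (h.memLp_A u j) (h.memLp_A u' k)
    simp [hz, hu]

lemma covariance_canonW (h : IsCorrelatedDatabases P M s A B) (hc : s.IsCanonical T N t)
    (v v' : V) (i i' : Da) :
    covariance (canonW s B N v i) (canonW s B N v' i') P =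
      if v = v' ∧ i = i' then t i else 0 := by
  have := h.isProbabilityMeasure
  have key := covariance_sum_sub_const (h.memLp_B v) (h.memLp_B v') (N i) s.meanB (N i') s.meanB
  refine Eq.trans key ?_
  by_cases hv : v = v'
  · subst hv
    simp only [h.covB, sum_sum_mul_mul_eq, hc.covW, diagonal_apply, true_and]
  · have hz : ∀ j k, covariance (fun ω => B v ω j) (fun ω => B v' ω k) P = 0 := by
      intro j k
      have hi := (h.indepB.indepFun hv).comp (measurable_pi_apply j) (measurable_pi_apply k)
      exact IndepFun.covariance_eq_zero hi (h.memLp_B v j) (h.memLp_B v' k)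
    simp [hz, hv]

lemma covariance_canonX_canonW (h : IsCorrelatedDatabases P M s A B) (hc : s.IsCanonical T N t)
    (u : U) (v : V) (i i' : Da) :
    covariance (canonX s A T u i) (canonW s B N v i') P =
      if M u = v ∧ i = i' then t i else 0 := by
  have := h.isProbabilityMeasure
  have key := covariance_sum_sub_const (h.memLp_A u) (h.memLp_B v) (T i) s.meanA (N i') s.meanB
  refine Eq.trans key ?_
  by_cases hv : M u = v
  · simp only [h.covAB, hv, if_true, sum_sum_mul_mul_eq, hc.covXW, diagonal_apply, true_and]
  · simp [h.covAB, hv]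

/-- The coordinate functional behind `canonX`. -/
noncomputable def functionalX (T : Matrix Da Da ℝ) (u : U) (i : Da) :
    (U → Da → ℝ) × (V → Db → ℝ) →ₗ[ℝ] ℝ :=
  LinearMap.proj i ∘ₗ T.mulVecLin ∘ₗ LinearMap.proj u ∘ₗ LinearMap.fst ℝ _ _

/-- The coordinate functional behind `canonW`. -/
noncomputable def functionalW (N : Matrix Da Db ℝ) (v : V) (i : Da) :
    (U → Da → ℝ) × (V → Db → ℝ) →ₗ[ℝ] ℝ :=
  LinearMap.proj i ∘ₗ N.mulVecLin ∘ₗ LinearMap.proj v ∘ₗ LinearMap.snd ℝ _ _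

lemma hasGaussianLaw_centered (h : IsCorrelatedDatabases P M s A B) :
    HasGaussianLaw (fun ω => ((fun u => A u ω - s.meanA, fun v => B v ω - s.meanB) :
      (U → Da → ℝ) × (V → Db → ℝ))) P :=
  hasGaussianLaw_sub_const h.gaussian ((fun _ => s.meanA, fun _ => s.meanB) :
      (U → Da → ℝ) × (V → Db → ℝ))

/-- Matched canonical coordinates: the second coordinates and the noise of the first ones are
independent. -/
lemma hasLaw_canonical (h : IsCorrelatedDatabases P M s A B) (hc : s.IsCanonical T N t) :
    HasLaw (fun ω => ((fun p => canonW s B N (M p.1) p.2 ω,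
        fun p => canonX s A T p.1 p.2 ω - canonW s B N (M p.1) p.2 ω) :
        (U × Da → ℝ) × (U × Da → ℝ)))
      ((Measure.pi fun p : U × Da => gaussianReal 0 (t p.2).toNNReal).prod
        (Measure.pi fun p : U × Da => gaussianReal 0 (1 - t p.2).toNNReal)) P := by
  have := h.isProbabilityMeasure
  set L : (U × Da) ⊕ (U × Da) → (U → Da → ℝ) × (V → Db → ℝ) →ₗ[ℝ] ℝ :=
    Sum.elim (fun p => functionalW N (M p.1) p.2)
      (fun p => functionalX T p.1 p.2 - functionalW N (M p.1) p.2) with hL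
  set D : Ω → (U → Da → ℝ) × (V → Db → ℝ) :=
    fun ω => (fun u => A u ω - s.meanA, fun v => B v ω - s.meanB) with hD
  have e1 : ∀ p, (fun ω => L (Sum.inl p) (D ω)) = canonW s B N (M p.1) p.2 := fun p => rfl
  have e2 : ∀ p, (fun ω => L (Sum.inr p) (D ω)) =
      canonX s A T p.1 p.2 - canonW s B N (M p.1) p.2 := fun p => rfl
  have hX := fun u i => h.memLp_canonX (T := T) u i
  have hW := fun v i => h.memLp_canonW (N := N) v i
  suffices hfam : iIndepFun (fun k ω => L k (D ω)) P ∧ ∀ k, HasLaw (fun ω => L k (D ω))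
      (gaussianReal 0 (Sum.elim (fun p => (t p.2).toNNReal) (fun p => (1 - t p.2).toNNReal) k)) P from
    hasLaw_prod_of_iIndepFun_sum hfam.2 hfam.1
  refine iIndepFun_linear_of_covariance h.hasGaussianLaw_centered L _ ?_ ?_ ?_
  · rintro (p | p)
    · exact h.integral_canonW _ _
    · have := integral_sub ((hX p.1 p.2).integrable one_le_two)
        ((hW (M p.1) p.2).integrable one_le_two)
      rw [h.integral_canonX, h.integral_canonW, sub_zero] at this
      exact this
  · rintro (p | p)
    · rw [e1, h.covariance_canonW hc]
      simp [hc.nonneg]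
    · rw [e2, covariance_sub_sub (hX _ _) (hW _ _) (hX _ _) (hW _ _), h.covariance_canonX hc,
        h.covariance_canonW hc, covariance_comm (canonW _ _ _ _ _), h.covariance_canonX_canonW hc]
      simp [(hc.lt_one _).le]
  · rintro (p | p) (q | q) hpq
    · have : ¬ (p.1 = q.1 ∧ p.2 = q.2) := fun h' => hpq (by rw [Prod.ext h'.1 h'.2])
      rw [e1, e1, h.covariance_canonW hc]
      simp [this]
    -- A regression residual is uncorrelated with the regressors: Cov(w, x) and Cov(w, w) are both t
    -- on the same coordinate and cancel.
    · rw [e1, e2, covariance_sub_right (hW _ _) (hX _ _) (hW _ _), h.covariance_canonW hc,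
        covariance_comm, h.covariance_canonX_canonW hc]
      by_cases h1 : p.1 = q.1 <;> by_cases h2 : p.2 = q.2 <;> simp [h1, h2, eq_comm]
    · rw [e1, e2, covariance_sub_left (hX _ _) (hW _ _) (hW _ _), h.covariance_canonW hc,
        h.covariance_canonX_canonW hc]
      simp
    · have hne : ¬ (p.1 = q.1 ∧ p.2 = q.2) := fun h' => hpq (by rw [Prod.ext h'.1 h'.2])
      have hne' : ¬ (q.1 = p.1 ∧ q.2 = p.2) := fun h' => hne ⟨h'.1.symm, h'.2.symm⟩
      rw [e2, e2, covariance_sub_sub (hX _ _) (hW _ _) (hX _ _) (hW _ _), h.covariance_canonX hc,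
        h.covariance_canonW hc, covariance_comm (canonW _ _ _ _ _), h.covariance_canonX_canonW hc,
        h.covariance_canonX_canonW hc]
      simp [hne, hne']

/-- Unmatched canonical coordinates are independent. -/
lemma hasLaw_canonical_of_ne (h : IsCorrelatedDatabases P M s A B) (hc : s.IsCanonical T N t)
    {u : U} {v : V} (huv : M u ≠ v) :
    HasLaw (fun ω => ((fun i => canonW s B N v i ω, fun i => canonX s A T u i ω) :
        (Da → ℝ) × (Da → ℝ)))
      ((Measure.pi fun i : Da => gaussianReal 0 (t i).toNNReal).prod
        (Measure.pi fun _ : Da => gaussianReal 0 1)) P := by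
  have := h.isProbabilityMeasure
  set L : Da ⊕ Da → (U → Da → ℝ) × (V → Db → ℝ) →ₗ[ℝ] ℝ :=
    Sum.elim (fun i => functionalW N v i) (fun i => functionalX T u i) with hL
  set D : Ω → (U → Da → ℝ) × (V → Db → ℝ) :=
    fun ω => (fun u => A u ω - s.meanA, fun v => B v ω - s.meanB) with hD
  have e1 : ∀ i, (fun ω => L (Sum.inl i) (D ω)) = canonW s B N v i := fun i => rfl
  have e2 : ∀ i, (fun ω => L (Sum.inr i) (D ω)) = canonX s A T u i := fun i => rfl
  suffices hfam : iIndepFun (fun k ω => L k (D ω)) P ∧ ∀ k, HasLaw (fun ω => L k (D ω))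
      (gaussianReal 0 (Sum.elim (fun i => (t i).toNNReal) (fun _ => 1) k)) P from
    hasLaw_prod_of_iIndepFun_sum hfam.2 hfam.1
  refine iIndepFun_linear_of_covariance h.hasGaussianLaw_centered L _ ?_ ?_ ?_
  · rintro (i | i)
    · exact h.integral_canonW _ _
    · exact h.integral_canonX _ _
  · rintro (i | i)
    · rw [e1, h.covariance_canonW hc]
      simp [hc.nonneg]
    · rw [e2, h.covariance_canonX hc]
      simp
  · rintro (i | i) (j | j) hij
    · have : i ≠ j := fun h' => hij (by rw [h'])
      rw [e1, e1, h.covariance_canonW hc]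
      simp [this]
    · rw [e1, e2, covariance_comm, h.covariance_canonX_canonW hc]
      simp [huv]
    · rw [e1, e2, h.covariance_canonX_canonW hc]
      simp [huv]
    · have : i ≠ j := fun h' => hij (by rw [h'])
      rw [e2, e2, h.covariance_canonX hc]
      simp [this]

lemma databaseScore_eq (hc : s.IsCanonical T N t) (ω : Ω) (u : U) (v : V) :
    databaseScore s A B ω u v =
      ∑ i, coordScore (t i) (canonX s A T u i ω) (canonW s B N v i ω) :=
  hc.infoDensity_eq _ _

end IsCorrelatedDatabases

end Canonical

/-! ### Moments of the database scores -/

section DatabaseMoments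

open Matrix

variable {U : Type*} {V : Type*} [Fintype U] [Fintype V] [DecidableEq V] [DecidableEq U]
  {Ω : Type*} [MeasurableSpace Ω] {P : Measure Ω} {M : U ≃ V}
  {Da : Type*} {Db : Type*} [Fintype Da] [Fintype Db] [DecidableEq Da] [DecidableEq Db]
  {s : FeatureStats Da Db} {A : U → Ω → Da → ℝ} {B : V → Ω → Db → ℝ}
  {T : Matrix Da Da ℝ} {N : Matrix Da Db ℝ} {t : Da → ℝ}

lemma lintegral_pi_prod_two {ι X Y : Type*} [Fintype ι] [MeasurableSpace X] [MeasurableSpace Y]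
    (μ : ι → Measure X) (ν : ι → Measure Y) [∀ i, IsProbabilityMeasure (μ i)]
    [∀ i, IsProbabilityMeasure (ν i)] (f : ι → X → Y → ℝ≥0∞)
    (hf : ∀ i, Measurable (Function.uncurry (f i))) :
    ∫⁻ w, ∫⁻ z, ∏ i, f i (w i) (z i) ∂Measure.pi ν ∂Measure.pi μ =
      ∏ i, ∫⁻ w, ∫⁻ z, f i w z ∂ν i ∂μ i := by
  have h1 : ∀ i w, Measurable (f i w) := fun i w => (hf i).comp measurable_prodMk_left
  rw [← lintegral_pi_prod μ (fun i w => ∫⁻ z, f i w z ∂ν i) fun i => (hf i).lintegral_prod_right']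
  exact lintegral_congr fun w => lintegral_pi_prod ν (fun i => f i (w i)) fun i => h1 i _

lemma measurable_prod_uncurry {ι X Y : Type*} [Fintype ι] [MeasurableSpace X] [MeasurableSpace Y]
    (f : ι → X → Y → ℝ≥0∞) (hf : ∀ i, Measurable (Function.uncurry (f i))) :
    Measurable (Function.uncurry fun (w : ι → X) (z : ι → Y) => ∏ i, f i (w i) (z i)) :=
  Finset.measurable_fun_prod _ fun i _ => (hf i).comp (f := fun x :
      (ι → X) × (ι → Y) => (x.1 i, x.2 i)) (by fun_prop)

namespace IsCorrelatedDatabases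

lemma scoreMeasurable (h : IsCorrelatedDatabases P M s A B) (hc : s.IsCanonical T N t) :
    ScoreMeasurable P (databaseScore s A B) := by
  intro u v
  have hX : ∀ i, AEMeasurable (canonX s A T u i) P := fun i =>
    (h.memLp_canonX u i).1.aemeasurable
  have hW : ∀ i, AEMeasurable (canonW s B N v i) P := fun i =>
    (h.memLp_canonW v i).1.aemeasurable
  simp only [databaseScore_eq hc, coordScore]
  fun_prop

/-- Integrals of functions of the matched canonical coordinates. -/
lemma lintegral_canonical (h : IsCorrelatedDatabases P M s A B) (hc : s.IsCanonical T N t)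
    (Φ : (U × Da → ℝ) → (U × Da → ℝ) → ℝ≥0∞) (hΦ : Measurable (Function.uncurry Φ)) :
    ∫⁻ ω, Φ (fun p => canonW s B N (M p.1) p.2 ω)
        (fun p => canonX s A T p.1 p.2 ω - canonW s B N (M p.1) p.2 ω) ∂P =
      ∫⁻ w, ∫⁻ z, Φ w z ∂(Measure.pi fun p : U × Da => gaussianReal 0 (1 - t p.2).toNNReal)
        ∂(Measure.pi fun p : U × Da => gaussianReal 0 (t p.2).toNNReal) := by
  refine Eq.trans ?_ (lintegral_prod (Function.uncurry Φ) hΦ.aemeasurable)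
  exact (h.hasLaw_canonical hc).lintegral_comp hΦ.aemeasurable

/-- The pairs (w, x - w) are independent over all users and coordinates, so the moment factors into
one-coordinate integrals. -/
lemma trueMoment (h : IsCorrelatedDatabases P M s A B) (hc : s.IsCanonical T N t) {θ : ℝ}
    (h0 : 0 ≤ θ) (h1 : θ ≤ 1) :
    TrueMoment P M (databaseScore s A B) θ (∑ i, -(Real.log (1 - t i) / 2)) := by
  intro S
  set f : U × Da → ℝ → ℝ → ℝ≥0∞ := fun p w z =>
    if p.1 ∈ S then eexp (-(θ * coordScore (t p.2) (w + z) w)) else 1 with hf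
  have hfm : ∀ p, Measurable (Function.uncurry (f p)) := by
    intro p
    simp only [hf, Function.uncurry_def]
    split_ifs <;> fun_prop
  have hint : ∀ ω, eexp (-(θ * ∑ u ∈ S, databaseScore s A B ω u (M u))) =
      ∏ p, f p (canonW s B N (M p.1) p.2 ω)
        (canonX s A T p.1 p.2 ω - canonW s B N (M p.1) p.2 ω) := by
    intro ω
    simp only [hf, Fintype.prod_prod_type, add_sub_cancel]
    have : ∀ u, (∏ i, if u ∈ S then eexp (-(θ * coordScore (t i) (canonX s A T u i ω)
        (canonW s B N (M u) i ω))) else 1) =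
        if u ∈ S then eexp (-(θ * databaseScore s A B ω u (M u))) else 1 := by
      intro u
      split_ifs
      · rw [← eexp_sum, databaseScore_eq hc, Finset.mul_sum, Finset.sum_neg_distrib]
      · simp
    rw [Finset.prod_congr rfl fun u _ => this u, Finset.prod_ite_mem, Finset.univ_inter, ← eexp_sum,
      Finset.mul_sum, Finset.sum_neg_distrib]
  rw [lintegral_congr hint, h.lintegral_canonical hc (fun w z => ∏ p, f p (w p) (z p))
    (measurable_prod_uncurry f hfm), lintegral_pi_prod_two _ _ f hfm, Fintype.prod_prod_type]
  have hle : ∀ u, ∏ i, ∫⁻ w, ∫⁻ z, f (u, i) w z ∂gaussianReal 0 (1 - t i).toNNReal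
      ∂gaussianReal 0 (t i).toNNReal ≤
      if u ∈ S then eexp (-(θ * (1 - θ) * ∑ i, -(Real.log (1 - t i) / 2))) else 1 := by
    intro u
    split_ifs with hu
    · rw [Finset.mul_sum, ← Finset.sum_neg_distrib, eexp_sum]
      refine Finset.prod_le_prod' fun i _ => ?_
      simp only [hf, hu, if_true]
      exact lintegral_eexp_neg_coordScore (hc.nonneg i) (hc.lt_one i) h0 h1
    · simp [hf, hu]
  refine (Finset.prod_le_prod' fun u _ => hle u).trans (le_of_eq ?_)
  rw [Finset.prod_ite_mem, Finset.univ_inter, Finset.prod_const]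

/-- For an unmatched pair all x and w coordinates are independent, so the moment again factors. -/
lemma falseMoment (h : IsCorrelatedDatabases P M s A B) (hc : s.IsCanonical T N t) {θ : ℝ}
    (h0 : 0 ≤ θ) (h1 : θ ≤ 1) :
    FalseMoment P M (databaseScore s A B) θ (∑ i, -(Real.log (1 - t i) / 2)) := by
  intro u v huv
  set f : Da → ℝ → ℝ → ℝ≥0∞ := fun i w x => eexp ((1 - θ) * coordScore (t i) x w) with hf
  have hfm : ∀ i, Measurable (Function.uncurry (f i)) := by
    intro i
    simp only [hf, Function.uncurry_def]
    fun_prop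
  have hint : ∀ ω, eexp ((1 - θ) * databaseScore s A B ω u v) =
      ∏ i, f i (canonW s B N v i ω) (canonX s A T u i ω) := by
    intro ω
    rw [← eexp_sum, databaseScore_eq hc, Finset.mul_sum]
  have hΦ := measurable_prod_uncurry f hfm
  rw [lintegral_congr hint]
  refine le_trans (le_of_eq ((h.hasLaw_canonical_of_ne hc huv).lintegral_comp hΦ.aemeasurable)) ?_
  refine le_trans (le_of_eq (lintegral_prod _ hΦ.aemeasurable)) ?_
  refine le_trans (le_of_eq (lintegral_pi_prod_two _ _ f hfm)) ?_
  rw [Finset.mul_sum, ← Finset.sum_neg_distrib, eexp_sum]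
  exact Finset.prod_le_prod' fun i _ =>
    lintegral_eexp_coordScore (hc.nonneg i) (hc.lt_one i) h0 h1

/-- The score of (u, Mσu) involves x(u) = w(u) + z(u) and w(σu). Once z is integrated out, the
kernels couple w(u) and w(σu) in cyclic chains, which `lintegral_pi_prod_perm_le` decouples. The
square root taken there turns the exponent 4θ(1-θ) of the squared kernel into 2θ(1-θ). -/
lemma pairMoment_of_kernel (h : IsCorrelatedDatabases P M s A B) (hc : s.IsCanonical T N t) {θ : ℝ}
    (h1 : θ ≤ 1 / 2) (y : Da → ℝ)
    (hy : ∀ i, ∫⁻ w, ∫⁻ w', coordKernel (t i) θ w w' ^ 2 ∂gaussianReal 0 (t i).toNNReal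
      ∂gaussianReal 0 (t i).toNNReal ≤ eexp (-(4 * θ * (1 - θ) * y i))) :
    PairMoment P M (databaseScore s A B) θ (∑ i, y i) := by
  intro σ S hS
  -- The permutation acts on users only, so each canonical coordinate carries its own copy of the
  -- chain. Users outside `S` get the trivial factor 1; this covers all fixed points, as σ moves
  -- `S`.
  set ρ : Equiv.Perm (U × Da) := Equiv.prodCongr σ (Equiv.refl Da) with hρ
  have hρ1 : ∀ p, ρ p = (σ p.1, p.2) := fun p => rfl
  set f : U × Da → ℝ → ℝ → ℝ → ℝ≥0∞ := fun p w w' z =>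
    if p.1 ∈ S then eexp ((1 - θ) * coordScore (t p.2) (w + z) w' -
      θ * coordScore (t p.2) (w + z) w) else 1 with hf
  have hfm : ∀ p, Measurable (fun x : ℝ × ℝ × ℝ => f p x.1 x.2.1 x.2.2) := by
    intro p
    simp only [hf]
    split_ifs <;> fun_prop
  have hfm1 : ∀ p w w', Measurable (f p w w') := fun p w w' =>
    (hfm p).comp (f := fun z => (w, w', z)) (by fun_prop)
  have hint : ∀ ω, eexp (∑ u ∈ S, ((1 - θ) * databaseScore s A B ω u (M (σ u)) -
      θ * databaseScore s A B ω u (M u))) =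
      ∏ p, f p (canonW s B N (M p.1) p.2 ω) (canonW s B N (M (ρ p).1) (ρ p).2 ω)
        (canonX s A T p.1 p.2 ω - canonW s B N (M p.1) p.2 ω) := by
    intro ω
    simp only [hf, hρ1, Fintype.prod_prod_type, add_sub_cancel]
    have : ∀ u, (∏ i, if u ∈ S then eexp ((1 - θ) * coordScore (t i) (canonX s A T u i ω)
        (canonW s B N (M (σ u)) i ω) - θ * coordScore (t i) (canonX s A T u i ω)
        (canonW s B N (M u) i ω)) else 1) =
        if u ∈ S then eexp ((1 - θ) * databaseScore s A B ω u (M (σ u)) -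
          θ * databaseScore s A B ω u (M u)) else 1 := by
      intro u
      split_ifs
      · rw [← eexp_sum, databaseScore_eq hc, databaseScore_eq hc, Finset.mul_sum, Finset.mul_sum,
          Finset.sum_sub_distrib]
      · simp
    rw [Finset.prod_congr rfl fun u _ => this u, Finset.prod_ite_mem, Finset.univ_inter, ← eexp_sum]
  rw [lintegral_congr hint,
    h.lintegral_canonical hc (fun w z => ∏ p, f p (w p) (w (ρ p)) (z p))]
  swap
  · simp only [Function.uncurry_def]
    exact Finset.measurable_prod _ fun p _ => (hfm p).comp (f := fun x :
      (U × Da → ℝ) × (U × Da → ℝ) => (x.1 p, x.1 (ρ p), x.2 p)) (by fun_prop)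
  simp only [lintegral_pi_prod _ _ fun p => hfm1 p _ _]
  set k : U × Da → ℝ → ℝ → ℝ≥0∞ := fun p =>
    if p.1 ∈ S then coordKernel (t p.2) θ else 1 with hk
  have hfk : ∀ p w w', ∫⁻ z, f p w w' z ∂gaussianReal 0 (1 - t p.2).toNNReal = k p w w' := by
    intro p w w'
    by_cases hp : p.1 ∈ S
    · simp only [hf, hk, hp, if_true, coordKernel]
    · simp [hf, hk, hp]
  simp only [hfk]
  refine (lintegral_pi_prod_perm_le _ ρ k ?_ ?_).trans ?_
  · intro p
    by_cases hp : p.1 ∈ S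
    · simp only [hk, hp, if_true]
      exact measurable_coordKernel (hc.nonneg _) (hc.lt_one _) h1
    · simp only [hk, hp, if_false]
      exact measurable_const
  · intro p hp
    have hσ : σ p.1 = p.1 := congrArg Prod.fst hp
    have : p.1 ∉ S := fun hpS => Equiv.Perm.mem_support.1 (hS hpS) hσ
    simp [hk, this]
  · rw [Fintype.prod_prod_type]
    have hle : ∀ u, ∏ i, (∫⁻ x, ∫⁻ y, k (u, i) x y ^ 2 ∂gaussianReal 0 (t (ρ (u, i)).2).toNNReal
        ∂gaussianReal 0 (t i).toNNReal) ^ (1 / 2 : ℝ) ≤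
        if u ∈ S then eexp (-(2 * θ * (1 - θ) * ∑ i, y i)) else 1 := by
      intro u
      split_ifs with hu
      · rw [Finset.mul_sum, ← Finset.sum_neg_distrib, eexp_sum]
        refine Finset.prod_le_prod' fun i _ => ?_
        simp only [hk, hu, if_true, hρ1]
        refine (ENNReal.rpow_le_rpow (hy i) (by norm_num)).trans (le_of_eq ?_)
        rw [eexp_rpow]
        congr 1
        ring
      · simp [hk, hu]
    refine (Finset.prod_le_prod' fun u _ => hle u).trans (le_of_eq ?_)
    rw [Finset.prod_ite_mem, Finset.univ_inter, Finset.prod_const]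

lemma pairMoment_half (h : IsCorrelatedDatabases P M s A B) (hc : s.IsCanonical T N t) :
    PairMoment P M (databaseScore s A B) (1 / 2) (∑ i, -(Real.log (1 - t i) / 2)) :=
  h.pairMoment_of_kernel hc le_rfl _ fun i =>
    lintegral_coordKernel_sq_half (hc.nonneg i) (hc.lt_one i)

lemma pairMoment_of_small (h : IsCorrelatedDatabases P M s A B) (hc : s.IsCanonical T N t)
    {θ ε : ℝ} (h0 : 0 < θ) (h1 : θ ≤ 1 / 2) (hε0 : 0 ≤ ε) (hε1 : ε ≤ 1)
    (ht : ∀ i, t i ≤ 2 * θ * (1 - θ) * ε / 5) :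
    PairMoment P M (databaseScore s A B) θ ((1 - ε) * ∑ i, -(Real.log (1 - t i) / 2)) := by
  rw [Finset.mul_sum]
  exact h.pairMoment_of_kernel hc h1 _ fun i =>
    lintegral_coordKernel_sq_le (hc.nonneg i) h0 h1 hε0 hε1 (ht i)

end IsCorrelatedDatabases

/-- The difference of the two coordinates is a nondegenerate Gaussian and so has no atom at 0. This
keeps the conditional variance of a swap gain positive. -/
lemma measure_pi_gaussianReal_eq_eval {ι : Type*} [Fintype ι] [DecidableEq ι]
    {v : ι → NNReal} {p q : ι} (hpq : p ≠ q) (hp : v p ≠ 0) :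
    ∀ᵐ w ∂(Measure.pi fun i => gaussianReal 0 (v i)), w p ≠ w q := by
  set c : ι → ℝ := fun i => (if i = p then 1 else 0) - (if i = q then 1 else 0) with hc
  have hlaw := hasLaw_sum_gaussianReal (P := Measure.pi fun i => gaussianReal 0 (v i))
    (X := fun i (y : ι → ℝ) => y i) (m := fun _ => 0) (v := v)
    (fun i => ⟨(measurable_pi_apply i).aemeasurable, (measurePreserving_eval _ i).map_eq⟩)
    (iIndepFun_pi (X := fun _ x => x) fun i => aemeasurable_id) c Finset.univ
  have hvar : (∑ i, NNReal.mk (c i ^ 2) (sq_nonneg _) * v i) ≠ 0 := by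
    intro h0
    rw [Finset.sum_eq_zero_iff] at h0
    have h1 := h0 p (Finset.mem_univ _)
    rcases mul_eq_zero.1 h1 with h2 | h2
    · have h3 : c p ^ 2 = 0 := congrArg NNReal.toReal h2
      simp [hc, hpq] at h3
    · exact hp h2
  have := nullSingletonClass_gaussianReal (μ := ∑ i, c i * 0) hvar
  have hz := hlaw.measure_eq (p := fun x => x = 0) (measurableSet_singleton 0)
  rw [ae_iff]
  have hs : {w : ι → ℝ | ¬ w p ≠ w q} = {w | ∑ i, c i * w i = 0} := by
    ext w
    simp [hc, sub_mul, Finset.sum_sub_distrib, sub_eq_zero]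
  rw [hs, hz]
  exact measure_singleton (μ := gaussianReal _ _) 0

end DatabaseMoments

/-! ### Tail bound for transpositions in the database model. -/

section DatabaseSwap

open Matrix

variable {U : Type*} {V : Type*} [Fintype U] [Fintype V] [DecidableEq V] [DecidableEq U]
  {Ω : Type*} [MeasurableSpace Ω] {P : Measure Ω} {M : U ≃ V}
  {Da : Type*} {Db : Type*} [Fintype Da] [Fintype Db] [DecidableEq Da] [DecidableEq Db]
  {s : FeatureStats Da Db} {A : U → Ω → Da → ℝ} {B : V → Ω → Db → ℝ}
  {T : Matrix Da Da ℝ} {N : Matrix Da Db ℝ} {t : Da → ℝ}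

/-- The gain of a transposition as a function of the canonical coordinates. -/
noncomputable def swapGain (t : Da → ℝ) (u u' : U) (w z : U × Da → ℝ) : ℝ :=
  ∑ i, (-((w (u, i) - w (u', i)) ^ 2 / (1 - t i)) +
    -((w (u, i) - w (u', i)) / (1 - t i)) * (z (u, i) - z (u', i)))

lemma measurable_swapGain (t : Da → ℝ) (u u' : U) :
    Measurable (Function.uncurry (swapGain t u u')) := by
  simp only [Function.uncurry_def, swapGain]
  fun_prop

/-- For fixed w the gain is affine in the noise z, hence Gaussian. Its mean is minus a sum of
squares, and its variance is nonzero because w separates the two users in the coordinate `j`. -/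
lemma swapGain_tail (ht : ∀ i, t i < 1) {u u' : U} (huu : u ≠ u') {w : U × Da → ℝ} {j : Da}
    (hw : w (u, j) ≠ w (u', j)) :
    (Measure.pi fun p : U × Da => gaussianReal 0 (1 - t p.2).toNNReal)
        {z | 0 ≤ swapGain t u u' w z} ≤
      (∫⁻ z, eexp (1 / 2 * swapGain t u u' w z)
        ∂(Measure.pi fun p : U × Da => gaussianReal 0 (1 - t p.2).toNNReal)) / 2 := by
  set d : Da → ℝ := fun i => -((w (u, i) - w (u', i)) / (1 - t i)) with hd
  set c : U × Da → ℝ := fun p => if p.1 = u then d p.2 else if p.1 = u' then - d p.2 else 0 with hc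
  set m : ℝ := ∑ i, -((w (u, i) - w (u', i)) ^ 2 / (1 - t i)) with hm
  have hlaw := hasLaw_sum_gaussianReal
    (P := Measure.pi fun p : U × Da => gaussianReal 0 (1 - t p.2).toNNReal)
    (X := fun i (y : U × Da → ℝ) => y i) (m := fun _ => 0) (v := fun p => (1 - t p.2).toNNReal)
    (fun i => ⟨(measurable_pi_apply i).aemeasurable, (measurePreserving_eval _ i).map_eq⟩)
    (iIndepFun_pi (X := fun _ x => x) fun i => aemeasurable_id) c Finset.univ
  have hlaw' := gaussianReal_const_add hlaw m
  have hgain : ∀ z : U × Da → ℝ, m + ∑ p, c p * z p = swapGain t u u' w z := by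
    intro z
    rw [Fintype.sum_prod_type]
    have : ∑ x, ∑ y, c (x, y) * z (x, y) = ∑ i, d i * (z (u, i) - z (u', i)) := by
      rw [Finset.sum_comm]
      refine Finset.sum_congr rfl fun i _ => ?_
      have h2 : ∀ x, c (x, i) * z (x, i) = (if x = u then d i * z (x, i) else 0) -
          (if x = u' then d i * z (x, i) else 0) := by
        intro x
        simp only [hc]
        by_cases h3 : x = u
        · simp [h3, huu]
        · by_cases h4 : x = u'
          · simp [h4, huu.symm]
          · simp [h3, h4]
      rw [Finset.sum_congr rfl fun x _ => h2 x, Finset.sum_sub_distrib]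
      simp
      ring
    rw [this, hm, ← Finset.sum_add_distrib, swapGain]
  have hmean : ∑ p, c p * 0 + m ≤ 0 := by
    simp only [mul_zero, Finset.sum_const_zero, zero_add, hm]
    refine Finset.sum_nonpos fun i _ => ?_
    have := sub_pos.2 (ht i)
    rw [neg_nonpos]
    positivity
  have hvar : (∑ p : U × Da, NNReal.mk (c p ^ 2) (sq_nonneg _) * (1 - t p.2).toNNReal) ≠ 0 := by
    intro h0
    rw [Finset.sum_eq_zero_iff] at h0
    have hs := sub_pos.2 (ht j)
    rcases mul_eq_zero.1 (h0 (u, j) (Finset.mem_univ _)) with h2 | h2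
    · have h3 : c (u, j) ^ 2 = 0 := congrArg NNReal.toReal h2
      have h4 : c (u, j) = d j := by simp [hc]
      rw [h4, sq_eq_zero_iff, hd, neg_eq_zero, div_eq_zero_iff] at h3
      rcases h3 with h3 | h3
      · exact hw (sub_eq_zero.1 h3)
      · exact hs.ne' h3
    · rw [Real.toNNReal_eq_zero] at h2
      exact absurd h2 (not_le.2 hs)
  have key := measure_nonneg_le_of_hasLaw_gaussianReal hlaw' hmean hvar (1 / 2)
  simp only [hgain] at key
  exact key

namespace IsCorrelatedDatabases

/-- The gain is a quadratic function of Gaussians, but conditionally on w it is Gaussian with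
nonpositive mean. So the factor 1/2 is gained for almost every w, and averaging over w restores the
full exponential moment. Some t j > 0 is needed: otherwise every w vanishes almost surely and so
does the gain. -/
lemma swapTail (h : IsCorrelatedDatabases P M s A B) (hc : s.IsCanonical T N t)
    (hpos : ∃ j, 0 < t j) :
    SwapTail P M (databaseScore s A B) (∑ i, -(Real.log (1 - t i) / 2)) := by
  intro u u' huu
  refine measure_swap_le_of_pairMoment (h.pairMoment_half hc) huu ?_
  obtain ⟨j, hj⟩ := hpos
  have hgain : ∀ ω, databaseScore s A B ω u (M u') + databaseScore s A B ω u' (M u) -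
      databaseScore s A B ω u (M u) - databaseScore s A B ω u' (M u') =
      swapGain t u u' (fun p => canonW s B N (M p.1) p.2 ω)
        (fun p => canonX s A T p.1 p.2 ω - canonW s B N (M p.1) p.2 ω) := by
    intro ω
    simp only [databaseScore_eq hc, swapGain, ← Finset.sum_add_distrib, ← Finset.sum_sub_distrib]
    refine Finset.sum_congr rfl fun i _ => ?_
    have := (sub_pos.2 (hc.lt_one i)).ne'
    simp only [coordScore]
    field_simp
    ring
  have hms := measurable_swapGain t u u'
  have hset : MeasurableSet {x : (U × Da → ℝ) × (U × Da → ℝ) | 0 ≤ swapGain t u u' x.1 x.2} :=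
    measurableSet_le measurable_const hms
  have hP : P {ω | databaseScore s A B ω u (M u) + databaseScore s A B ω u' (M u') ≤
      databaseScore s A B ω u (M u') + databaseScore s A B ω u' (M u)} =
      ((Measure.pi fun p : U × Da => gaussianReal 0 (t p.2).toNNReal).prod
        (Measure.pi fun p : U × Da => gaussianReal 0 (1 - t p.2).toNNReal))
        {x | 0 ≤ swapGain t u u' x.1 x.2} := by
    rw [← (h.hasLaw_canonical hc).measure_eq (p := fun x => 0 ≤ swapGain t u u' x.1 x.2) hset]
    congr 1
    ext ω
    simp only [Set.mem_ofPred_eq, ← hgain]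
    constructor <;> intro h' <;> linarith
  rw [hP, Measure.prod_apply hset]
  simp only [hgain]
  rw [h.lintegral_canonical hc (fun w z => eexp (1 / 2 * swapGain t u u' w z))
    (by simp only [Function.uncurry_def] at hms ⊢; fun_prop), ENNReal.div_eq_inv_mul,
    ← lintegral_const_mul' _ _ (by simp)]
  have hae := measure_pi_gaussianReal_eq_eval (v := fun p : U × Da => (t p.2).toNNReal)
    (p := (u, j)) (q := (u', j)) (fun he => huu (congrArg Prod.fst he))
    (by simpa using hj)
  refine lintegral_mono_ae ?_
  filter_upwards [hae] with w hw
  rw [← ENNReal.div_eq_inv_mul]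
  exact swapGain_tail hc.lt_one huu hw

end IsCorrelatedDatabases

end DatabaseSwap

/-! ### Error bounds from moment bounds -/

lemma eexp_mul_log {n : ℕ} (hn : 1 ≤ n) (a : ℝ) :
    eexp (a * Real.log n) = ENNReal.ofReal ((n : ℝ) ^ a) := by
  have : (0 : ℝ) < n := by exact_mod_cast hn
  rw [eexp, Real.rpow_def_of_pos this, mul_comm]

open scoped Matrix.Norms.L2Operator in
lemma FeatureStats.maxCorrelation_nonneg {Da : Type*} {Db : Type*} [Fintype Da] [Fintype Db]
    [DecidableEq Da] [DecidableEq Db] (s : FeatureStats Da Db) : 0 ≤ s.maxCorrelation :=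
  norm_nonneg s.normalizedCov

section Guarantees

variable {U : Type*} {V : Type*} [Fintype U] [Fintype V] [DecidableEq V] [DecidableEq U]
  {Ω : Type*} [MeasurableSpace Ω] {P : Measure Ω} {M : U ≃ V} {G : Ω → Matrix U V ℝ} {z : ℝ}
  {n : ℕ} {β : ℝ}

/-- The moment bounds, at signal strength `z`, that hold in both models. -/
structure HasScoreMoments (P : Measure Ω) (M : U ≃ V) (G : Ω → Matrix U V ℝ) (z : ℝ) : Prop where
  measurable : ScoreMeasurable P G
  trueMoment : ∀ θ, 0 ≤ θ → θ ≤ 1 → TrueMoment P M G θ z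
  falseMoment : ∀ θ, 0 ≤ θ → θ ≤ 1 → FalseMoment P M G θ z
  pairMoment : PairMoment P M G (1 / 2) z
  swapTail : 0 < z → SwapTail P M G z

lemma IsPlantedMatching.hasScoreMoments [IsProbabilityMeasure P] {μ : ℝ} {W : U → V → Ω → ℝ}
    (h : IsPlantedMatching P M μ W) (hμ : 0 < μ) :
    HasScoreMoments P M (plantedScore μ W) (μ ^ 2 / 2) where
  measurable := h.scoreMeasurable
  trueMoment θ _ _ := h.trueMoment θ
  falseMoment θ _ _ := h.falseMoment θ
  pairMoment := h.pairMoment (1 / 2)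
  swapTail _ := h.swapTail hμ

lemma IsCorrelatedDatabases.hasScoreMoments {Da : Type*} {Db : Type*} [Fintype Da] [Fintype Db]
    [DecidableEq Da] [DecidableEq Db] {s : FeatureStats Da Db} {A : U → Ω → Da → ℝ}
    {B : V → Ω → Db → ℝ} (h : IsCorrelatedDatabases P M s A B) :
    HasScoreMoments P M (databaseScore s A B) s.mutualInfo := by
  obtain ⟨T, N, t, hc, -⟩ := s.exists_isCanonical
  rw [hc.mutualInfo_eq]
  refine ⟨h.scoreMeasurable hc, fun θ h0 h1 => h.trueMoment hc h0 h1,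
    fun θ h0 h1 => h.falseMoment hc h0 h1, h.pairMoment_half hc, fun hz => h.swapTail hc ?_⟩
  by_contra! hcon
  refine absurd hz (not_lt.2 (Finset.sum_nonpos fun i _ => ?_))
  have := Real.log_nonneg (x := 1 - t i) (by linarith [hcon i])
  linarith

lemma IsCorrelatedDatabases.pairMoment_of_maxCorrelation_le {Da : Type*} {Db : Type*} [Fintype Da]
    [Fintype Db] [DecidableEq Da] [DecidableEq Db] {s : FeatureStats Da Db} {A : U → Ω → Da → ℝ}
    {B : V → Ω → Db → ℝ} (h : IsCorrelatedDatabases P M s A B) {θ ε κ : ℝ} (h0 : 0 < θ)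
    (h1 : θ ≤ 1 / 2) (hε0 : 0 ≤ ε) (hε1 : ε ≤ 1) (hs : s.maxCorrelation ≤ κ)
    (hκ : κ ^ 2 ≤ 2 * θ * (1 - θ) * ε / 5) :
    PairMoment P M (databaseScore s A B) θ ((1 - ε) * s.mutualInfo) := by
  obtain ⟨T, N, t, hc, ht⟩ := s.exists_isCanonical
  rw [hc.mutualInfo_eq]
  refine h.pairMoment_of_small hc h0 h1 hε0 hε1 fun i => (ht i).trans (le_trans ?_ hκ)
  exact pow_le_pow_left₀ s.maxCorrelation_nonneg hs 2

/-- With a = √β and b = √(1+β), the choice θ = a(b-a) minimizes the exponent 1 + θ - θ(1-θ)(a+b)².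
As b² - a² = 1, one has 1-θ = b(b-a) and θ(1-θ)(a+b)² = ab, so the minimum is 1 - a² = 1 - β. -/
lemma HasScoreMoments.threshold_le (h : HasScoreMoments P M G z) (hβ : 0 < β) (hn : 1 ≤ n)
    (hU : Fintype.card U = n) (hz : (Real.sqrt β + Real.sqrt (1 + β)) ^ 2 * Real.log n ≤ z) :
    ExpectedErrorsLE P .threshold M G (2 * (n : ℝ) ^ (1 - β)) := by
  intro τ m hτ _ hm
  have hL : 0 ≤ Real.log n := Real.log_nonneg (by exact_mod_cast hn)
  set a := Real.sqrt β with ha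
  set b := Real.sqrt (1 + β) with hb
  have ha2 : a ^ 2 = β := Real.sq_sqrt hβ.le
  have hb2 : b ^ 2 = 1 + a ^ 2 := by rw [ha2]; exact Real.sq_sqrt (by linarith)
  have ha0 : 0 < a := Real.sqrt_pos.2 hβ
  have hab : a < b := Real.sqrt_lt_sqrt hβ.le (by linarith)
  have h1θ : 1 - a * (b - a) = b * (b - a) := by linear_combination -hb2
  have hθ0 : 0 ≤ a * (b - a) := mul_nonneg ha0.le (sub_nonneg.2 hab.le)
  have hθ1 : a * (b - a) ≤ 1 := by
    have : 0 ≤ b * (b - a) := mul_nonneg (ha0.le.trans hab.le) (sub_nonneg.2 hab.le)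
    linarith
  rw [Algorithm.Offset, hU] at hτ
  refine (lintegral_threshold_errors_le hn hU h.measurable hθ0 hθ1 (h.trueMoment _ hθ0 hθ1)
    (h.falseMoment _ hθ0 hθ1) hτ hm).trans ?_
  rw [ENNReal.ofReal_mul zero_le_two, ENNReal.ofReal_ofNat, ← eexp_mul_log hn]
  gcongr
  apply eexp_mono
  have hc : a * (b - a) * (1 - a * (b - a)) * (a + b) ^ 2 = a * b := by
    rw [h1θ]
    have : (b - a) * (a + b) = 1 := by linear_combination hb2
    calc a * (b - a) * (b * (b - a)) * (a + b) ^ 2 = a * b * ((b - a) * (a + b)) ^ 2 := by ring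
      _ = a * b := by rw [this]; ring
  have hnn : 0 ≤ a * (b - a) * (1 - a * (b - a)) := mul_nonneg hθ0 (by linarith)
  have := mul_le_mul_of_nonneg_left hz hnn
  rw [← mul_assoc, hc] at this
  have e : (1 - β) * Real.log n = (1 + a * (b - a)) * Real.log n - a * b * Real.log n := by
    rw [← ha2]; ring
  linarith

/-- Take r = √β; then r(1-θ) = θ forces θ = r/(1+r). Without loss the exponent is 1 + r - r(1+r) = 1
- β, and a relative loss ε of the pair moment adds 2βε. The constraint r ≤ 1 is β ≤ 1. -/
lemma HasScoreMoments.maxRow_le_of_pairMoment (h : HasScoreMoments P M G z) (hβ : 0 < β)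
    (hβ1 : β ≤ 1) (hn : 1 ≤ n) (hU : Fintype.card U = n) {ε : ℝ} (hε1 : ε ≤ 1)
    (hF : PairMoment P M G (Real.sqrt β / (1 + Real.sqrt β)) ((1 - ε) * z))
    (hz : (1 + Real.sqrt β) ^ 2 * Real.log n ≤ z) :
    ExpectedErrorsLE P .maxRow M G ((n : ℝ) ^ (1 - β + 2 * β * ε)) := by
  intro τ m _ _ hm
  have hL : 0 ≤ Real.log n := Real.log_nonneg (by exact_mod_cast hn)
  set r := Real.sqrt β with hr
  have hr2 : r ^ 2 = β := Real.sq_sqrt hβ.le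
  have hr0 : 0 < r := Real.sqrt_pos.2 hβ
  have hr1 : r ≤ 1 := Real.sqrt_le_one.2 hβ1
  have hθ : r * (1 - r / (1 + r)) = r / (1 + r) := by field_simp; ring
  have hθ0 : 0 ≤ r / (1 + r) := by positivity
  have hθ1 : r / (1 + r) ≤ 1 := by rw [div_le_one (by positivity)]; linarith
  refine (lintegral_maxRow_errors_le hn hU h.measurable hr0 hr1 hθ hθ0 (h.trueMoment _ hθ0 hθ1)
    hF hm).trans ?_
  rw [← eexp_mul_log hn]
  apply eexp_mono
  have e : r / (1 + r) * (1 - r / (1 + r)) * ((1 - r) * z + 2 * r * ((1 - ε) * z)) =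
      r / (1 + r) ^ 2 * (1 + r - 2 * r * ε) * z := by
    field_simp; ring
  have hnn : 0 ≤ r / (1 + r) ^ 2 * (1 + r - 2 * r * ε) :=
    mul_nonneg (by positivity) (by nlinarith)
  have := mul_le_mul_of_nonneg_left hz hnn
  have e2 : r / (1 + r) ^ 2 * (1 + r - 2 * r * ε) * ((1 + r) ^ 2 * Real.log n) =
      (r + β - 2 * β * ε) * Real.log n := by
    rw [← hr2]; field_simp
  rw [e2] at this
  rw [e]
  linarith

/-- The plain union bound r = 1, θ = 1/2: n·n·exp(-z/2) ≤ n^(1-β). -/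
lemma HasScoreMoments.maxRow_le_linear (h : HasScoreMoments P M G z) (hn : 1 ≤ n)
    (hU : Fintype.card U = n) (hz : 2 * (1 + β) * Real.log n ≤ z) :
    ExpectedErrorsLE P .maxRow M G (2 * (n : ℝ) ^ (1 - β)) := by
  intro τ m _ _ hm
  refine (lintegral_maxRow_errors_le hn hU h.measurable one_pos le_rfl (θ := 1 / 2) (by norm_num)
    (by norm_num) (h.trueMoment _ (by norm_num) (by norm_num)) h.pairMoment hm).trans ?_
  have : eexp ((1 + 1) * Real.log n - 1 / 2 * (1 - 1 / 2) * ((1 - 1) * z + 2 * 1 * z)) ≤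
      ENNReal.ofReal ((n : ℝ) ^ (1 - β)) := by
    rw [← eexp_mul_log hn]
    apply eexp_mono
    linarith
  refine this.trans (ENNReal.ofReal_le_ofReal ?_)
  have : 0 ≤ (n : ℝ) ^ (1 - β) := by positivity
  linarith

/-- The number of misaligned users never exceeds the number of users. -/
lemma expectedErrorsLE_card [IsProbabilityMeasure P] {alg : Algorithm}
    (halg : alg = .maxRow ∨ alg = .maxLikelihood) (hU : Fintype.card U = n) :
    ExpectedErrorsLE P alg M G n := by
  intro τ m _ _ _
  have hle : ∀ ω, (alg.errors M (m ω) : ℝ≥0∞) ≤ n := by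
    intro ω
    have : userErrors M (m ω) ≤ n := by
      rw [userErrors, ← hU, ← Nat.card_eq_fintype_card]
      exact Set.ncard_le_card _
    rcases halg with rfl | rfl <;> exact_mod_cast this
  refine (lintegral_mono hle).trans ?_
  simp

lemma ExpectedErrorsLE.mono {alg : Algorithm} {b b' : ℝ} (h : ExpectedErrorsLE P alg M G b)
    (hb : b ≤ b') : ExpectedErrorsLE P alg M G b' := fun τ m h1 h2 h3 =>
  (h τ m h1 h2 h3).trans (ENNReal.ofReal_le_ofReal hb)

/-- The union bound over cycles in terms of real numbers. -/
lemma HasScoreMoments.maxLikelihood_le_sum (h : HasScoreMoments P M G z)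
    (hU : Fintype.card U = n) {b : ℝ}
    (hb : ∑ l ∈ Finset.Icc 2 n, (n.descFactorial l : ℝ) * Real.exp (-(z / 2)) ^ l ≤ b) :
    ExpectedErrorsLE P .maxLikelihood M G b := by
  intro τ m _ _ hm
  refine (lintegral_maxLikelihood_errors_le_sum_cycles hU (fun l => eexp (-(z / 2)) ^ l)
    h.measurable (fun c _ => measure_augmenting_le h.measurable h.pairMoment c) hm).trans ?_
  refine le_trans (le_of_eq ?_) (ENNReal.ofReal_le_ofReal hb)
  rw [ENNReal.ofReal_sum_of_nonneg fun l _ => by positivity]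
  refine Finset.sum_congr rfl fun l _ => ?_
  rw [ENNReal.ofReal_mul (by positivity), ENNReal.ofReal_natCast,
    ENNReal.ofReal_pow (Real.exp_pos _).le, eexp]

/-- A sharper union bound, where transpositions are treated separately. -/
lemma HasScoreMoments.maxLikelihood_le_sum_swap (h : HasScoreMoments P M G z) (hz : 0 < z)
    (hU : Fintype.card U = n) {b : ℝ}
    (hb : (n : ℝ) ^ 2 * (Real.exp (-z) / 2) +
      ∑ l ∈ Finset.Icc 3 n, (n : ℝ) ^ l * Real.exp (-(z / 2)) ^ l ≤ b) :
    ExpectedErrorsLE P .maxLikelihood M G b := by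
  intro τ m _ _ hm
  set p : ℕ → ℝ≥0∞ := fun l => if l = 2 then eexp (-z) / 2 else eexp (-(z / 2)) ^ l with hp
  refine (lintegral_maxLikelihood_errors_le_sum_cycles hU p h.measurable ?_ hm).trans ?_
  · intro c _
    by_cases hc : c.support.card = 2
    · obtain ⟨u, u', huu, rfl⟩ := Equiv.Perm.card_support_eq_two.1 hc
      rw [hp]
      simp only [hc, if_true, sum_swap_support huu, Equiv.swap_apply_left, Equiv.swap_apply_right]
      exact h.swapTail hz u u' huu
    · rw [hp]
      simp only [hc, if_false]
      exact measure_augmenting_le h.measurable h.pairMoment c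
  refine le_trans ?_ (ENNReal.ofReal_le_ofReal hb)
  have hle : ∀ l, (n.descFactorial l : ℝ≥0∞) * p l ≤ ENNReal.ofReal (if l = 2 then
      (n : ℝ) ^ 2 * (Real.exp (-z) / 2) else (n : ℝ) ^ l * Real.exp (-(z / 2)) ^ l) := by
    intro l
    have hd : (n.descFactorial l : ℝ≥0∞) ≤ ENNReal.ofReal ((n : ℝ) ^ l) := by
      rw [ENNReal.ofReal_pow (by positivity), ENNReal.ofReal_natCast]
      exact_mod_cast Nat.descFactorial_le_pow n l
    by_cases hl : l = 2
    · subst hl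
      simp only [hp, if_true]
      rw [ENNReal.ofReal_mul (by positivity), ENNReal.ofReal_div_of_pos two_pos,
        ENNReal.ofReal_ofNat, ← eexp]
      gcongr
    · simp only [hp, hl, if_false]
      rw [ENNReal.ofReal_mul (by positivity), ENNReal.ofReal_pow (Real.exp_pos _).le, ← eexp]
      gcongr
  refine (Finset.sum_le_sum fun l _ => hle l).trans ?_
  rw [← ENNReal.ofReal_sum_of_nonneg fun l _ => by positivity]
  apply ENNReal.ofReal_le_ofReal
  by_cases h2 : 2 ≤ n
  · rw [← Finset.add_sum_Ioc_eq_sum_Icc h2, if_pos rfl]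
    gcongr
    have : Finset.Ioc 2 n = Finset.Icc 3 n := rfl
    rw [this]
    refine (Finset.sum_congr rfl fun l hl => ?_).le
    have : l ≠ 2 := by have := (Finset.mem_Icc.1 hl).1; lia
    rw [if_neg this]
  · rw [Finset.Icc_eq_empty h2, Finset.sum_empty]
    positivity

end Guarantees

/-! ### Maximum likelihood estimation: sums over cycle lengths -/

lemma sum_Icc_pow_le {x : ℝ} (hx0 : 0 ≤ x) (hx1 : x < 1) (k n : ℕ) :
    ∑ l ∈ Finset.Icc k n, x ^ l ≤ x ^ k / (1 - x) := by
  rw [← Finset.Ico_add_one_right_eq_Icc]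
  exact geom_sum_Ico_le_of_lt_one hx0 hx1

lemma mul_exp_neg_le_rpow {n : ℕ} (hn : 1 ≤ n) {c z : ℝ} (hz : c * Real.log n ≤ z) :
    (n : ℝ) * Real.exp (-(z / 2)) ≤ (n : ℝ) ^ (1 - c / 2) := by
  have h0 : (0 : ℝ) < n := by exact_mod_cast hn
  rw [Real.rpow_def_of_pos h0]
  nth_rewrite 1 [← Real.exp_log h0]
  rw [← Real.exp_add]
  apply Real.exp_le_exp.2
  linarith

/-- The partial products `n (n - 1) ⋯ (n - l + 1) / n ^ l` telescope. -/
lemma sum_mul_descFactorial_div_pow (n : ℕ) (hn : 1 ≤ n) (k : ℕ) :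
    ∑ l ∈ Finset.range k, (l : ℝ) * ((n.descFactorial l : ℝ) / (n : ℝ) ^ l) =
      n * (1 - (n.descFactorial k : ℝ) / (n : ℝ) ^ k) := by
  have h0 : (n : ℝ) ≠ 0 := by exact_mod_cast (by lia : n ≠ 0)
  induction k with
  | zero => simp
  | succ k ih =>
    rw [Finset.sum_range_succ, ih, Nat.descFactorial_succ]
    rcases le_or_gt k n with hk | hk
    · push_cast [Nat.cast_sub hk]
      field_simp
      ring
    · rw [Nat.descFactorial_of_lt hk]
      simp

/-- At most √n of the indices are ≤ √n, and each term is at most 1. A term a l with l > √n is at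
most l·a l/√n, and the telescoping identity bounds the sum of l·a l by n. -/
lemma sum_descFactorial_div_pow_le (n : ℕ) (hn : 1 ≤ n) :
    ∑ l ∈ Finset.Icc 2 n, (n.descFactorial l : ℝ) / (n : ℝ) ^ l ≤ 2 * Real.sqrt n := by
  have h0 : (0 : ℝ) < n := by exact_mod_cast hn
  have hs : 0 < Real.sqrt n := Real.sqrt_pos.2 h0
  set a : ℕ → ℝ := fun l => (n.descFactorial l : ℝ) / (n : ℝ) ^ l with ha
  have ha0 : ∀ l, 0 ≤ a l := fun l => by positivity
  have ha1 : ∀ l, a l ≤ 1 := fun l => by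
    rw [ha]
    refine div_le_one_of_le₀ ?_ (by positivity)
    exact_mod_cast Nat.descFactorial_le_pow n l
  have hle : ∀ l, a l ≤ (if (l : ℝ) ≤ Real.sqrt n then 1 else 0) + l * a l / Real.sqrt n := by
    intro l
    split_ifs with hl
    · have : 0 ≤ l * a l / Real.sqrt n := div_nonneg (mul_nonneg (by positivity) (ha0 l)) hs.le
      linarith [ha1 l]
    · rw [zero_add, le_div_iff₀ hs, mul_comm]
      exact mul_le_mul_of_nonneg_right (not_le.1 hl).le (ha0 l)
  have hcount : ∑ l ∈ Finset.Icc 2 n, (if (l : ℝ) ≤ Real.sqrt n then (1 : ℝ) else 0) ≤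
      Real.sqrt n := by
    rw [Finset.sum_boole]
    have : (Finset.Icc 2 n).filter (fun l : ℕ => (l : ℝ) ≤ Real.sqrt n) ⊆
        Finset.Icc 1 ⌊Real.sqrt n⌋₊ := by
      intro l hl
      rw [Finset.mem_filter, Finset.mem_Icc] at hl
      rw [Finset.mem_Icc]
      exact ⟨by lia, Nat.le_floor hl.2⟩
    have hc := Finset.card_le_card this
    rw [Nat.card_Icc, Nat.add_sub_cancel] at hc
    exact le_trans (by exact_mod_cast hc) (Nat.floor_le hs.le)
  have hsum : ∑ l ∈ Finset.Icc 2 n, (l : ℝ) * a l ≤ n := by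
    have h1 : ∑ l ∈ Finset.Icc 2 n, (l : ℝ) * a l ≤ ∑ l ∈ Finset.range (n + 1), (l : ℝ) * a l := by
      refine Finset.sum_le_sum_of_subset_of_nonneg (fun l hl => ?_)
        fun l _ _ => mul_nonneg (by positivity) (ha0 l)
      rw [Finset.mem_Icc] at hl
      exact Finset.mem_range.2 (by lia)
    refine h1.trans ?_
    rw [sum_mul_descFactorial_div_pow n hn, Nat.descFactorial_of_lt (Nat.lt_succ_self n)]
    simp
  calc ∑ l ∈ Finset.Icc 2 n, a l
      ≤ ∑ l ∈ Finset.Icc 2 n, ((if (l : ℝ) ≤ Real.sqrt n then 1 else 0) + l * a l / Real.sqrt n) :=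
        Finset.sum_le_sum fun l _ => hle l
    _ = ∑ l ∈ Finset.Icc 2 n, (if (l : ℝ) ≤ Real.sqrt n then (1 : ℝ) else 0) +
        (∑ l ∈ Finset.Icc 2 n, (l : ℝ) * a l) / Real.sqrt n := by
        rw [Finset.sum_add_distrib, Finset.sum_div]
    _ ≤ Real.sqrt n + n / Real.sqrt n := by gcongr
    _ = 2 * Real.sqrt n := by rw [Real.div_sqrt]; ring

section Cycles

variable {U : Type*} {V : Type*} [Fintype U] [Fintype V] [DecidableEq V] [DecidableEq U]
  {Ω : Type*} [MeasurableSpace Ω] {P : Measure Ω} {M : U ≃ V} {G : Ω → Matrix U V ℝ} {z : ℝ}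
  {n : ℕ} {β : ℝ}

/-- The end point β = 1/2 of the elliptic boundary. There r = 1 and the union over supports loses
its decay, but the cycle sum with exp(-z/2) ≤ 1/n is still of order √n. -/
lemma HasScoreMoments.maxLikelihood_le_sqrt (h : HasScoreMoments P M G z) (hn : 1 ≤ n)
    (hU : Fintype.card U = n) (hz : 2 * Real.log n ≤ z) :
    ExpectedErrorsLE P .maxLikelihood M G (2 * Real.sqrt n) := by
  have h0 : (0 : ℝ) < n := by exact_mod_cast hn
  refine h.maxLikelihood_le_sum hU (le_trans ?_ (sum_descFactorial_div_pow_le n hn))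
  refine Finset.sum_le_sum fun l _ => ?_
  rw [div_eq_mul_inv (n.descFactorial l : ℝ), ← inv_pow]
  gcongr
  have := mul_exp_neg_le_rpow hn hz
  norm_num at this
  rwa [mul_comm, ← le_div_iff₀ h0, one_div] at this

/-- The cycle sum is dominated by the geometric series of 1/g from l = 2 on, and g² = g + 1 says
exactly that this series sums to 1. -/
lemma HasScoreMoments.maxLikelihood_le_one (h : HasScoreMoments P M G z) (hn : 1 ≤ n)
    (hU : Fintype.card U = n)
    (hz : 2 * Real.log n + 2 * Real.log ((Real.sqrt 5 + 1) / 2) ≤ z) :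
    ExpectedErrorsLE P .maxLikelihood M G 1 := by
  have h0 : (0 : ℝ) < n := by exact_mod_cast hn
  set g : ℝ := (Real.sqrt 5 + 1) / 2 with hg
  have h5 : Real.sqrt 5 ^ 2 = 5 := Real.sq_sqrt (by norm_num)
  have h51 : 1 < Real.sqrt 5 := Real.lt_sqrt_of_sq_lt (by norm_num)
  have hg1 : 1 < g := by rw [hg]; linarith
  have hgg : g ^ 2 = g + 1 := by rw [hg]; linear_combination h5 / 4
  refine h.maxLikelihood_le_sum hU ?_
  have hx : (n : ℝ) * Real.exp (-(z / 2)) ≤ g⁻¹ := by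
    have : Real.exp (-(z / 2)) ≤ Real.exp (-(Real.log n + Real.log g)) :=
      Real.exp_le_exp.2 (by linarith)
    rw [Real.exp_neg (_ + _), Real.exp_add, Real.exp_log h0, Real.exp_log (by linarith), mul_inv] at this
    calc (n : ℝ) * Real.exp (-(z / 2)) ≤ n * ((n : ℝ)⁻¹ * g⁻¹) := by gcongr
      _ = g⁻¹ := by rw [← mul_assoc, mul_inv_cancel₀ h0.ne', one_mul]
  calc ∑ l ∈ Finset.Icc 2 n, (n.descFactorial l : ℝ) * Real.exp (-(z / 2)) ^ l
      ≤ ∑ l ∈ Finset.Icc 2 n, g⁻¹ ^ l := by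
        refine Finset.sum_le_sum fun l _ => ?_
        refine le_trans ?_ (pow_le_pow_left₀ (by positivity) hx l)
        rw [mul_pow]
        gcongr
        exact_mod_cast Nat.descFactorial_le_pow n l
    _ ≤ g⁻¹ ^ 2 / (1 - g⁻¹) := sum_Icc_pow_le (by positivity) (inv_lt_one_of_one_lt₀ hg1) 2 n
    _ = 1 := by
        have hg0 : g ≠ 0 := by linarith
        have : g - 1 ≠ 0 := by linarith
        rw [div_eq_one_iff_eq]
        · field_simp
          linarith
        · rw [sub_ne_zero]
          intro h1
          rw [eq_comm, inv_eq_one] at h1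
          linarith

/-- With x = n^((1-β)/2) cycles of length l contribute at most x^l. The halved transposition tail
leaves x²/2, and x ≤ 1/3 fits all longer cycles, x³/(1-x), into the other x²/2. -/
lemma HasScoreMoments.maxLikelihood_le_linear (h : HasScoreMoments P M G z) (hn : 2 ≤ n)
    (hU : Fintype.card U = n) (hβ : 1 < β) (hz : (1 + β) * Real.log n ≤ z)
    (hsmall : (n : ℝ) ^ ((1 - β) / 2) ≤ 1 / 3) :
    ExpectedErrorsLE P .maxLikelihood M G ((n : ℝ) ^ (1 - β)) := by
  have hn1 : 1 ≤ n := by lia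
  have h0 : (0 : ℝ) < n := by exact_mod_cast hn1
  have hlog : 0 < Real.log n := Real.log_pos (by exact_mod_cast hn)
  have hz0 : 0 < z := lt_of_lt_of_le (by positivity) hz
  set x : ℝ := (n : ℝ) ^ ((1 - β) / 2) with hx
  have hx0 : 0 < x := Real.rpow_pos_of_pos h0 _
  have hx2 : x ^ 2 = (n : ℝ) ^ (1 - β) := by
    rw [hx, ← Real.rpow_natCast, ← Real.rpow_mul h0.le]
    congr 1
    push_cast
    ring
  have hle : (n : ℝ) * Real.exp (-(z / 2)) ≤ x := by
    have := mul_exp_neg_le_rpow hn1 hz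
    convert this using 2
    ring
  refine h.maxLikelihood_le_sum_swap hz0 hU ?_
  have h2 : (n : ℝ) ^ 2 * (Real.exp (-z) / 2) ≤ x ^ 2 / 2 := by
    have := pow_le_pow_left₀ (by positivity) hle 2
    rw [mul_pow, ← Real.exp_nat_mul] at this
    have e : ((2 : ℕ) : ℝ) * -(z / 2) = -z := by push_cast; ring
    rw [e] at this
    linarith
  have h3 : ∑ l ∈ Finset.Icc 3 n, (n : ℝ) ^ l * Real.exp (-(z / 2)) ^ l ≤ x ^ 2 / 2 := by
    calc ∑ l ∈ Finset.Icc 3 n, (n : ℝ) ^ l * Real.exp (-(z / 2)) ^ l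
        ≤ ∑ l ∈ Finset.Icc 3 n, x ^ l := by
          refine Finset.sum_le_sum fun l _ => ?_
          rw [← mul_pow]
          exact pow_le_pow_left₀ (by positivity) hle l
      _ ≤ x ^ 3 / (1 - x) := sum_Icc_pow_le hx0.le (by linarith) 3 n
      _ ≤ x ^ 2 / 2 := by
          rw [div_le_div_iff₀ (by linarith) two_pos]
          nlinarith [sq_nonneg x, mul_pos hx0 hx0]
  rw [← hx2]
  linarith

end Cycles

/-! ### Maximum likelihood estimation: sums over sets of misaligned users -/

lemma mul_log_sub_one_le_log_factorial {k : ℕ} (hk : 1 ≤ k) :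
    k * (Real.log k - 1) ≤ Real.log k.factorial := by
  have h0 : (0 : ℝ) < k := by exact_mod_cast hk
  have hf : (0 : ℝ) < k.factorial := by exact_mod_cast k.factorial_pos
  have h := Real.pow_div_factorial_le_exp (k : ℝ) h0.le k
  have := Real.log_le_log (by positivity) h
  rw [Real.log_div (by positivity) hf.ne', Real.log_pow, Real.log_exp] at this
  linarith

/-- From C(n,k) ≤ n^k/k! and the k!^r of the geometric mean there remains k!^(-(1-r)), which k! ≥
(k/e)^k makes explicit. This negative power of k makes large supports unlikely when r < 1. -/
lemma choose_mul_geometric_mean_le {n k : ℕ} (hn : 1 ≤ n) (hk : 1 ≤ k) {r : ℝ}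
    (hr1 : r ≤ 1) (D : ℝ≥0∞) (α γ : ℝ) :
    (n.choose k : ℝ≥0∞) *
        (D * ((eexp α ^ k) ^ (1 - r) * ((k.factorial : ℝ≥0∞) * eexp γ ^ k) ^ r)) ≤
      D * eexp (k * (Real.log n - (1 - r) * (Real.log k - 1) + ((1 - r) * α + r * γ))) := by
  have hn0 : (0 : ℝ) < n := by exact_mod_cast hn
  have hf : (0 : ℝ) < k.factorial := by exact_mod_cast k.factorial_pos
  have hc : (n.choose k : ℝ≥0∞) ≤ eexp (k * Real.log n - Real.log k.factorial) := by
    rw [eexp, Real.exp_sub, Real.exp_log hf, Real.exp_nat_mul, Real.exp_log hn0,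
      ← ENNReal.ofReal_natCast]
    exact ENNReal.ofReal_le_ofReal (Nat.choose_le_pow_div k n)
  rw [natCast_eq_eexp k.factorial_pos, eexp_pow, eexp_pow, ← eexp_add, eexp_rpow, eexp_rpow,
    ← eexp_add]
  calc _ ≤ eexp (k * Real.log n - Real.log k.factorial) * (D * eexp (k * α * (1 - r) +
        (Real.log k.factorial + k * γ) * r)) := by gcongr
    _ = D * eexp (k * Real.log n - Real.log k.factorial + (k * α * (1 - r) +
        (Real.log k.factorial + k * γ) * r)) := by rw [eexp_add (_ - _) _, mul_left_comm]
    _ ≤ _ := by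
        gcongr
        apply eexp_mono
        have := mul_le_mul_of_nonneg_left (mul_log_sub_one_le_log_factorial hk)
          (sub_nonneg.2 hr1)
        nlinarith

/-- The parameters of the elliptic boundary. -/
lemma elliptic_params {β : ℝ} (hβ : 0 < β) (hβ2 : β < 1 / 2) :
    ∃ r θ : ℝ, 0 < r ∧ r < 1 ∧ 0 < θ ∧ θ ≤ 1 / 2 ∧ r * (1 - θ) = θ ∧
      θ ^ 2 * (1 + 2 * Real.sqrt (β * (1 - β))) = β ∧
      (∀ ε, θ * (1 - θ) * ((1 - r) + 2 * r * (1 - ε)) * (1 + 2 * Real.sqrt (β * (1 - β))) =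
        1 - (1 - β) * (1 - r) - 2 * β * ε) := by
  set p := Real.sqrt β with hp
  set q := Real.sqrt (1 - β) with hq
  have hp2 : p ^ 2 = β := Real.sq_sqrt hβ.le
  have hq2 : q ^ 2 = 1 - β := Real.sq_sqrt (by linarith)
  have hp0 : 0 < p := Real.sqrt_pos.2 hβ
  have hpq : p < q := Real.sqrt_lt_sqrt hβ.le (by linarith)
  have hq0 : 0 < q := hp0.trans hpq
  have hc : 1 + 2 * Real.sqrt (β * (1 - β)) = (p + q) ^ 2 := by
    rw [Real.sqrt_mul hβ.le, ← hp, ← hq]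
    linear_combination -hp2 - hq2
  have hs : 0 < p + q := by linarith
  have h1 : 1 - p / (p + q) = q / (p + q) := by field_simp; ring
  -- The elliptic constant is (p+q)² with p² = β and q² = 1-β. The condition β < 1/2 gives r = p/q <
  -- 1.
  refine ⟨p / q, p / (p + q), by positivity, (div_lt_one hq0).2 hpq, by positivity, ?_, ?_, ?_, ?_⟩
  · rw [div_le_div_iff₀ hs two_pos]; linarith
  · rw [h1]; field_simp
  · rw [hc, ← hp2]; field_simp
  · intro ε
    have hβ' : β = p ^ 2 := hp2.symm
    have h1q : 1 = p ^ 2 + q ^ 2 := by linarith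
    rw [hc, h1, ← hq2]
    have e1 : p / (p + q) * (q / (p + q)) * (1 - p / q + 2 * (p / q) * (1 - ε)) * (p + q) ^ 2 =
        p * q + p ^ 2 - 2 * p ^ 2 * ε := by field_simp; ring
    have e2 : q ^ 2 * (1 - p / q) = q ^ 2 - p * q := by field_simp
    rw [e1, e2, hβ']
    linarith

section Elliptic

variable {U : Type*} {V : Type*} [Fintype U] [Fintype V] [DecidableEq V] [DecidableEq U]
  {Ω : Type*} [MeasurableSpace Ω] {P : Measure Ω} {M : U ≃ V} {G : Ω → Matrix U V ℝ} {z : ℝ}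
  {n : ℕ} {β : ℝ}

/-- Supports of size at most X are charged X; beyond X the term for each size k is at most
exp(-(1-r)X), and there are at most n sizes. The loss ε only moves the exponent of X, which suffices
for an o(1) there. -/
lemma HasScoreMoments.maxLikelihood_le_elliptic [IsProbabilityMeasure P]
    (h : HasScoreMoments P M G z) (hn : 1 ≤ n)
    (hU : Fintype.card U = n) {r θ ε c : ℝ} (hr0 : 0 < r) (hr1 : r < 1) (hθ0 : 0 ≤ θ)
    (hθ1 : θ ≤ 1) (hθ : r * (1 - θ) = θ) (hε1 : ε ≤ 1)
    (hc : θ * (1 - θ) * ((1 - r) + 2 * r * (1 - ε)) * c = 1 - (1 - β) * (1 - r) - 2 * β * ε)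
    (hF : PairMoment P M G θ ((1 - ε) * z)) (hz : c * Real.log n ≤ z) :
    ExpectedErrorsLE P .maxLikelihood M G
      (Real.exp 2 * (n : ℝ) ^ (1 - β + 2 * β * ε / (1 - r)) +
        n * (n * Real.exp (-((1 - r) * (Real.exp 2 *
          (n : ℝ) ^ (1 - β + 2 * β * ε / (1 - r))))))) := by
  intro τ m _ _ hm
  have hn0 : (0 : ℝ) < n := by exact_mod_cast hn
  have hr : 0 < 1 - r := by linarith
  -- X is chosen so that (1-r)·log X cancels the remaining multiple of log n. Of the factor e², one
  -- e compensates Stirling's k/e and the other leaves the decay exp(-(1-r)k).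
  set X : ℝ := Real.exp 2 * (n : ℝ) ^ (1 - β + 2 * β * ε / (1 - r)) with hX
  have hX0 : 0 < X := by positivity
  have hlogX : Real.log X = 2 + (1 - β + 2 * β * ε / (1 - r)) * Real.log n := by
    rw [hX, Real.log_mul (Real.exp_ne_zero _) (by positivity), Real.log_exp, Real.log_rpow hn0]
  have key := lintegral_maxLikelihood_errors_le_sum_supports (P := P) (M := M) (G := G) (τ := τ)
    (m := m) hU h.measurable hr0 hr1.le hθ hθ0 ⌊X⌋₊
    (fun _ _ => 1) (fun _ => aemeasurable_const) (fun _ _ => ENNReal.one_ne_top) ∅ (by simp) 1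
    (eexp (-(θ * (1 - θ) * z))) (eexp (-(2 * θ * (1 - θ) * ((1 - ε) * z)))) (fun _ _ _ => by simp)
    (fun S => by simpa using h.trueMoment θ hθ0 hθ1 S)
    (fun σ => by simpa using hF σ σ.support (Finset.Subset.refl _)) hm
  refine key.trans ?_
  rw [measure_empty, zero_add]
  have hterm : ∀ k ∈ Finset.Ioc ⌊X⌋₊ n, (n.choose k : ℝ≥0∞) *
      (1 * ((eexp (-(θ * (1 - θ) * z)) ^ k) ^ (1 - r) *
        ((k.factorial : ℝ≥0∞) * eexp (-(2 * θ * (1 - θ) * ((1 - ε) * z))) ^ k) ^ r)) ≤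
      eexp (-((1 - r) * X)) := by
    intro k hk
    rw [Finset.mem_Ioc] at hk
    have hk1 : 1 ≤ k := by lia
    have hkX : X < k := (Nat.floor_lt hX0.le).1 hk.1
    refine (choose_mul_geometric_mean_le hn hk1 hr1.le 1 _ _).trans ?_
    rw [one_mul]
    apply eexp_mono
    have hlogk : Real.log X ≤ Real.log k := Real.log_le_log hX0 hkX.le
    have hnn : 0 ≤ θ * (1 - θ) * ((1 - r) + 2 * r * (1 - ε)) := by
      have : 0 ≤ r * (1 - ε) := mul_nonneg hr0.le (by linarith)
      exact mul_nonneg (mul_nonneg hθ0 (by linarith)) (by linarith)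
    have h1 := mul_le_mul_of_nonneg_left hz hnn
    rw [← mul_assoc, hc] at h1
    have h2 : Real.log n - (1 - r) * (Real.log k - 1) +
        ((1 - r) * -(θ * (1 - θ) * z) + r * -(2 * θ * (1 - θ) * ((1 - ε) * z))) ≤ -(1 - r) := by
      have h3 := mul_le_mul_of_nonneg_left hlogk hr.le
      rw [hlogX] at h3
      have h4 : (1 - r) * (2 + (1 - β + 2 * β * ε / (1 - r)) * Real.log n) =
          2 * (1 - r) + (1 - β) * (1 - r) * Real.log n + 2 * β * ε * Real.log n := by
        field_simp
        ring
      rw [h4] at h3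
      linarith
    calc (k : ℝ) * _ ≤ k * (-(1 - r)) := by gcongr
      _ ≤ -((1 - r) * X) := by nlinarith
  calc (⌊X⌋₊ : ℝ≥0∞) + n * ∑ k ∈ Finset.Ioc ⌊X⌋₊ n, _
      ≤ ENNReal.ofReal X + n * (n * eexp (-((1 - r) * X))) := by
        gcongr
        · rw [← ENNReal.ofReal_natCast]
          exact ENNReal.ofReal_le_ofReal (Nat.floor_le hX0.le)
        · refine (Finset.sum_le_sum hterm).trans ?_
          rw [Finset.sum_const, nsmul_eq_mul, Nat.card_Ioc]
          gcongr
          exact Nat.sub_le _ _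
    _ = ENNReal.ofReal (X + n * (n * Real.exp (-((1 - r) * X)))) := by
        rw [ENNReal.ofReal_add hX0.le (by positivity), ENNReal.ofReal_mul hn0.le,
          ENNReal.ofReal_mul hn0.le, ENNReal.ofReal_natCast, eexp]

end Elliptic

/-! ### Planted matching on the elliptic boundary -/

/-- The budget per misaligned user in the planted elliptic case: log(3/5) is the mean weight, 1 -
log(19/10) comes from Stirling at k > 1.9 N, and log 20/38 is the share per user of the price
20^(N/20). Multiplied by 38 the claim reads e^40·20 ≤ (19/6)^38. -/
lemma elliptic_numerics :
    Real.log (3 / 5) + (1 - Real.log (19 / 10)) + Real.log 20 / 38 ≤ -(1 / 19) := by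
  have h1 : Real.exp 40 * 20 ≤ (19 / 6 : ℝ) ^ 38 := by
    have he : Real.exp 40 = Real.exp 1 ^ 40 := by rw [← Real.exp_nat_mul]; norm_num
    have h2 : Real.exp 1 ^ 40 ≤ (2.7182818286 : ℝ) ^ 40 :=
      pow_le_pow_left₀ (Real.exp_pos 1).le Real.exp_one_lt_d9.le 40
    rw [he]
    calc Real.exp 1 ^ 40 * 20 ≤ (2.7182818286 : ℝ) ^ 40 * 20 := by gcongr
      _ ≤ (19 / 6 : ℝ) ^ 38 := by norm_num
  have h2 := Real.log_le_log (by positivity) h1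
  rw [Real.log_mul (Real.exp_ne_zero _) (by norm_num), Real.log_exp, Real.log_pow] at h2
  have h3 : Real.log (19 / 6) = Real.log (19 / 10) - Real.log (3 / 5) := by
    rw [← Real.log_div (by norm_num) (by norm_num)]
    norm_num
  rw [h3] at h2
  push_cast at h2
  linarith

lemma gaussianReal_Iio_le (μ a l : ℝ) (hl : 0 ≤ l) (ha : a = μ - l) :
    gaussianReal μ 1 (Set.Iio a) ≤ eexp (-(l ^ 2 / 2)) := by
  calc gaussianReal μ 1 (Set.Iio a)
      = ∫⁻ x, (Set.Iio a).indicator (fun _ => 1) x ∂gaussianReal μ 1 := by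
        rw [lintegral_indicator measurableSet_Iio]; simp
    _ ≤ ∫⁻ x, eexp (l * a) * eexp (-l * x) ∂gaussianReal μ 1 := by
        refine lintegral_mono fun x => ?_
        by_cases hx : x ∈ Set.Iio a
        · rw [Set.indicator_of_mem hx, ← eexp_add]
          apply one_le_eexp
          have : x < a := hx
          nlinarith
        · rw [Set.indicator_of_notMem hx]; exact zero_le
    _ = eexp (-(l ^ 2 / 2)) := by
        rw [lintegral_const_mul _ (by fun_prop), lintegral_eexp_linear_gaussianReal, ← eexp_add, ha]
        congr 1
        push_cast
        ring

/-- The weight of a user whose true score is `x`: small below the level `a`. -/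
noncomputable def levelWeight (a x : ℝ) : ℝ≥0∞ := if x < a then 1 / 20 else 1

lemma measurable_levelWeight (a : ℝ) : Measurable (levelWeight a) := by
  unfold levelWeight
  exact Measurable.ite measurableSet_Iio measurable_const measurable_const

/-- The level lies 1/20 below the mean, so the average is at most 1/20 + (1/2 + 1/20) = 3/5. -/
lemma lintegral_levelWeight_le (a m : ℝ) (ha : a = m - 1 / 20) :
    ∫⁻ x, levelWeight a x ∂gaussianReal m 1 ≤ eexp (Real.log (3 / 5)) := by
  have hle : ∀ x, levelWeight a x ≤ 1 / 20 + (Set.Ici a).indicator (fun _ => 1) x := by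
    intro x
    unfold levelWeight
    split_ifs with hx
    · exact le_self_add
    · rw [Set.indicator_of_mem (show x ∈ Set.Ici a from not_lt.1 hx)]
      exact le_add_self
  refine (lintegral_mono hle).trans ?_
  rw [lintegral_add_left measurable_const, lintegral_indicator measurableSet_Ici]
  have hshift : gaussianReal m 1 (Set.Ici a) = gaussianReal 0 1 (Set.Ici (-(1 / 20))) := by
    have h1 := gaussianReal_map_add_const (μ := 0) (v := 1) m
    rw [zero_add] at h1
    rw [← h1, Measure.map_apply (by fun_prop) measurableSet_Ici]
    congr 1
    ext x
    simp only [Set.mem_preimage, Set.mem_Ici, ha]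
    constructor <;> intro h <;> linarith
  simp only [lintegral_const, measure_univ, mul_one, Measure.restrict_apply, MeasurableSet.univ,
    Set.univ_inter, one_mul, hshift]
  refine (add_le_add_right (gaussianReal_Ici_neg_le _) _).trans ?_
  have e1 : (1 / 20 : ℝ≥0∞) = ENNReal.ofReal (1 / 20) := by
    rw [ENNReal.ofReal_div_of_pos (by norm_num)]; simp
  have e2 : (1 / 2 : ℝ≥0∞) = ENNReal.ofReal (1 / 2) := by
    rw [ENNReal.ofReal_div_of_pos (by norm_num)]; simp
  rw [e1, e2, ← ENNReal.ofReal_add (by norm_num) (by norm_num),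
    ← ENNReal.ofReal_add (by norm_num) (by norm_num), eexp, Real.exp_log (by norm_num)]
  apply ENNReal.ofReal_le_ofReal
  norm_num

section PlantedElliptic

variable {U : Type*} {V : Type*} [Fintype U] [Fintype V] [DecidableEq V] [DecidableEq U]
  {Ω : Type*} [MeasurableSpace Ω] {P : Measure Ω} {M : U ≃ V} {μ : ℝ} {W : U → V → Ω → ℝ}
  {n : ℕ} {β : ℝ}

/-- The number of users whose true score is below the level `a`. -/
noncomputable def lowCount (M : U ≃ V) (W : U → V → Ω → ℝ) (a : ℝ) (S : Finset U) (ω : Ω) : ℕ :=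
  (S.filter fun u => W u (M u) ω < a).card

lemma prod_levelWeight (a : ℝ) (S : Finset U) (ω : Ω) :
    ∏ u ∈ S, levelWeight a (W u (M u) ω) = eexp (-(Real.log 20 * lowCount M W a S ω)) := by
  simp only [levelWeight]
  rw [Finset.prod_ite, Finset.prod_const, Finset.prod_const_one, mul_one, lowCount]
  have : (1 / 20 : ℝ≥0∞) = eexp (-Real.log 20) := by
    rw [eexp, Real.exp_neg, Real.exp_log (by norm_num), ENNReal.ofReal_inv_of_pos (by norm_num)]
    simp
  rw [this, eexp_pow]
  congr 1
  ring

/-- The number of low true scores is rarely larger than a given fraction of `n`. -/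
lemma IsPlantedMatching.measure_lowCount_le (h : IsPlantedMatching P M μ W)
    (hU : Fintype.card U = n) {l : ℝ} (hl : 0 ≤ l) (x : ℝ) :
    P {ω | x < lowCount M W (μ - l) Finset.univ ω} ≤
      eexp (2 * n * Real.exp (-(l ^ 2 / 2)) - x) := by
  set a := μ - l with ha
  -- Markov's inequality for exp(count): by independence each user contributes a factor 1 +
  -- (e-1)P(low), at most 1 + 2P(low).
  set φ : ℝ → ℝ≥0∞ := fun y => if y < a then eexp 1 else 1 with hφ
  have hφm : Measurable φ := Measurable.ite measurableSet_Iio measurable_const measurable_const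
  have hprod : ∀ ω, ∏ u, φ (W u (M u) ω) = eexp (lowCount M W a Finset.univ ω) := by
    intro ω
    simp only [hφ]
    rw [Finset.prod_ite, Finset.prod_const, Finset.prod_const_one, mul_one, lowCount, eexp_pow,
      mul_one]
  have hint : ∫⁻ y, φ y ∂gaussianReal μ 1 ≤ eexp (2 * Real.exp (-(l ^ 2 / 2))) := by
    have hle : ∀ y, φ y ≤ 1 + (Set.Iio a).indicator (fun _ => 2) y := by
      intro y
      simp only [hφ]
      split_ifs with hy
      · rw [Set.indicator_of_mem (show y ∈ Set.Iio a from hy), eexp]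
        have : Real.exp 1 ≤ 3 := by linarith [Real.exp_one_lt_d9]
        refine (ENNReal.ofReal_le_ofReal this).trans (le_of_eq ?_)
        norm_num
      · exact le_self_add
    refine (lintegral_mono hle).trans ?_
    rw [lintegral_add_left measurable_const, lintegral_indicator measurableSet_Iio]
    simp only [lintegral_const, measure_univ, mul_one, Measure.restrict_apply, MeasurableSet.univ,
      Set.univ_inter]
    calc 1 + 2 * gaussianReal μ 1 (Set.Iio a) ≤ 1 + 2 * eexp (-(l ^ 2 / 2)) := by
          gcongr
          exact gaussianReal_Iio_le μ a l hl ha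
      _ = ENNReal.ofReal (1 + 2 * Real.exp (-(l ^ 2 / 2))) := by
          rw [ENNReal.ofReal_add one_pos.le (by positivity), ENNReal.ofReal_mul zero_le_two, eexp]
          simp
      _ ≤ eexp (2 * Real.exp (-(l ^ 2 / 2))) := by
          apply ENNReal.ofReal_le_ofReal
          linarith [Real.add_one_le_exp (2 * Real.exp (-(l ^ 2 / 2)))]
  have hmean : ∫⁻ ω, eexp (lowCount M W a Finset.univ ω) ∂P ≤
      eexp (2 * n * Real.exp (-(l ^ 2 / 2))) := by
    simp only [← hprod]
    rw [h.lintegral_prod_true Finset.univ φ hφm, Finset.card_univ, hU]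
    refine (pow_le_pow_left₀ zero_le hint n).trans (le_of_eq ?_)
    rw [eexp_pow]
    congr 1
    ring
  have hmeas : AEMeasurable (fun ω => eexp (lowCount M W a Finset.univ ω)) P := by
    simp only [← hprod]
    exact Finset.aemeasurable_fun_prod _ fun u _ =>
      hφm.comp_aemeasurable (h.law u (M u)).aemeasurable
  have hmark := mul_meas_ge_le_lintegral₀ hmeas (eexp x)
  have hsub : {ω | x < lowCount M W a Finset.univ ω} ⊆
      {ω | eexp x ≤ eexp (lowCount M W a Finset.univ ω)} := fun ω hω => eexp_mono (le_of_lt hω)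
  have h1 : eexp x * P {ω | x < lowCount M W a Finset.univ ω} ≤
      eexp (2 * n * Real.exp (-(l ^ 2 / 2))) :=
    (mul_le_mul_right (measure_mono hsub) _).trans (hmark.trans hmean)
  calc P {ω | x < lowCount M W a Finset.univ ω}
      = eexp (-x) * (eexp x * P {ω | x < lowCount M W a Finset.univ ω}) := by
        rw [← mul_assoc, ← eexp_add]; simp [eexp_zero]
    _ ≤ eexp (-x) * eexp (2 * n * Real.exp (-(l ^ 2 / 2))) := by gcongr
    _ = _ := by rw [← eexp_add]; congr 1; ring

lemma IsPlantedMatching.aemeasurable_lowCount (h : IsPlantedMatching P M μ W) (a : ℝ) :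
    AEMeasurable (fun ω => (lowCount M W a Finset.univ ω : ℝ)) P := by
  simp only [lowCount, Finset.card_filter, Nat.cast_sum]
  refine Finset.aemeasurable_fun_sum _ fun u _ => ?_
  have : Measurable fun y : ℝ => ((if y < a then 1 else 0 : ℕ) : ℝ) :=
    measurable_from_top.comp (Measurable.ite measurableSet_Iio measurable_const measurable_const)
  exact this.comp_aemeasurable (h.law u (M u)).aemeasurable

/-- Tilting by exp(-θG) moves the mean of a true weight from μ to (1-θ)μ, so a large misaligned set
needs many atypically low true scores. With N = n^(1-β), more than N/20 users below a level just
under (1-θ)μ is a rare bad event. Off it, the product of level weights is at least 20^(-N/20), while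
every misaligned user contributes a factor at most 3/5 to the moments. This replaces the constant e²
of the general argument by 19/10. -/
lemma IsPlantedMatching.maxLikelihood_le_elliptic [IsProbabilityMeasure P]
    (h : IsPlantedMatching P M μ W) (hμ : 0 < μ) (hn : 1 ≤ n) (hU : Fintype.card U = n)
    {r θ c : ℝ} (hr0 : 0 < r) (hr1 : r < 1) (hθ0 : 0 ≤ θ) (hθ1 : θ ≤ 1)
    (hθ : r * (1 - θ) = θ) (hc1 : 1 ≤ c) (hcβ : θ ^ 2 * c = β)
    (hc : θ * (1 - θ) * (1 + r) * c = 1 - (1 - β) * (1 - r))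
    (hz : c * Real.log n ≤ μ ^ 2 / 2)
    (hs : Real.exp (-(θ / 20 * Real.sqrt (2 * Real.log n))) ≤ 1 / 80) :
    ExpectedErrorsLE P .maxLikelihood M (plantedScore μ W)
      (19 / 10 * (n : ℝ) ^ (1 - β) + n * (Real.exp (-((n : ℝ) ^ (1 - β) / 40)) +
        n * Real.exp (-((n : ℝ) ^ (1 - β) / 19)))) := by
  intro τ m _ _ hm
  have hn0 : (0 : ℝ) < n := by exact_mod_cast hn
  have hL : 0 ≤ Real.log n := Real.log_nonneg (by exact_mod_cast hn)
  have hr : 0 < 1 - r := by linarith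
  set N : ℝ := (n : ℝ) ^ (1 - β) with hN
  have hN0 : 0 < N := by positivity
  have hlogN : Real.log N = (1 - β) * Real.log n := Real.log_rpow hn0 _
  have h20 : 0 < Real.log 20 := Real.log_pos (by norm_num)
  -- With this l the level μ - l is the tilted mean (1-θ)μ lowered by 1/20. The surplus 1/20 also
  -- makes the expected number of low scores o(N) rather than of order N.
  set l : ℝ := θ * μ + 1 / 20 with hl
  have hl0 : 0 ≤ l := by positivity
  have hlevel : μ - l = (1 - θ) * μ - 1 / 20 := by rw [hl]; ring
  set bad : Set Ω := {ω | N / 20 < lowCount M W (μ - l) Finset.univ ω} with hbad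
  have hbadm : NullMeasurableSet bad P :=
    nullMeasurableSet_lt aemeasurable_const (h.aemeasurable_lowCount _)
  have hw := lintegral_levelWeight_le (μ - l) ((1 - θ) * μ) hlevel
  have hwm := measurable_levelWeight (μ - l)
  have key := lintegral_maxLikelihood_errors_le_sum_supports (P := P) (M := M)
    (G := plantedScore μ W) (τ := τ) (m := m) hU h.scoreMeasurable hr0 hr1.le hθ hθ0
    ⌊19 / 10 * N⌋₊ (fun S ω => ∏ u ∈ S, levelWeight (μ - l) (W u (M u) ω))
    (fun S => Finset.aemeasurable_fun_prod _ fun u _ =>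
      hwm.comp_aemeasurable (h.law u (M u)).aemeasurable)
    (fun S ω => by rw [prod_levelWeight]; exact eexp_ne_top _) bad hbadm
    (eexp (Real.log 20 * (N / 20)))
    (eexp (Real.log (3 / 5) - θ * (1 - θ) * (μ ^ 2 / 2)))
    (eexp (Real.log (3 / 5) - 2 * θ * (1 - θ) * (μ ^ 2 / 2))) ?_ ?_ ?_ hm
  rotate_left
  · intro ω hω S
    rw [prod_levelWeight, ← eexp_add]
    apply one_le_eexp
    have h1 : (lowCount M W (μ - l) Finset.univ ω : ℝ) ≤ N / 20 := not_lt.1 hω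
    have h2 : (lowCount M W (μ - l) S ω : ℝ) ≤ lowCount M W (μ - l) Finset.univ ω := by
      exact_mod_cast Finset.card_le_card (Finset.filter_subset_filter _ (Finset.subset_univ S))
    have := mul_le_mul_of_nonneg_left (h2.trans h1) h20.le
    linarith
  · intro S
    rw [h.lintegral_weight_true θ _ hwm S]
    refine pow_le_pow_left₀ zero_le ?_ _
    rw [sub_eq_neg_add (Real.log _), eexp_add]
    gcongr
  · intro σ
    rw [h.lintegral_weight_pair θ _ hwm σ σ.support (Finset.Subset.refl _)]
    refine pow_le_pow_left₀ zero_le ?_ _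
    rw [sub_eq_neg_add (Real.log _), eexp_add]
    gcongr
  refine key.trans ?_
  have hPbad : P bad ≤ eexp (-(N / 40)) := by
    refine (h.measure_lowCount_le hU hl0 (N / 20)).trans (eexp_mono ?_)
    have hμL : Real.sqrt (2 * Real.log n) ≤ μ := by
      rw [Real.sqrt_le_left hμ.le]
      nlinarith
    -- The square of θμ supplies θ²μ²/2 ≥ θ²c·log n = β·log n, and the cross term θμ/20 supplies the
    -- rest.
    have h1 : β * Real.log n + θ / 20 * Real.sqrt (2 * Real.log n) ≤ l ^ 2 / 2 := by
      have h2 := mul_le_mul_of_nonneg_left hz (sq_nonneg θ)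
      rw [← mul_assoc, hcβ] at h2
      have h3 := mul_le_mul_of_nonneg_left hμL (by positivity : 0 ≤ θ / 20)
      rw [hl]
      nlinarith
    have h4 : (n : ℝ) * Real.exp (-(l ^ 2 / 2)) ≤ N / 80 := by
      calc (n : ℝ) * Real.exp (-(l ^ 2 / 2))
          ≤ n * Real.exp (-(β * Real.log n) + -(θ / 20 * Real.sqrt (2 * Real.log n))) := by
            gcongr
            linarith
        _ = N * Real.exp (-(θ / 20 * Real.sqrt (2 * Real.log n))) := by
            rw [Real.exp_add, ← mul_assoc, hN, Real.rpow_def_of_pos hn0]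
            congr 1
            nth_rewrite 1 [← Real.exp_log hn0]
            rw [← Real.exp_add]
            congr 1
            ring
        _ ≤ N * (1 / 80) := by gcongr
        _ = N / 80 := by ring
    linarith
  have hterm : ∀ k ∈ Finset.Ioc ⌊19 / 10 * N⌋₊ n, (n.choose k : ℝ≥0∞) *
      (eexp (Real.log 20 * (N / 20)) *
        ((eexp (Real.log (3 / 5) - θ * (1 - θ) * (μ ^ 2 / 2)) ^ k) ^ (1 - r) *
        ((k.factorial : ℝ≥0∞) *
          eexp (Real.log (3 / 5) - 2 * θ * (1 - θ) * (μ ^ 2 / 2)) ^ k) ^ r)) ≤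
      eexp (-(N / 19)) := by
    intro k hk
    rw [Finset.mem_Ioc] at hk
    have hk1 : 1 ≤ k := by lia
    have hkN : 19 / 10 * N < k := (Nat.floor_lt (by positivity)).1 hk.1
    refine (choose_mul_geometric_mean_le hn hk1 hr1.le _ _ _).trans ?_
    rw [← eexp_add]
    apply eexp_mono
    have hlogk : Real.log (19 / 10) + (1 - β) * Real.log n ≤ Real.log k := by
      rw [← hlogN, ← Real.log_mul (by norm_num) hN0.ne']
      exact Real.log_le_log (by positivity) hkN.le
    have hnn : 0 ≤ θ * (1 - θ) * (1 + r) :=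
      mul_nonneg (mul_nonneg hθ0 (by linarith)) (by linarith)
    have h1 := mul_le_mul_of_nonneg_left hz hnn
    rw [← mul_assoc, hc] at h1
    have hκ : 0 ≤ 1 - Real.log (19 / 10) := by
      have := Real.log_le_sub_one_of_pos (x := 19 / 10) (by norm_num)
      linarith
    have h2 : Real.log n - (1 - r) * (Real.log k - 1) +
        ((1 - r) * (Real.log (3 / 5) - θ * (1 - θ) * (μ ^ 2 / 2)) +
          r * (Real.log (3 / 5) - 2 * θ * (1 - θ) * (μ ^ 2 / 2))) ≤
        Real.log (3 / 5) + (1 - Real.log (19 / 10)) := by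
      have h3 := mul_le_mul_of_nonneg_left hlogk hr.le
      have h4 := mul_nonneg hr0.le hκ
      nlinarith
    have h5 := elliptic_numerics
    have hk0 : (0 : ℝ) < k := by exact_mod_cast hk1
    -- As k > 1.9 N, the price 20^(N/20) is at most 20^(k/38).
    have h6 : Real.log 20 * (N / 20) ≤ k * (Real.log 20 / 38) := by
      have := mul_le_mul_of_nonneg_left hkN.le h20.le
      linarith
    calc Real.log 20 * (N / 20) + k * _
        ≤ k * (Real.log 20 / 38) + k * (Real.log (3 / 5) + (1 - Real.log (19 / 10))) := by
          gcongr
      _ = k * (Real.log (3 / 5) + (1 - Real.log (19 / 10)) + Real.log 20 / 38) := by ring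
      _ ≤ k * (-(1 / 19)) := by gcongr
      _ ≤ -(N / 19) := by linarith
  calc (⌊19 / 10 * N⌋₊ : ℝ≥0∞) + n * (P bad + ∑ k ∈ Finset.Ioc ⌊19 / 10 * N⌋₊ n, _)
      ≤ ENNReal.ofReal (19 / 10 * N) + n * (eexp (-(N / 40)) + n * eexp (-(N / 19))) := by
        gcongr
        · rw [← ENNReal.ofReal_natCast]
          exact ENNReal.ofReal_le_ofReal (Nat.floor_le (by positivity))
        · refine (Finset.sum_le_sum hterm).trans ?_
          rw [Finset.sum_const, nsmul_eq_mul, Nat.card_Ioc]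
          gcongr
          exact Nat.sub_le _ _
    _ = ENNReal.ofReal (19 / 10 * N + n * (Real.exp (-(N / 40)) +
        n * Real.exp (-(N / 19)))) := by
        rw [ENNReal.ofReal_add (by positivity) (by positivity), ENNReal.ofReal_mul hn0.le,
          ENNReal.ofReal_add (by positivity) (by positivity), ENNReal.ofReal_mul hn0.le,
          ENNReal.ofReal_natCast, eexp, eexp]

end PlantedElliptic

/-! ### Asymptotics -/

/-- Bounds that hold eventually for every positive exponent hold with a vanishing exponent. -/
lemma exists_tendsto_zero {Q : ℕ → ℝ → Prop} (hmono : ∀ n, 1 ≤ n → ∀ ε ε', ε ≤ ε' → Q n ε → Q n ε')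
    {b : ℝ} (hb : 0 ≤ b) (htriv : ∀ n, 1 ≤ n → Q n b) (hev : ∀ ε > 0, ∀ᶠ n in atTop, Q n ε) :
    ∃ e : ℕ → ℝ, Tendsto e atTop (𝓝 0) ∧ ∀ n, 1 ≤ n → Q n (e n) := by
  set S : ℕ → Set ℝ := fun n => {ε | 0 ≤ ε ∧ Q n ε} with hS
  have hbdd : ∀ n, BddBelow (S n) := fun n => ⟨0, fun ε hε => hε.1⟩
  have hinv : Tendsto (fun n : ℕ => 1 / ((n : ℝ) + 1)) atTop (𝓝 0) :=
    tendsto_one_div_add_atTop_nhds_zero_nat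
  -- The exponent is the infimum of the admissible ones; 1/(n+1) is added because the infimum need
  -- not be admissible.
  refine ⟨fun n => sInf (S n) + 1 / ((n : ℝ) + 1), ?_, ?_⟩
  · rw [Metric.tendsto_atTop']
    intro δ hδ
    have h1 : ∀ᶠ n : ℕ in atTop, 1 / ((n : ℝ) + 1) < δ / 2 :=
      hinv.eventually_lt_const (by linarith)
    obtain ⟨k, hk⟩ := eventually_atTop.1 (h1.and (hev (δ / 2) (by linarith)))
    refine ⟨k, fun n hn => ?_⟩
    obtain ⟨h2, h3⟩ := hk n hn.le
    have h4 : sInf (S n) ≤ δ / 2 := csInf_le (hbdd n) ⟨by linarith, h3⟩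
    have h5 : 0 ≤ sInf (S n) := Real.sInf_nonneg fun ε hε => hε.1
    have h6 : 0 < 1 / ((n : ℝ) + 1) := by positivity
    rw [Real.dist_eq, sub_zero, abs_of_pos (by linarith)]
    linarith
  · intro n hn
    have hne : (S n).Nonempty := ⟨b, hb, htriv n hn⟩
    have h6 : 0 < 1 / ((n : ℝ) + 1) := by positivity
    obtain ⟨ε, hε, hlt⟩ := exists_lt_of_csInf_lt hne (lt_add_of_pos_right (sInf (S n)) h6)
    exact hmono n hn ε _ hlt.le hε.2

lemma tendsto_sq_mul_exp_neg_sqrt {a : ℝ} (ha : 0 < a) :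
    Tendsto (fun n : ℕ => (n : ℝ) ^ 2 * Real.exp (-(a * Real.sqrt n))) atTop (𝓝 0) := by
  have h1 : Tendsto (fun n : ℕ => Real.sqrt n) atTop atTop :=
    Real.tendsto_sqrt_atTop.comp tendsto_natCast_atTop_atTop
  have h2 := (Real.tendsto_pow_mul_exp_neg_atTop_nhds_zero 4).comp (h1.const_mul_atTop ha)
  have h3 := h2.const_mul ((a ^ 4)⁻¹)
  rw [mul_zero] at h3
  refine h3.congr fun n => ?_
  have hs : Real.sqrt n ^ 2 = n := Real.sq_sqrt (by positivity)
  simp only [Function.comp_apply]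
  rw [mul_pow, ← mul_assoc, ← mul_assoc, inv_mul_cancel₀ (by positivity), one_mul]
  have h4 : Real.sqrt n ^ 4 = (n : ℝ) ^ 2 := by
    calc Real.sqrt n ^ 4 = (Real.sqrt n ^ 2) ^ 2 := by ring
      _ = _ := by rw [hs]
  rw [h4]

lemma sqrt_le_rpow {n : ℕ} (hn : 1 ≤ n) {a : ℝ} (ha : 1 / 2 ≤ a) : Real.sqrt n ≤ (n : ℝ) ^ a := by
  rw [Real.sqrt_eq_rpow]
  exact Real.rpow_le_rpow_of_exponent_le (by exact_mod_cast hn) ha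

lemma eventually_const_le_rpow (c : ℝ) {ε : ℝ} (hε : 0 < ε) :
    ∀ᶠ n : ℕ in atTop, c ≤ (n : ℝ) ^ ε :=
  ((tendsto_rpow_atTop hε).comp tendsto_natCast_atTop_atTop).eventually_ge_atTop c

lemma DatabaseGuarantee.mono {alg : Algorithm} {n : ℕ} {κ : EReal} {z b b' : ℝ}
    (h : DatabaseGuarantee.{u₁, u₂, u₃, u₄, u₅} alg n κ z b) (hb : b ≤ b') :
    DatabaseGuarantee.{u₁, u₂, u₃, u₄, u₅} alg n κ z b' := by
  intro U V _ _ _ Ω _ P _ M Da Db _ _ _ _ s A B hU hd hs hz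
  classical
  exact (h U V Ω P M Da Db s A B hU hd hs hz).mono hb

/-- To have a bound with a vanishing exponent, it is enough to have a bound for every small
relative loss `ε` of the pair moments. -/
lemma exists_exponent_databaseGuarantee {alg : Algorithm}
    (halg : alg = .maxRow ∨ alg = .maxLikelihood) {β : ℝ} (hβ : 0 < β) (z : ℕ → ℝ) (κ : ℕ → EReal)
    (hev : ∀ ε > 0, ∀ᶠ n : ℕ in atTop, DatabaseGuarantee.{u₁, u₂, u₃, u₄, u₅} alg n (κ n) (z n)
      ((n : ℝ) ^ (1 - β + ε))) :
    ∃ e : ℕ → ℝ, Tendsto e atTop (𝓝 0) ∧ ∀ n : ℕ, 1 ≤ n →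
      DatabaseGuarantee.{u₁, u₂, u₃, u₄, u₅} alg n (κ n) (z n) ((n : ℝ) ^ (1 - β + e n)) := by
  refine exists_tendsto_zero (Q := fun n ε => DatabaseGuarantee.{u₁, u₂, u₃, u₄, u₅} alg n (κ n)
    (z n) ((n : ℝ) ^ (1 - β + ε))) ?_ hβ.le ?_ hev
  · intro n hn ε ε' hε h
    exact h.mono (Real.rpow_le_rpow_of_exponent_le (by exact_mod_cast hn) (by linarith))
  · intro n _ U V _ _ _ Ω _ P _ M Da Db _ _ _ _ s A B hU hd hs hz
    classical
    -- The exponent loss β gives the trivial bound n, admissible for every n.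
    rw [sub_add_cancel, Real.rpow_one]
    exact expectedErrorsLE_card halg hU

/-- The pair moments under vanishing correlation. -/
lemma eventually_sq_le {r : ℕ → ℝ} (hr : Tendsto r atTop (𝓝 0)) {c : ℝ} (hc : 0 < c) :
    ∀ᶠ n in atTop, r n ^ 2 ≤ c := by
  have := hr.pow 2
  rw [zero_pow two_ne_zero] at this
  exact this.eventually_le_const hc

lemma databaseGuarantee_maxRow {β : ℝ} (hβ : 0 < β) (hβ1 : β ≤ 1) {κ : ℕ → ℝ}
    (hκ : Tendsto κ atTop (𝓝 0)) :
    ∃ e : ℕ → ℝ, Tendsto e atTop (𝓝 0) ∧ ∀ n : ℕ, 1 ≤ n →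
      DatabaseGuarantee.{u₁, u₂, u₃, u₄, u₅} .maxRow n (κ n)
        ((1 + Real.sqrt β) ^ 2 * Real.log n) ((n : ℝ) ^ (1 - β + e n)) := by
  refine exists_exponent_databaseGuarantee (Or.inl rfl) hβ _ (fun n => (κ n : EReal)) ?_
  intro ε hε
  -- A relative loss δ in the pair moment costs 2βδ in the exponent.
  set δ : ℝ := min 1 (ε / (2 * β)) with hδ
  have hδ0 : 0 < δ := lt_min one_pos (by positivity)
  have hδε : 2 * β * δ ≤ ε := by
    have := min_le_right 1 (ε / (2 * β))
    rw [← hδ, le_div_iff₀ (by positivity)] at this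
    linarith
  have hr0 : 0 < Real.sqrt β := Real.sqrt_pos.2 hβ
  have hr1 : Real.sqrt β ≤ 1 := Real.sqrt_le_one.2 hβ1
  set θ : ℝ := Real.sqrt β / (1 + Real.sqrt β) with hθ
  have hθ0 : 0 < θ := by positivity
  have hθ1 : θ ≤ 1 / 2 := by
    rw [hθ, div_le_div_iff₀ (by positivity) two_pos]; linarith
  have hc : 0 < 2 * θ * (1 - θ) * δ / 5 := by
    have : 0 < 1 - θ := by linarith
    positivity
  filter_upwards [eventually_sq_le hκ hc, eventually_ge_atTop 1] with n hn hn1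
  intro U V _ _ _ Ω _ P _ M Da Db _ _ _ _ s A B hU hd hs hz
  classical
  have hpair := hd.pairMoment_of_maxCorrelation_le hθ0 hθ1 hδ0.le (min_le_left _ _)
    (EReal.coe_le_coe_iff.1 hs) hn
  refine (hd.hasScoreMoments.maxRow_le_of_pairMoment hβ hβ1 hn1 hU (min_le_left _ _) hpair hz).mono ?_
  exact Real.rpow_le_rpow_of_exponent_le (by exact_mod_cast hn1) (by linarith)

lemma one_le_elliptic_constant (β : ℝ) : 1 ≤ 1 + 2 * Real.sqrt (β * (1 - β)) := by
  have := Real.sqrt_nonneg (β * (1 - β))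
  linarith

lemma elliptic_constant_half : 1 + 2 * Real.sqrt (1 / 2 * (1 - 1 / 2)) = 2 := by
  have : Real.sqrt (1 / 2 * (1 - 1 / 2)) = 1 / 2 := by
    rw [Real.sqrt_eq_iff_mul_self_eq (by norm_num) (by norm_num)]; norm_num
  rw [this]; norm_num

lemma databaseGuarantee_maxLikelihood {β : ℝ} (hβ : 0 < β) (hβ1 : β ≤ 1 / 2) {κ : ℕ → ℝ}
    (hκ : Tendsto κ atTop (𝓝 0)) :
    ∃ e : ℕ → ℝ, Tendsto e atTop (𝓝 0) ∧ ∀ n : ℕ, 1 ≤ n →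
      DatabaseGuarantee.{u₁, u₂, u₃, u₄, u₅} .maxLikelihood n (κ n)
        ((1 + 2 * Real.sqrt (β * (1 - β))) * Real.log n) ((n : ℝ) ^ (1 - β + e n)) := by
  refine exists_exponent_databaseGuarantee (Or.inr rfl) hβ _ (fun n => (κ n : EReal)) ?_
  intro ε hε
  rcases hβ1.lt_or_eq with hβ2 | rfl
  · obtain ⟨r, θ, hr0, hr1, hθ0, hθ1, hθ, -, hc⟩ := elliptic_params hβ hβ2
    have hr : 0 < 1 - r := by linarith
    -- Half of ε pays for the loss δ of the pair moment, the other half for the constant e² + 1.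
    set δ : ℝ := min 1 (ε * (1 - r) / (4 * β)) with hδ
    have hδ0 : 0 < δ := lt_min one_pos (by positivity)
    have hδε : 2 * β * δ / (1 - r) ≤ ε / 2 := by
      have := min_le_right 1 (ε * (1 - r) / (4 * β))
      rw [← hδ, le_div_iff₀ (by positivity)] at this
      rw [div_le_iff₀ hr]
      linarith
    have hδε0 : 0 ≤ 2 * β * δ / (1 - r) := by positivity
    have hcκ : 0 < 2 * θ * (1 - θ) * δ / 5 := by
      have : 0 < 1 - θ := by linarith
      positivity
    filter_upwards [eventually_sq_le hκ hcκ, eventually_ge_atTop 1,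
      (tendsto_sq_mul_exp_neg_sqrt hr).eventually_le_const one_pos,
      eventually_const_le_rpow (Real.exp 2 + 1) (half_pos hε)] with n hn hn1 hsmall hlarge
    intro U V _ _ _ Ω _ P _ M Da Db _ _ _ _ s A B hU hd hs hz
    classical
    have hpair := hd.pairMoment_of_maxCorrelation_le hθ0 hθ1 hδ0.le (min_le_left _ _)
      (EReal.coe_le_coe_iff.1 hs) hn
    refine (hd.hasScoreMoments.maxLikelihood_le_elliptic (c := 1 + 2 * Real.sqrt (β * (1 - β)))
      hn1 hU hr0 hr1 hθ0.le (by linarith) hθ (min_le_left _ _) (hc δ) hpair hz).mono ?_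
    have hn0 : (0 : ℝ) < n := by exact_mod_cast hn1
    have hn1' : (1 : ℝ) ≤ n := by exact_mod_cast hn1
    set X : ℝ := (n : ℝ) ^ (1 - β + 2 * β * δ / (1 - r)) with hX
    have hX1 : 1 ≤ X := Real.one_le_rpow hn1' (by linarith)
    -- For β < 1/2 the threshold exceeds √n, so the tail n²·exp(-(1-r)e²X) vanishes.
    have hXs : Real.sqrt n ≤ Real.exp 2 * X := by
      have h1 : Real.sqrt n ≤ X := sqrt_le_rpow hn1 (by linarith)
      have h2 : 1 ≤ Real.exp 2 := Real.one_le_exp (by norm_num)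
      nlinarith
    have htail : (n : ℝ) * (n * Real.exp (-((1 - r) * (Real.exp 2 * X)))) ≤ 1 := by
      refine le_trans ?_ hsmall
      rw [← mul_assoc, ← sq]
      gcongr
    calc Real.exp 2 * X + n * (n * Real.exp (-((1 - r) * (Real.exp 2 * X))))
        ≤ (Real.exp 2 + 1) * X := by linarith
      _ ≤ (n : ℝ) ^ (ε / 2) * X := by gcongr
      _ = (n : ℝ) ^ (ε / 2 + (1 - β + 2 * β * δ / (1 - r))) := by rw [hX, ← Real.rpow_add hn0]
      _ ≤ (n : ℝ) ^ (1 - β + ε) := Real.rpow_le_rpow_of_exponent_le hn1' (by linarith)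
  -- At β = 1/2 the union over cycles applies, with constant 2 and no use of small correlation.
  · filter_upwards [eventually_ge_atTop 1, eventually_const_le_rpow 2 hε] with n hn1 hlarge
    intro U V _ _ _ Ω _ P _ M Da Db _ _ _ _ s A B hU hd hs hz
    classical
    rw [elliptic_constant_half] at hz
    refine (hd.hasScoreMoments.maxLikelihood_le_sqrt hn1 hU hz).mono ?_
    have hn0 : (0 : ℝ) < n := by exact_mod_cast hn1
    rw [Real.rpow_add hn0, mul_comm, Real.sqrt_eq_rpow, show (1 - 1 / 2 : ℝ) = 1 / 2 by norm_num]
    gcongr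

lemma plantedGuarantee_maxLikelihood {β : ℝ} (hβ : 0 < β) (hβ1 : β ≤ 1 / 2) :
    ∀ᶠ n : ℕ in atTop, PlantedGuarantee.{u₁, u₂, u₃} .maxLikelihood n
      ((1 + 2 * Real.sqrt (β * (1 - β))) * Real.log n) (2 * (n : ℝ) ^ (1 - β)) := by
  rcases hβ1.lt_or_eq with hβ2 | rfl
  · obtain ⟨r, θ, hr0, hr1, hθ0, hθ1, hθ, hcβ, hc⟩ := elliptic_params hβ hβ2
    have hlog : Tendsto (fun n : ℕ => Real.exp (-(θ / 20 * Real.sqrt (2 * Real.log n)))) atTop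
        (𝓝 0) := by
      refine Real.tendsto_exp_neg_atTop_nhds_zero.comp ?_
      refine Tendsto.const_mul_atTop (by positivity) (Real.tendsto_sqrt_atTop.comp ?_)
      exact Tendsto.const_mul_atTop two_pos
        (Real.tendsto_log_atTop.comp tendsto_natCast_atTop_atTop)
    filter_upwards [eventually_ge_atTop 1, hlog.eventually_le_const (by norm_num : (0 : ℝ) < 1 / 80),
      (tendsto_sq_mul_exp_neg_sqrt (by norm_num : (0 : ℝ) < 1 / 40)).eventually_le_const
        (by norm_num : (0 : ℝ) < 1 / 20)] with n hn1 hs hsmall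
    intro U V _ _ _ Ω _ P _ M μ W hU hμ hW hz
    classical
    refine (hW.maxLikelihood_le_elliptic hμ hn1 hU hr0 hr1 hθ0.le (by linarith) hθ
      (one_le_elliptic_constant β) hcβ ?_ hz hs).mono ?_
    · have := hc 0
      rw [sub_zero, mul_one] at this
      rw [← sub_zero (1 - (1 - β) * (1 - r)), ← mul_zero (2 * β), ← this]
      ring
    · have hn0 : (0 : ℝ) < n := by exact_mod_cast hn1
      have hn1' : (1 : ℝ) ≤ n := by exact_mod_cast hn1
      set N : ℝ := (n : ℝ) ^ (1 - β) with hN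
      have hN1 : 1 ≤ N := Real.one_le_rpow hn1' (by linarith)
      have hNs : Real.sqrt n ≤ N := sqrt_le_rpow hn1 (by linarith)
      have h1 : Real.exp (-(N / 40)) ≤ Real.exp (-(1 / 40 * Real.sqrt n)) :=
        Real.exp_le_exp.2 (by linarith)
      have h2 : Real.exp (-(N / 19)) ≤ Real.exp (-(1 / 40 * Real.sqrt n)) :=
        Real.exp_le_exp.2 (by linarith)
      set E : ℝ := Real.exp (-(1 / 40 * Real.sqrt n)) with hE
      have hE0 : 0 < E := Real.exp_pos _
      -- The tails are at most 1/10 ≤ N/10, which completes 19/10·N to 2N.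
      have h3 : (n : ℝ) * (Real.exp (-(N / 40)) + n * Real.exp (-(N / 19))) ≤ 1 / 10 := by
        calc (n : ℝ) * (Real.exp (-(N / 40)) + n * Real.exp (-(N / 19)))
            ≤ n * (n * E + n * E) := by
              gcongr
              nlinarith
          _ = 2 * ((n : ℝ) ^ 2 * E) := by ring
          _ ≤ 1 / 10 := by linarith
      linarith
  · filter_upwards [eventually_ge_atTop 1] with n hn1
    intro U V _ _ _ Ω _ P _ M μ W hU hμ hW hz
    classical
    rw [elliptic_constant_half] at hz
    refine ((hW.hasScoreMoments hμ).maxLikelihood_le_sqrt hn1 hU hz).mono ?_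
    rw [Real.sqrt_eq_rpow, show (1 - 1 / 2 : ℝ) = 1 / 2 by norm_num]

end Alignment

open Alignment in
theorem theorem2 (β : ℝ) (hβ : 0 < β) :
    -- threshold testing, parabolic boundary
    (∀ n : ℕ, 1 ≤ n →
      PlantedGuarantee.{u₁, u₂, u₃} .threshold n
        ((Real.sqrt β + Real.sqrt (1 + β)) ^ 2 * Real.log n) (2 * (n : ℝ) ^ (1 - β)) ∧
      DatabaseGuarantee.{u₁, u₂, u₃, u₄, u₅} .threshold n ⊤
        ((Real.sqrt β + Real.sqrt (1 + β)) ^ 2 * Real.log n) (2 * (n : ℝ) ^ (1 - β))) ∧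
    -- maximum row estimation, parabolic boundary
    (β ≤ 1 →
      (∀ n : ℕ, 1 ≤ n →
        PlantedGuarantee.{u₁, u₂, u₃} .maxRow n
          ((1 + Real.sqrt β) ^ 2 * Real.log n) (2 * (n : ℝ) ^ (1 - β))) ∧
      (∀ r : ℕ → ℝ, Tendsto r atTop (𝓝 0) → ∃ e : ℕ → ℝ, Tendsto e atTop (𝓝 0) ∧
        ∀ n : ℕ, 1 ≤ n →
          DatabaseGuarantee.{u₁, u₂, u₃, u₄, u₅} .maxRow n (r n)
            ((1 + Real.sqrt β) ^ 2 * Real.log n) ((n : ℝ) ^ (1 - β + e n)))) ∧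
    -- maximum row estimation, linear boundary
    (1 < β → ∀ n : ℕ, 1 ≤ n →
      PlantedGuarantee.{u₁, u₂, u₃} .maxRow n
        (2 * (1 + β) * Real.log n) (2 * (n : ℝ) ^ (1 - β)) ∧
      DatabaseGuarantee.{u₁, u₂, u₃, u₄, u₅} .maxRow n ⊤
        (2 * (1 + β) * Real.log n) (2 * (n : ℝ) ^ (1 - β))) ∧
    -- maximum likelihood estimation, elliptic boundary
    (β ≤ 1 / 2 →
      (∀ᶠ n : ℕ in atTop,
        PlantedGuarantee.{u₁, u₂, u₃} .maxLikelihood n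
          ((1 + 2 * Real.sqrt (β * (1 - β))) * Real.log n) (2 * (n : ℝ) ^ (1 - β))) ∧
      (∀ r : ℕ → ℝ, Tendsto r atTop (𝓝 0) → ∃ e : ℕ → ℝ, Tendsto e atTop (𝓝 0) ∧
        ∀ n : ℕ, 1 ≤ n →
          DatabaseGuarantee.{u₁, u₂, u₃, u₄, u₅} .maxLikelihood n (r n)
            ((1 + 2 * Real.sqrt (β * (1 - β))) * Real.log n) ((n : ℝ) ^ (1 - β + e n)))) ∧
    -- maximum likelihood estimation, vertical boundary
    (1 / 2 < β → β ≤ 1 → ∀ n : ℕ, 1 ≤ n →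
      PlantedGuarantee.{u₁, u₂, u₃} .maxLikelihood n
        (2 * Real.log n + 2 * Real.log ((Real.sqrt 5 + 1) / 2)) ((n : ℝ) ^ (1 - β)) ∧
      DatabaseGuarantee.{u₁, u₂, u₃, u₄, u₅} .maxLikelihood n ⊤
        (2 * Real.log n + 2 * Real.log ((Real.sqrt 5 + 1) / 2)) ((n : ℝ) ^ (1 - β))) ∧
    -- maximum likelihood estimation, linear boundary
    (1 < β → ∀ᶠ n : ℕ in atTop,
      PlantedGuarantee.{u₁, u₂, u₃} .maxLikelihood n
        ((1 + β) * Real.log n) ((n : ℝ) ^ (1 - β)) ∧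
      DatabaseGuarantee.{u₁, u₂, u₃, u₄, u₅} .maxLikelihood n ⊤
        ((1 + β) * Real.log n) ((n : ℝ) ^ (1 - β))) := by
  refine ⟨fun n hn => ⟨?_, ?_⟩, fun hβ1 => ⟨fun n hn => ?_, fun r hr => ?_⟩,
    fun _ n hn => ⟨?_, ?_⟩, fun hβ1 => ⟨plantedGuarantee_maxLikelihood hβ hβ1, fun r hr =>
      databaseGuarantee_maxLikelihood hβ hβ1 hr⟩, fun _ hβ1 n hn => ⟨?_, ?_⟩, fun hβ1 => ?_⟩
  · intro U V _ _ _ Ω _ P _ M μ W hU hμ hW hz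
    classical
    exact (hW.hasScoreMoments hμ).threshold_le hβ hn hU hz
  · intro U V _ _ _ Ω _ P _ M Da Db _ _ _ _ s A B hU hd _ hz
    classical
    exact hd.hasScoreMoments.threshold_le hβ hn hU hz
  · intro U V _ _ _ Ω _ P _ M μ W hU hμ hW hz
    classical
    -- Planted pair moments hold at every θ, so ε = 0.
    refine ((hW.hasScoreMoments hμ).maxRow_le_of_pairMoment (ε := 0) hβ hβ1 hn hU zero_le_one
      ?_ hz).mono ?_
    · rw [sub_zero, one_mul]
      exact hW.pairMoment _
    · rw [mul_zero, add_zero]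
      have : 0 ≤ (n : ℝ) ^ (1 - β) := by positivity
      linarith
  · exact databaseGuarantee_maxRow hβ hβ1 hr
  · intro U V _ _ _ Ω _ P _ M μ W hU hμ hW hz
    classical
    exact (hW.hasScoreMoments hμ).maxRow_le_linear hn hU hz
  · intro U V _ _ _ Ω _ P _ M Da Db _ _ _ _ s A B hU hd _ hz
    classical
    exact hd.hasScoreMoments.maxRow_le_linear hn hU hz
  · intro U V _ _ _ Ω _ P _ M μ W hU hμ hW hz
    classical
    -- The bound 1 is at most n^(1-β) because β ≤ 1.
    exact ((hW.hasScoreMoments hμ).maxLikelihood_le_one hn hU hz).mono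
      (Real.one_le_rpow (by exact_mod_cast hn) (by linarith))
  · intro U V _ _ _ Ω _ P _ M Da Db _ _ _ _ s A B hU hd _ hz
    classical
    exact (hd.hasScoreMoments.maxLikelihood_le_one hn hU hz).mono
      (Real.one_le_rpow (by exact_mod_cast hn) (by linarith))
  · have hlim : Tendsto (fun n : ℕ => (n : ℝ) ^ ((1 - β) / 2)) atTop (𝓝 0) := by
      have := (tendsto_rpow_neg_atTop (y := (β - 1) / 2) (by linarith)).comp
        (tendsto_natCast_atTop_atTop (R := ℝ))
      refine this.congr fun n => ?_
      simp only [Function.comp_apply]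
      congr 1
      ring
    filter_upwards [eventually_ge_atTop 2,
      hlim.eventually_le_const (by norm_num : (0 : ℝ) < 1 / 3)] with n hn hsmall
    constructor
    · intro U V _ _ _ Ω _ P _ M μ W hU hμ hW hz
      classical
      exact (hW.hasScoreMoments hμ).maxLikelihood_le_linear hn hU hβ1 hz hsmall
    · intro U V _ _ _ Ω _ P _ M Da Db _ _ _ _ s A B hU hd _ hz
      classical
      exact hd.hasScoreMoments.maxLikelihood_le_linear hn hU hβ1 hz hsmall
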